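/- **Setting.** All manifolds are convenient ($c^\infty$-complete) manifolds in the sense of Frölicher–Kriegl–Michor: they are modelled on $c^\infty$-open subsets of a convenient vector space (Hausdorff, locally convex, Mackey complete), and a map is smooth if it sends smooth curves to smooth curves. $TM$ and $T'M$ are the kinematic tangent and cotangent bundles. *Weak subbundle.* Let $M$ be modelled on $\mathbb M$, and let $\mathbb M^\flat$ be a convenient space with a bounded linear injection into the bornological dual $\mathbb M'$. A weak subbundle $T^\flat M\subset T'M$ with fibre $\mathbb M^\flat$ is a convenient vector bundle such that, over the chart domains $U$ of some atlas of $M$, the inclusion $T^\flat M|_U\to T'M|_U$ is the inclusion $U\times\mathbb M^\flat\to U\times\mathbb M'$. For $U\subset M$ open, $\mathfrak A(U)$ is the set of $f\in C^\infty(U)$ such that $df$ is a smooth section of $T^\flat M$ and, in those charts, $d^k_xf(\cdot,u_2,\dots,u_k)\in T^\flat_xM$ for all $k\ge1$, $x\in U$ and $u_i\in T_xM$. *Partial Poisson anchor.* This is a smooth vector bundle morphism $P:T^\flat M\to TM$ with $\langle\xi,P\eta\rangle=-\langle\eta,P\xi\rangle$ such that, for all open $U$, the bracket $\{f,g\}_P=-\langle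 df,P(dg)\rangle$ maps $\mathfrak A(U)\times\mathfrak A(U)$ to $\mathfrak A(U)$ and satisfies the Jacobi identity. *Partial PN structure.* This is a pair $(P,N)$ in which $P$ is a partial Poisson anchor and $N:TM\to TM$ is a smooth $(1,1)$-tensor whose transpose restricts to a smooth bundle morphism $N^t:T^\flat M\to T^\flat M$, such that, for all local vector fields $X,Y$, $[NX,NY]=N([NX,Y]+[X,NY]-N[X,Y])$ ($N$ is Nijenhuis), $N\circ P=P\circ N^t$, and $R(P,N)=0$. The last condition means that, for all local sections $\alpha,\theta$ of $T^\flat M$, with $X=P(\theta)$, the form $L_X(N^t\alpha)-L_{NX}\alpha$ takes its values in $T^\flat M$ and $$[P\alpha,NX]-N[P\alpha,X]=P\big(L_X(N^t\alpha)-L_{NX}\alpha\big).$$ **Hypotheses.** Let $(P,N)$ be a partial PN structure on $(M,T^\flat M)$. Let $\imath:\check M\to M$ be a smooth injective map with injective tangent maps $d\imath(m)$, parametrizing the immersed submanifold $S=\imath(\check M)$. On $\check M$ and its open subsets, let $\mathfrak X^\flat(S,M)$ be the smooth fields along $\imath$ of elements of $T^\flat M$; let $\mathfrak X(S)=d\imath(\mathfrak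 X(\check M))$; let $\mathfrak X^\flat_P(S)$ be the $\alpha\in\mathfrak X^\flat(S,M)$ with $P\alpha\in\mathfrak X(S)$; and let $\mathfrak X^\flat(S)^{\rm ann}$ be the $\alpha\in\mathfrak X^\flat(S,M)$ that vanish on $\mathfrak X(S)$. For $\xi\in T^\flat_{\imath(m)}M$ put $\delta\imath(\xi)=\xi\circ d\imath(m)$. Let $\check M$ carry the induced weak subbundle $T^\flat\check M=\delta\imath(T^\flat M)\subset T'\check M$, that is, a weak subbundle such that $\delta\imath$ maps $\mathfrak X^\flat(S,M)$ to smooth sections of $T^\flat\check M$ and is locally surjective onto them. Assume * (RpP 1) $\mathfrak X^\flat_P(S)+\mathfrak X^\flat(S)^{\rm ann}=\mathfrak X^\flat(S,M)$, as sheaves on $\check M$ (every local section is locally such a sum); * (RpP 2) $\mathfrak X^\flat_P(S)\cap\mathfrak X^\flat(S)^{\rm ann}\subset\ker P$ fibrewise: if $\xi\in T^\flat_{\imath(m)}M$, $P\xi\in d\imath(T_m\check M)$ and $\xi\circ d\imath(m)=0$, then $P\xi=0$; * (RpN) $N(\mathfrak X(S))\subset\mathfrak X(S)$ (over every open subset of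 $\check M$). **Conclusion.** There are fields of linear maps $\check P_m:T^\flat_m\check M\to T_m\check M$ and $\check N_m:T_m\check M\to T_m\check M$ given by $$\check P=d\imath^{-1}\circ P\circ(\delta\imath|_{\mathfrak X^\flat_P(S)})^{-1},\qquad \check N=d\imath^{-1}\circ N\circ d\imath .$$ That is, $\check P\check\xi=v$ if and only if $P\xi=d\imath(v)$ for some $\xi$ with $\delta\imath(\xi)=\check\xi$, and $\check Nv=w$ if and only if $d\imath(w)=N\,d\imath(v)$. Moreover $(\check P,\check N)$ is a partial PN structure on $(\check M,T^\flat\check M)$. In particular $\check P$ is a partial Poisson anchor, $\check N$ is a Nijenhuis tensor, and the two are compatible. -/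

import Mathlib

open Set Filter Topology

noncomputable section

/-! ## Convenient vector spaces and convenient smoothness -/

section ConvenientCalculus

/-- A Mackey-Cauchy sequence: for some bounded absolutely convex set `B`, the differences
`x m - x n` eventually lie in `ε • B`, for every `ε > 0`. -/
def MackeyCauchy {E : Type*} [AddCommGroup E] [Module ℝ E] [TopologicalSpace E]
    (x : ℕ → E) : Prop :=
  ∃ B : Set E, Bornology.IsVonNBounded ℝ B ∧ AbsConvex ℝ B ∧
    ∀ ε : ℝ, 0 < ε → ∃ k : ℕ, ∀ m n : ℕ, k ≤ m → k ≤ n → ∃ b ∈ B, x m - x n = ε • b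

/-- A convenient (`c^∞`-complete) vector space: a Hausdorff locally convex real topological vector
space in which every Mackey-Cauchy sequence converges. -/
class ConvenientSpace (E : Type*) [AddCommGroup E] [Module ℝ E] [TopologicalSpace E] : Prop
    extends IsTopologicalAddGroup E, ContinuousSMul ℝ E, LocallyConvexSpace ℝ E, T2Space E where
  mackey_complete : ∀ x : ℕ → E, MackeyCauchy x → ∃ l : E, Tendsto x atTop (𝓝 l)

variable {E F : Type*} [AddCommGroup E] [Module ℝ E] [TopologicalSpace E]
  [AddCommGroup F] [Module ℝ F] [TopologicalSpace F]

/-- `c` is an infinitely differentiable curve on the (open) set `I` of parameters. -/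
def SmoothCurveOn (c : ℝ → E) (I : Set ℝ) : Prop :=
  ∀ n : ℕ, ∀ t ∈ I, DifferentiableAt ℝ (deriv^[n] c) t

/-- Convenient smoothness on `s`: smooth curves in `s` are mapped to smooth curves. (Curves defined
on an open set of parameters are allowed; since every open interval is diffeomorphic to the line,
it is the same to test with the curves defined on the whole line.) -/
def ConvSmoothOn (f : E → F) (s : Set E) : Prop :=
  ∀ (I : Set ℝ) (c : ℝ → E), IsOpen I → SmoothCurveOn c I → MapsTo c I s →
    SmoothCurveOn (fun t => f (c t)) I

/-- The directional derivative `df(x)v = lim_{t → 0} (f (x + t v) - f x) / t`. -/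
def dirDeriv (f : E → F) (x v : E) : F :=
  deriv (fun t : ℝ => f (x + t • v)) 0

/-- The iterated directional derivative `d^k f(x)(v₁, …, v_k)`. -/
def iterDirDeriv (f : E → F) : List E → E → F
  | [] => f
  | v :: l => fun x => dirDeriv (iterDirDeriv f l) x v

/-- The vector space `E`, to be endowed with its `c^∞`-topology. -/
def CInf (E : Type*) : Type _ := E

/-- The `c^∞`-topology: the final topology for all smooth curves `ℝ → E`. -/
instance instTopologicalSpaceCInf : TopologicalSpace (CInf E) :=
  ⨆ c : {c : ℝ → E // SmoothCurveOn c univ},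
    TopologicalSpace.coinduced (fun t => (c.1 t : CInf E)) inferInstance

end ConvenientCalculus

/-! ## Convenient manifolds

A manifold modelled on the convenient space `E` is a space with an atlas of charts with values in
`c^∞`-open subsets of `E` and smooth chart changes. As for Mathlib's tangent bundle, the kinematic
tangent space at `x` is the model space `E`, a vector of `E` being read in the preferred chart
`chartAt x`; its coordinates in another chart are given by the derivative of the chart change.
Accordingly a vector field is a map `X : M → E`. -/

section Manifolds

variable {E F : Type*} [AddCommGroup E] [Module ℝ E] [TopologicalSpace E]
  [AddCommGroup F] [Module ℝ F] [TopologicalSpace F]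
  {M S : Type*} [TopologicalSpace M] [TopologicalSpace S]

/-- The coordinates of a point in a chart. -/
def coord (e : OpenPartialHomeomorph M (CInf E)) (x : M) : E := e x

/-- The point with given coordinates in a chart. -/
def pointAt (e : OpenPartialHomeomorph M (CInf E)) (y : E) : M := e.symm (y : CInf E)

/-- The part of the target of the chart `e` that corresponds to points of `U`. -/
def dom (e : OpenPartialHomeomorph M (CInf E)) (U : Set M) : Set E :=
  {y | (y : CInf E) ∈ e.target ∧ pointAt e y ∈ U}

variable (E M) in
/-- The charts of the atlas have convenient smooth chart changes. -/
class ConvManifold [ChartedSpace (CInf E) M] : Prop where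
  smooth_change : ∀ e ∈ atlas (CInf E) M, ∀ e' ∈ atlas (CInf E) M,
    ConvSmoothOn (fun y : E => coord e' (pointAt e y)) (dom e e'.source)

variable [ChartedSpace (CInf E) M] [ChartedSpace (CInf F) S]

/-- The differential at `x` of a vector valued function `f` on `M`, applied to `v ∈ T_x M`. -/
def diffAt {G : Type*} [AddCommGroup G] [Module ℝ G] [TopologicalSpace G]
    (f : M → G) (x : M) (v : E) : G :=
  dirDeriv (fun y : E => f (pointAt (chartAt (CInf E) x) y)) (coord (chartAt (CInf E) x) x) v

/-- The coordinates in the chart `e` of the tangent vector `v ∈ T_x M`. -/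
def tcoord (e : OpenPartialHomeomorph M (CInf E)) (x : M) (v : E) : E :=
  diffAt (coord e) x v

/-- The coordinate expression in the chart `e` of the vector field `X`. -/
def vfRep (e : OpenPartialHomeomorph M (CInf E)) (X : M → E) (y : E) : E :=
  tcoord e (pointAt e y) (X (pointAt e y))

/-- `X` is a smooth vector field on `U`. -/
def SmoothVF (X : M → E) (U : Set M) : Prop :=
  ∀ e ∈ atlas (CInf E) M, ConvSmoothOn (vfRep e X) (dom e U)

/-- The Lie bracket `[X, Y]` of vector fields at `x`, that is `dY(X) - dX(Y)` in a chart. -/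
def lieBr (X Y : M → E) (x : M) : E :=
  dirDeriv (vfRep (chartAt (CInf E) x) Y) (coord (chartAt (CInf E) x) x) (X x) -
    dirDeriv (vfRep (chartAt (CInf E) x) X) (coord (chartAt (CInf E) x) x) (Y x)

/-- `(L_X ω)(Y) = X (ω(Y)) - ω([X, Y])` at `x`, for a field `ω` of covectors. -/
def lieCovector (X : M → E) (ω : M → E → ℝ) (Y : M → E) (x : M) : ℝ :=
  diffAt (fun z => ω z (Y z)) x (X x) - ω x (lieBr X Y x)

/-- The tangent map `T_m ι : T_m S → T_{ι m} M` of a map `ι : S → M`. -/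
def tangentMapAt (E : Type*) [AddCommGroup E] [Module ℝ E] [TopologicalSpace E]
    [ChartedSpace (CInf E) M] (ι : S → M) (m : S) (v : F) : E :=
  diffAt (fun m' => coord (chartAt (CInf E) (ι m)) (ι m')) m v

variable (E F) in
/-- Smooth maps between convenient manifolds. -/
structure IsConvSmooth (ι : S → M) : Prop where
  continuous : Continuous ι
  smooth : ∀ e' ∈ atlas (CInf F) S, ∀ e ∈ atlas (CInf E) M,
    ConvSmoothOn (fun y : F => coord e (ι (pointAt e' y))) (dom e' (ι ⁻¹' e.source))

variable (E F) in
/-- A parametrized immersed submanifold: `ι` is smooth and injective, and so are (as linear maps)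
all its tangent maps. -/
structure IsInjectiveImmersion (ι : S → M) : Prop where
  smooth : IsConvSmooth E F ι
  injective : Function.Injective ι
  injective_tangentMap : ∀ m : S, Function.Injective (tangentMapAt E ι m : F → E)

/-- A field of endomorphisms `N` of the tangent spaces is a smooth bundle morphism `TM → TM`,
i.e. a tensor of type `(1,1)`. -/
def IsSmoothEndo (N : M → E →ₗ[ℝ] E) : Prop :=
  ∀ e ∈ atlas (CInf E) M, ∃ n : E × E → E, ConvSmoothOn n (dom e univ ×ˢ univ) ∧
    ∀ x ∈ e.source, ∀ v : E, tcoord e x (N x v) = n (coord e x, tcoord e x v)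

/-- The torsion of `N` vanishes:
`[NX, NY] = N ([NX, Y] + [X, NY] - N [X, Y])` for all local vector fields `X`, `Y`. -/
def IsNijenhuis (N : M → E →ₗ[ℝ] E) : Prop :=
  ∀ (U : Set M) (X Y : M → E), IsOpen U → SmoothVF X U → SmoothVF Y U → ∀ x ∈ U,
    lieBr (fun z => N z (X z)) (fun z => N z (Y z)) x =
      N x (lieBr (fun z => N z (X z)) Y x + lieBr X (fun z => N z (Y z)) x - N x (lieBr X Y x))

end Manifolds

/-! ## Weak subbundles of the cotangent bundle, partial Poisson and partial PN structures -/

section PartialPoisson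

/-- The typical fibre `E^♭` of a weak subbundle: a space `Eb` with a bounded linear injection into
the bornological dual `E'` of `E`, given as a left nondegenerate bounded bilinear pairing. -/
structure FlatModel (E Eb : Type*) [AddCommGroup E] [Module ℝ E] [TopologicalSpace E]
    [AddCommGroup Eb] [Module ℝ Eb] [TopologicalSpace Eb] where
  pair : Eb →ₗ[ℝ] E →ₗ[ℝ] ℝ
  injective : ∀ ξ : Eb, (∀ v : E, pair ξ v = 0) → ξ = 0
  bounded : ∀ (K : Set Eb) (A : Set E), Bornology.IsVonNBounded ℝ K →
    Bornology.IsVonNBounded ℝ A → Bornology.IsVonNBounded ℝ (image2 (fun ξ v => pair ξ v) K A)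

variable {E Eb F Fb : Type*} [AddCommGroup E] [Module ℝ E] [TopologicalSpace E]
  [AddCommGroup Eb] [Module ℝ Eb] [TopologicalSpace Eb]
  [AddCommGroup F] [Module ℝ F] [TopologicalSpace F]
  [AddCommGroup Fb] [Module ℝ Fb] [TopologicalSpace Fb]
  {M S : Type*} [TopologicalSpace M] [TopologicalSpace S]
  [ChartedSpace (CInf E) M] [ChartedSpace (CInf F) S]

variable (M) in
/-- A weak subbundle `T^♭M` of the cotangent bundle `T'M` with typical fibre `E^♭`: over the domain
of each chart `e` of the atlas, the inclusion `T^♭M → T'M` is the inclusion of `e.target × E^♭`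
into `e.target × E'`. So the transposed derivatives of the chart changes have to map `E^♭` to `E^♭`,
and to define smooth transition maps of the convenient vector bundle `T^♭M`.
The fibre `T^♭_x M` is the space `Eb`, read in the preferred chart at `x`. -/
class WeakSubbundle (β : FlatModel E Eb) : Prop where
  transpose_change : ∀ e ∈ atlas (CInf E) M, ∀ e' ∈ atlas (CInf E) M,
    ∃ τ : E × Eb → Eb, ConvSmoothOn τ (dom e e'.source ×ˢ univ) ∧
      ∀ y ∈ dom e e'.source, ∀ (η : Eb) (v : E),
        β.pair (τ (y, η)) v = β.pair η (dirDeriv (fun z : E => coord e' (pointAt e z)) y v)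

/-- `η ∈ E^♭` represents in the chart `e` the covector `ξ ∈ T^♭_x M`. -/
def FlatCoord (β : FlatModel E Eb) (e : OpenPartialHomeomorph M (CInf E)) (x : M)
    (ξ η : Eb) : Prop :=
  ∀ v : E, β.pair ξ v = β.pair η (tcoord e x v)

/-- `α` is a smooth section of `T^♭M` over `U`. -/
def SmoothFlatSection (β : FlatModel E Eb) (α : M → Eb) (U : Set M) : Prop :=
  ∀ e ∈ atlas (CInf E) M, ∃ a : E → Eb, ConvSmoothOn a (dom e U) ∧
    ∀ x ∈ U ∩ e.source, FlatCoord β e x (α x) (a (coord e x))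

/-- The space `𝔄(U)`: the smooth functions `f` on `U` whose differential is a (smooth) section of
`T^♭M` over `U` and whose derivatives satisfy `d^k_x f(·, u₂, …, u_k) ∈ T^♭_x M` for all `k ≥ 1`. -/
structure IsAdmissible (β : FlatModel E Eb) (f : M → ℝ) (U : Set M) : Prop where
  smooth : ∀ e ∈ atlas (CInf E) M, ConvSmoothOn (fun y : E => f (pointAt e y)) (dom e U)
  differential : ∀ e ∈ atlas (CInf E) M, ∃ a : E → Eb, ConvSmoothOn a (dom e U) ∧
    ∀ y ∈ dom e U, ∀ v : E, β.pair (a y) v = dirDeriv (fun z : E => f (pointAt e z)) y v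
  higher : ∀ e ∈ atlas (CInf E) M, ∀ y ∈ dom e U, ∀ u : List E, ∃ η : Eb, ∀ v : E,
    β.pair η v = iterDirDeriv (fun z : E => f (pointAt e z)) (v :: u) y

/-- The differential of `f` at `x` as an element of `T^♭_x M` (when it is one). -/
def flatDiff (β : FlatModel E Eb) (f : M → ℝ) (x : M) : Eb :=
  Classical.epsilon fun ξ : Eb => ∀ v : E, β.pair ξ v = diffAt f x v

/-- The bracket `{f, g}_P = -⟨df, P(dg)⟩`. -/
def poissonBr (β : FlatModel E Eb) (P : M → Eb →ₗ[ℝ] E) (f g : M → ℝ) (x : M) : ℝ :=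
  -β.pair (flatDiff β f x) (P x (flatDiff β g x))

/-- The field of linear maps `P x : T^♭_x M → T_x M` is a smooth bundle morphism. -/
def IsSmoothAnchor (β : FlatModel E Eb) (P : M → Eb →ₗ[ℝ] E) : Prop :=
  ∀ e ∈ atlas (CInf E) M, ∃ p : E × Eb → E, ConvSmoothOn p (dom e univ ×ˢ univ) ∧
    ∀ x ∈ e.source, ∀ ξ η : Eb, FlatCoord β e x ξ η → tcoord e x (P x ξ) = p (coord e x, η)

/-- `P : T^♭M → TM` is a partial Poisson anchor: an antisymmetric smooth bundle morphism whose
bracket maps `𝔄(U) × 𝔄(U)` to `𝔄(U)` and satisfies the Jacobi identity, for all open `U`. -/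
structure IsPartialPoisson (β : FlatModel E Eb) (P : M → Eb →ₗ[ℝ] E) : Prop where
  smooth : IsSmoothAnchor β P
  antisymm : ∀ (x : M) (ξ η : Eb), β.pair ξ (P x η) = -β.pair η (P x ξ)
  bracket_mem : ∀ (U : Set M) (f g : M → ℝ), IsOpen U → IsAdmissible β f U →
    IsAdmissible β g U → IsAdmissible β (poissonBr β P f g) U
  jacobi : ∀ (U : Set M) (f g h : M → ℝ), IsOpen U → IsAdmissible β f U →
    IsAdmissible β g U → IsAdmissible β h U → ∀ x ∈ U,
      poissonBr β P f (poissonBr β P g h) x + poissonBr β P g (poissonBr β P h f) x +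
        poissonBr β P h (poissonBr β P f g) x = 0

/-- `Nt` is the restriction to `T^♭M` of the transpose of `N`, and it is a smooth bundle morphism
`T^♭M → T^♭M`. -/
structure IsFlatTranspose (β : FlatModel E Eb) (N : M → E →ₗ[ℝ] E) (Nt : M → Eb →ₗ[ℝ] Eb) :
    Prop where
  transpose : ∀ (x : M) (ξ : Eb) (v : E), β.pair (Nt x ξ) v = β.pair ξ (N x v)
  smooth : ∀ e ∈ atlas (CInf E) M, ∃ q : E × Eb → Eb, ConvSmoothOn q (dom e univ ×ˢ univ) ∧
    ∀ x ∈ e.source, ∀ ξ η : Eb, FlatCoord β e x ξ η →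
      FlatCoord β e x (Nt x ξ) (q (coord e x, η))

/-- The concomitant vanishes: for all local sections `α` of `T^♭M` and `X = P(θ)` of `im P`,
`L_{P(α)}(N) X - P (L_X (N^t α)) + P (L_{NX} α) = 0`. Here `P` is applied to the difference
`γ = L_X (N^t α) - L_{NX} α`, which has to take its values in `T^♭M` (the two terms separately
need not do so). -/
def ConcomitantVanishes (β : FlatModel E Eb) (P : M → Eb →ₗ[ℝ] E) (N : M → E →ₗ[ℝ] E)
    (Nt : M → Eb →ₗ[ℝ] Eb) : Prop :=
  ∀ (U : Set M) (α θ : M → Eb), IsOpen U → SmoothFlatSection β α U → SmoothFlatSection β θ U →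
    ∀ x ∈ U, ∃ γ : Eb,
      (∀ (V : Set M) (Y : M → E), IsOpen V → x ∈ V → V ⊆ U → SmoothVF Y V →
        β.pair γ (Y x) =
          lieCovector (fun z => P z (θ z)) (fun z => β.pair (Nt z (α z))) Y x -
          lieCovector (fun z => N z (P z (θ z))) (fun z => β.pair (α z)) Y x) ∧
      lieBr (fun z => P z (α z)) (fun z => N z (P z (θ z))) x -
        N x (lieBr (fun z => P z (α z)) (fun z => P z (θ z)) x) = P x γ

/-- A partial PN structure: a partial Poisson anchor `P` and a Nijenhuis tensor `N`, whose
transpose preserves `T^♭M`, with `N ∘ P = P ∘ N^t` and `R(P, N) = 0`. -/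
structure IsPartialPN (β : FlatModel E Eb) (P : M → Eb →ₗ[ℝ] E) (N : M → E →ₗ[ℝ] E) : Prop where
  poisson : IsPartialPoisson β P
  smooth : IsSmoothEndo N
  nijenhuis : IsNijenhuis N
  compatible : ∃ Nt : M → Eb →ₗ[ℝ] Eb, IsFlatTranspose β N Nt ∧
    (∀ (x : M) (ξ : Eb), N x (P x ξ) = P x (Nt x ξ)) ∧ ConcomitantVanishes β P N Nt

/-! ### Restriction to an immersed submanifold `ι : S → M` -/

/-- `δι(ξ) = ξ'`, i.e. `ξ' = ξ ∘ T_m ι`, for `ξ ∈ T^♭_{ι m} M` and `ξ' ∈ T^♭_m S`. -/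
def IsPullback (β : FlatModel E Eb) (βS : FlatModel F Fb) (ι : S → M) (m : S)
    (ξ : Eb) (ξ' : Fb) : Prop :=
  ∀ v : F, βS.pair ξ' v = β.pair ξ (tangentMapAt E ι m v)

/-- `α` belongs to `𝔛^♭(S, M)` over the part `V` of `S`: it is a smooth field, along `ι`, of
elements of `T^♭M`. -/
def SmoothFlatAlong (β : FlatModel E Eb) (ι : S → M) (α : S → Eb) (V : Set S) : Prop :=
  ∀ e' ∈ atlas (CInf F) S, ∀ e ∈ atlas (CInf E) M, ∃ a : F → Eb,
    ConvSmoothOn a (dom e' (V ∩ ι ⁻¹' e.source)) ∧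
      ∀ m ∈ V ∩ e'.source, ι m ∈ e.source → FlatCoord β e (ι m) (α m) (a (coord e' m))

/-- `T^♭S` is the weak subbundle induced by `T^♭M`, with fibres `δι(T^♭_{ι m} M)`: `δι` maps
(local) sections in `𝔛^♭(S, M)` to sections of `T^♭S`, and is (locally) surjective. -/
structure IsInducedSubbundle (β : FlatModel E Eb) (βS : FlatModel F Fb) (ι : S → M) : Prop where
  maps : ∀ (V : Set S) (α : S → Eb), IsOpen V → SmoothFlatAlong (F := F) β ι α V →
    ∃ α' : S → Fb, SmoothFlatSection βS α' V ∧ ∀ m ∈ V, IsPullback β βS ι m (α m) (α' m)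
  surjective : ∀ (V : Set S) (α' : S → Fb), IsOpen V → SmoothFlatSection βS α' V → ∀ m ∈ V,
    ∃ (W : Set S) (α : S → Eb), IsOpen W ∧ m ∈ W ∧ W ⊆ V ∧ SmoothFlatAlong (F := F) β ι α W ∧
      ∀ m' ∈ W, IsPullback β βS ι m' (α m') (α' m')

variable (F) in
/-- `α` belongs to `𝔛^♭_P(S)` over `V`: it is in `𝔛^♭(S, M)` and `P(α)` is (the image under `dι`
of a smooth vector field) tangent to `S`. -/
def IsTangentForm (β : FlatModel E Eb) (P : M → Eb →ₗ[ℝ] E) (ι : S → M) (α : S → Eb)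
    (V : Set S) : Prop :=
  SmoothFlatAlong (F := F) β ι α V ∧
    ∃ X : S → F, SmoothVF X V ∧ ∀ m ∈ V, P (ι m) (α m) = tangentMapAt E ι m (X m)

variable (F) in
/-- `α` belongs to the partial annihilator `𝔛^♭(S)^ann` over `V`. -/
def IsAnnForm (β : FlatModel E Eb) (ι : S → M) (α : S → Eb) (V : Set S) : Prop :=
  SmoothFlatAlong (F := F) β ι α V ∧
    ∀ m ∈ V, ∀ v : F, β.pair (α m) (tangentMapAt E ι m v) = 0

variable (F) in
/-- `𝔛^♭_P(S) + 𝔛^♭(S)^ann = 𝔛^♭(S, M)`, as sheaves on `S`. -/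
def RpP1 (β : FlatModel E Eb) (P : M → Eb →ₗ[ℝ] E) (ι : S → M) : Prop :=
  ∀ (V : Set S) (α : S → Eb), IsOpen V → SmoothFlatAlong (F := F) β ι α V → ∀ m ∈ V,
    ∃ (W : Set S) (α₁ α₂ : S → Eb), IsOpen W ∧ m ∈ W ∧ W ⊆ V ∧ IsTangentForm F β P ι α₁ W ∧
      IsAnnForm F β ι α₂ W ∧ ∀ m' ∈ W, α m' = α₁ m' + α₂ m'

variable (F) in
/-- `𝔛^♭_P(S) ∩ 𝔛^♭(S)^ann ⊂ ker P`, fibre by fibre. -/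
def RpP2 (β : FlatModel E Eb) (P : M → Eb →ₗ[ℝ] E) (ι : S → M) : Prop :=
  ∀ (m : S) (ξ : Eb), (∃ v : F, P (ι m) ξ = tangentMapAt E ι m v) →
    (∀ v : F, β.pair ξ (tangentMapAt E ι m v) = 0) → P (ι m) ξ = 0

variable (F) in
/-- `N(𝔛(S)) ⊂ 𝔛(S)`, where `𝔛(S)` consists of the images under `dι` of the vector fields
on (open parts of) `S`. -/
def RpN (N : M → E →ₗ[ℝ] E) (ι : S → M) : Prop :=
  ∀ (V : Set S) (X : S → F), IsOpen V → SmoothVF X V →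
    ∃ Y : S → F, SmoothVF Y V ∧
      ∀ m ∈ V, N (ι m) (tangentMapAt E ι m (X m)) = tangentMapAt E ι m (Y m)

end PartialPoisson

end

set_option linter.unusedSectionVars false

noncomputable section
open Asymptotics
open scoped ContDiff Pointwise

/-! ## Bounded sets and derivatives of curves in locally convex spaces -/

/-! The reduced anchor is well defined because every covector of T^♭S lifts locally to a section
along ι, (RpP 1) corrects the lift by an annihilating section so that its image under P becomes
tangent, and (RpP 2) makes that image independent of the lift. The tensor N' is the restriction of
N, unique by injectivity of dι; its transpose is found by lifting a covector, applying N^t and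
pulling back. Antisymmetry and N∘P = P∘N^t are inherited by evaluation on lifts.

The differential identities are compared in charts. Let i be the coordinate expression of ι.
Differentiating the relations ⟨a, Di w⟩ = ⟨a', w⟩, p(i) a = Di(p' a') and n(i) Di = Di n' expresses
the derivatives of p' and n' through those of p and n, up to terms with D²i and with derivatives of
the lifts. The former cancel by symmetry of D²i, the latter by antisymmetry of p or by n p = p n^t.
Jacobi identity, torsion and concomitant are tensorial, so all this takes place at single points
(`IsLocalReduction.jacobi`, `IsLocalReduction.torsion`, `IsLocalReduction.concomitant`).

That the bracket preserves admissible functions is not an identity. On M, brackets of functions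
linear in a chart show that the covector ⟨ξ, dp(·)η⟩ lies in E^♭, and brackets with nonlinear
functions that it depends smoothly on all arguments (`exists_anchor_derivative`). The corresponding
covector on S is obtained by pull-back (`IsLocalReduction.exists_derivative`), and this suffices
there (`isPartialPoisson_of_local`).

The analysis rests on curves, since they define smoothness. Linearity of derivatives, the chain rule
and Schwarz's theorem follow from Boman's theorem in the plane, which is proved by special curves
through rapidly converging points and decay of Fourier transforms. The reduced bundle maps are at
first known to be smooth only on sections. Sections with an arbitrary smooth curve of values along a
line, together with special curves and uniform boundedness, show that each fibre map is bounded
(`isBoundedLinear_of_forall_curve`); a pointwise smooth family of bounded maps is jointly smooth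
(`convSmoothOn_family`). -/

theorem Seminorm.exists_bound_of_forall_functional {E : Type*} [AddCommGroup E] [Module ℝ E]
    (p : Seminorm ℝ E) (s : Set E)
    (h : ∀ l : E →ₗ[ℝ] ℝ, (∃ C, ∀ x, |l x| ≤ C * p x) → ∃ C, ∀ x ∈ s, |l x| ≤ C) :
    ∃ r, ∀ x ∈ s, p x ≤ r := by
  let _ : SeminormedAddCommGroup E := p.toSeminormedAddCommGroup
  let _ : NormedSpace ℝ E := ⟨fun a b => (map_smul_eq_mul p a b).le⟩
  have hn : ∀ x : E, ‖x‖ = p x := fun x => rfl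
  -- The points of `s`, seen in the bidual, form a pointwise bounded family of operators on the
  -- dual; the dual is complete even if the seminormed space is neither complete nor separated.
  obtain ⟨C, hC⟩ := banach_steinhaus
    (g := fun x : s => NormedSpace.inclusionInDoubleDual ℝ E x.1) (fun l => by
      obtain ⟨C, hC⟩ := h l.toLinearMap ⟨‖l‖, fun x => l.le_opNorm x⟩
      exact ⟨C, fun x => hC x.1 x.2⟩)
  refine ⟨C, fun x hx => ?_⟩
  obtain ⟨g, hg1, hg⟩ := exists_dual_vector'' ℝ x
  have h1 := (NormedSpace.inclusionInDoubleDual ℝ E x).le_opNorm g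
  rw [NormedSpace.dual_def, hg] at h1
  have h2 := hC ⟨x, hx⟩
  rw [← hn]
  have h3 : ‖x‖ ≤ ‖NormedSpace.inclusionInDoubleDual ℝ E x‖ * ‖g‖ := by simpa using h1
  calc ‖x‖ ≤ _ := h3
    _ ≤ C * 1 := by gcongr; exact (norm_nonneg _).trans h2
    _ = C := mul_one C

section
variable {E : Type*} [AddCommGroup E] [Module ℝ E] [TopologicalSpace E]
  [IsTopologicalAddGroup E] [ContinuousSMul ℝ E] [LocallyConvexSpace ℝ E]

/-- Mackey's theorem: in a locally convex space, weakly bounded sets are bounded. -/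
theorem isVonNBounded_of_forall_dual {s : Set E}
    (h : ∀ l : E →L[ℝ] ℝ, ∃ C, ∀ x ∈ s, |l x| ≤ C) : Bornology.IsVonNBounded ℝ s := by
  have hw := PolynormableSpace.withSeminorms ℝ E
  rw [hw.isVonNBounded_iff_seminorm_bounded]
  rintro ⟨p, hp⟩
  obtain ⟨r, hr⟩ := p.exists_bound_of_forall_functional s (fun l ⟨C, hC⟩ => by
    have hl : Continuous l := by
      refine WithSeminorms.continuous_of_isBounded hw (norm_withSeminorms ℝ ℝ) l ?_
      intro _
      refine ⟨{⟨p, hp⟩}, (max C 0).toNNReal, fun x => ?_⟩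
      have : |l x| ≤ max C 0 * p x := (hC x).trans (by gcongr; exact le_max_left _ _)
      simpa [NNReal.smul_def] using this
    exact h ⟨l, hl⟩)
  refine ⟨max r 0 + 1, by positivity, fun x hx => ?_⟩
  have := hr x hx
  exact this.trans_lt ((le_max_left r 0).trans_lt (lt_add_one _))

theorem Bornology.IsVonNBounded.exists_dual_bound {s : Set E} (hs : Bornology.IsVonNBounded ℝ s)
    (l : E →L[ℝ] ℝ) : ∃ C, ∀ x ∈ s, |l x| ≤ C := by
  have := hs.image l
  rw [NormedSpace.isVonNBounded_iff, isBounded_iff_forall_norm_le] at this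
  obtain ⟨C, hC⟩ := this
  exact ⟨C, fun x hx => hC _ (mem_image_of_mem _ hx)⟩

/-- A bound |l| ≤ C on `s` persists on the hull, since the preimage of a closed ball is closed and
absolutely convex; Mackey's theorem turns these scalar bounds back into boundedness. Such hulls are
the disks on which uniform boundedness is applied. -/
theorem isVonNBounded_closedAbsConvexHull {s : Set E} (hs : Bornology.IsVonNBounded ℝ s) :
    Bornology.IsVonNBounded ℝ (closedAbsConvexHull ℝ s) := by
  refine isVonNBounded_of_forall_dual fun l => ?_
  obtain ⟨C, hC⟩ := hs.exists_dual_bound l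
  refine ⟨C, fun x hx => ?_⟩
  have hA : AbsConvex ℝ (l ⁻¹' Metric.closedBall 0 C) := by
    refine ⟨?_, (convex_closedBall _ _).linear_preimage l.toLinearMap⟩
    intro a ha
    rintro _ ⟨y, hy, rfl⟩
    simp only [mem_preimage, mem_closedBall_zero_iff] at hy ⊢
    rw [map_smul, norm_smul]
    exact (mul_le_of_le_one_left (norm_nonneg _) ha).trans hy
  have := closedAbsConvexHull_min (fun y hy => by simpa using hC y hy) hA
    (Metric.isClosed_closedBall.preimage l.continuous) hx
  simpa using this

/-- A bounded set is absorbed by every neighbourhood of 0, so a remainder (y - t)² b with b in it is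
o(y - t). This is how derivatives are produced without norms. -/
theorem hasDerivAt_of_bounded_remainder {c : ℝ → E} {l : E} {t : ℝ} {B : Set E}
    (hB : Bornology.IsVonNBounded ℝ B)
    (h : ∀ᶠ y in 𝓝 t, ∃ b ∈ B, c y - c t - (y - t) • l = (y - t) ^ 2 • b) :
    HasDerivAt c l t := by
  refine HasFDerivAt.of_isLittleOTVS ?_
  constructor
  intro U hU
  obtain ⟨V, ⟨hV, hVb, hVc⟩, hVU⟩ := (nhds_hasBasis_absConvex ℝ E).mem_iff.1 hU
  obtain ⟨r, hr0, hr⟩ := (hB hV).exists_pos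
  refine ⟨Metric.ball 0 1, Metric.ball_mem_nhds _ one_pos, fun ε hε => ?_⟩
  have hε' : (0:ℝ) < ε := by positivity
  -- On this range (y - t)² r ≤ ε |y - t|.
  have hnear : ∀ᶠ y in 𝓝 t, |y - t| < ε / r := by
    have : Tendsto (fun y : ℝ => |y - t|) (𝓝 t) (𝓝 0) := by
      have h : Continuous fun y : ℝ => |y - t| := by fun_prop
      simpa using h.tendsto t
    exact this.eventually_lt_const (by positivity)
  filter_upwards [h, hnear] with y ⟨b, hb, hy⟩ hyt
  have hbV : b ∈ r • V := hr r (by simp [abs_of_pos hr0]) hb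
  have hmem : c y - c t - (y - t) • l ∈ ((y - t) ^ 2 * r) • V := by
    rw [hy, mul_smul]; exact smul_mem_smul_set hbV
  have h1 : egauge ℝ U (c y - c t - (ContinuousLinearMap.toSpanSingleton ℝ l) (y - t)) ≤
      ‖((y - t) ^ 2 * r)‖ₑ := by
    refine (egauge_anti ℝ hVU _).trans (egauge_le_of_mem_smul ?_)
    simpa using hmem
  refine h1.trans ?_
  have h2 : ‖y - t‖ₑ ≤ egauge ℝ (Metric.ball (0:ℝ) 1) (y - t) := by
    have := div_le_egauge_ball ℝ 1 (y - t)
    simpa using this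
  refine le_trans ?_ (mul_le_mul_right h2 _)
  rw [← ofReal_norm, ← ofReal_norm, ← ENNReal.ofReal_coe_nnreal,
    ← ENNReal.ofReal_mul (by positivity)]
  refine ENNReal.ofReal_le_ofReal ?_
  rw [norm_mul, norm_pow, Real.norm_eq_abs, Real.norm_eq_abs, abs_of_pos hr0]
  rw [lt_div_iff₀ hr0] at hyt
  nlinarith [abs_nonneg (y - t)]

theorem eq_of_forall_dual [T2Space E] {x y : E} (h : ∀ l : E →L[ℝ] ℝ, l x = l y) : x = y := by
  by_contra hxy
  obtain ⟨f, hf⟩ := SeparatingDual.exists_ne_zero (R := ℝ) (sub_ne_zero.2 hxy)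
  exact hf (by rw [map_sub, h f, sub_self])

end

/-- Difference quotients of a `C²` function are Lipschitz. -/
theorem exists_lipschitz_slope {g : ℝ → ℝ} {I : Set ℝ} (hI : IsOpen I) (hg : ContDiffOn ℝ 2 g I)
    {t δ : ℝ} (hδ : Metric.closedBall t δ ⊆ I) :
    ∃ C, ∀ h h' : ℝ, |h| ≤ δ → |h'| ≤ δ → h ≠ 0 → h' ≠ 0 →
      |h⁻¹ * (g (t + h) - g t) - h'⁻¹ * (g (t + h') - g t)| ≤ C * |h - h'| := by
  have h1 : ContDiffOn ℝ 1 (deriv g) I :=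
    ((contDiffOn_succ_iff_deriv_of_isOpen (n := 1) hI).1 (by rw [one_add_one_eq_two]; exact hg)).2.2
  have h2 : ContDiffOn ℝ 0 (deriv (deriv g)) I :=
    ((contDiffOn_succ_iff_deriv_of_isOpen (n := 0) hI).1 (by simpa using h1)).2.2
  obtain ⟨C, hC⟩ := (isCompact_closedBall t δ).exists_bound_of_continuousOn
    (h2.continuousOn.mono hδ)
  have hd : ∀ x ∈ I, HasDerivAt g (deriv g x) x := fun x hx =>
    ((hg.differentiableOn (by norm_num)).differentiableAt (hI.mem_nhds hx)).hasDerivAt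
  have hd' : ∀ x ∈ I, HasDerivAt (deriv g) (deriv (deriv g) x) x := fun x hx =>
    ((h1.differentiableOn (by norm_num)).differentiableAt (hI.mem_nhds hx)).hasDerivAt
  refine ⟨C, fun h h' hh hh' h0 h0' => ?_⟩
  have hmem : ∀ k : ℝ, |k| ≤ δ → ∀ r ∈ Icc (0:ℝ) 1, t + r * k ∈ Metric.closedBall t δ := by
    intro k hk r hr
    rw [Metric.mem_closedBall, Real.dist_eq, add_sub_cancel_left, abs_mul, abs_of_nonneg hr.1]
    exact (mul_le_of_le_one_left (abs_nonneg _) hr.2).trans hk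
  -- The quotient with step k is the value at r = 1 of a function of r that vanishes at r = 0 and
  -- has derivative g'(t + r k). Two quotients are compared through these derivatives, which a
  -- second mean value estimate controls by g''.
  have hder : ∀ k : ℝ, |k| ≤ δ → k ≠ 0 → ∀ r ∈ Icc (0:ℝ) 1,
      HasDerivAt (fun r => k⁻¹ * (g (t + r * k) - g t)) (deriv g (t + r * k)) r := by
    intro k hk hk0 r hr
    have e : HasDerivAt (fun r : ℝ => t + r * k) (1 * k) r :=
      ((hasDerivAt_id r).mul_const k).const_add t
    have := (((hd _ (hδ (hmem k hk r hr))).comp r e).sub_const (g t)).const_mul k⁻¹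
    refine this.congr_deriv ?_
    field_simp
  have hmv := (convex_Icc (0:ℝ) 1).norm_image_sub_le_of_norm_hasDerivWithin_le
    (f := fun r => h⁻¹ * (g (t + r * h) - g t) - h'⁻¹ * (g (t + r * h') - g t))
    (f' := fun r => deriv g (t + r * h) - deriv g (t + r * h')) (C := C * |h - h'|)
    (fun r hr => ((hder h hh h0 r hr).sub (hder h' hh' h0' r hr)).hasDerivWithinAt)
    (fun r hr => by
      have := (convex_closedBall t δ).norm_image_sub_le_of_norm_hasDerivWithin_le
        (f := deriv g) (f' := deriv (deriv g)) (C := C)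
        (fun x hx => (hd' x (hδ hx)).hasDerivWithinAt) (fun x hx => hC x hx)
        (hmem h' hh' r hr) (hmem h hh r hr)
      refine this.trans ?_
      have hC0 : 0 ≤ C := (norm_nonneg _).trans (hC _ (hmem h hh r hr))
      gcongr
      have : t + r * h - (t + r * h') = r * (h - h') := by ring
      rw [this, norm_mul, Real.norm_eq_abs, abs_of_nonneg hr.1]
      exact mul_le_of_le_one_left (abs_nonneg _) hr.2)
    (left_mem_Icc.2 zero_le_one) (right_mem_Icc.2 zero_le_one)
  simpa using hmv

/-! ### Mackey convergence of difference quotients and scalarwise smooth curves. -/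

section Convenient
variable {E F : Type*} [AddCommGroup E] [Module ℝ E] [TopologicalSpace E] [ConvenientSpace E]
  [AddCommGroup F] [Module ℝ F] [TopologicalSpace F] [ConvenientSpace F]

/-- A curve that is scalarwise `C²` has Mackey-convergent difference quotients. -/
theorem exists_bounded_remainder {c : ℝ → E} {I : Set ℝ} (hI : IsOpen I)
    (hc : ∀ l : E →L[ℝ] ℝ, ContDiffOn ℝ 2 (fun s => l (c s)) I) {t : ℝ} (ht : t ∈ I) :
    ∃ (v : E) (B : Set E), Bornology.IsVonNBounded ℝ B ∧
      ∀ᶠ y in 𝓝 t, ∃ b ∈ B, c y - c t - (y - t) • v = (y - t) ^ 2 • b := by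
  obtain ⟨δ, hδ0, hδ⟩ := Metric.nhds_basis_closedBall.mem_iff.1 (hI.mem_nhds ht)
  set q : ℝ → E := fun h => h⁻¹ • (c (t + h) - c t) with hq
  -- Normalised differences of difference quotients: scalarwise bounded by the Lipschitz estimate,
  -- hence bounded by Mackey's theorem.
  set B₀ : Set E := {b | ∃ h h' : ℝ, |h| ≤ δ ∧ |h'| ≤ δ ∧ h ≠ 0 ∧ h' ≠ 0 ∧ h ≠ h' ∧
    b = (h - h')⁻¹ • (q h - q h')} with hB₀
  have hB₀b : Bornology.IsVonNBounded ℝ B₀ := by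
    refine isVonNBounded_of_forall_dual fun l => ?_
    obtain ⟨C, hC⟩ := exists_lipschitz_slope hI (hc l) hδ
    refine ⟨C, ?_⟩
    rintro _ ⟨h, h', hh, hh', h0, h0', hne, rfl⟩
    have := hC h h' hh hh' h0 h0'
    have hp : 0 < |h - h'| := abs_pos.2 (sub_ne_zero.2 hne)
    simp only [hq, map_smul, map_sub, smul_eq_mul, abs_mul, abs_inv]
    rw [inv_mul_le_iff₀ hp]
    exact this.trans_eq (mul_comm _ _)
  set B := closedAbsConvexHull ℝ B₀ with hBdef
  have hB : Bornology.IsVonNBounded ℝ B := isVonNBounded_closedAbsConvexHull hB₀b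
  have hBac : AbsConvex ℝ B := absConvex_convexClosedHull
  have hBcl : IsClosed B := isClosed_closedAbsConvexHull
  have hqB : ∀ h h' : ℝ, |h| ≤ δ → |h'| ≤ δ → h ≠ 0 → h' ≠ 0 → h ≠ h' →
      (h - h')⁻¹ • (q h - q h') ∈ B := fun h h' hh hh' h0 h0' hne =>
    subset_closedAbsConvexHull ⟨h, h', hh, hh', h0, h0', hne, rfl⟩
  have hB0 : (0:E) ∈ B := by
    have := hBac.1 (0:ℝ) (by simp) (smul_mem_smul_set (a := (0:ℝ))
      (hqB δ (δ/2) (by rw [abs_of_pos hδ0]) (by rw [abs_of_pos (by positivity)]; linarith)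
        hδ0.ne' (by positivity) (by linarith)))
    simpa using this
  set hs : ℕ → ℝ := fun n => δ / (n + 1) with hhs
  have hs0 : ∀ n, hs n ≠ 0 := fun n => by simp only [hhs]; positivity
  have hsδ : ∀ n, |hs n| ≤ δ := fun n => by
    rw [abs_of_pos (by simp only [hhs]; positivity)]
    exact div_le_self hδ0.le (by linarith [n.cast_nonneg (α := ℝ)])
  have hslim : Tendsto hs atTop (𝓝 0) := by
    have := (tendsto_one_div_add_atTop_nhds_zero_nat (𝕜 := ℝ)).const_mul δ
    simpa [hhs, div_eq_mul_inv] using this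
  -- Two quotients differ by (h - h') times an element of `B`, so those along δ / (n + 1) form a
  -- Mackey-Cauchy sequence; its limit is the derivative.
  obtain ⟨v, hv⟩ := ConvenientSpace.mackey_complete (fun n => q (hs n)) ⟨B, hB, hBac, by
    intro ε hε
    obtain ⟨k, hk⟩ := (Metric.tendsto_atTop.1 hslim) (ε / 2) (by positivity)
    refine ⟨k, fun m n hm hn => ?_⟩
    by_cases hmn : hs m = hs n
    · exact ⟨0, hB0, by simp [hmn]⟩
    · have hlt : |hs m - hs n| ≤ ε := by
        have h1 := hk m hm
        have h2 := hk n hn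
        rw [Real.dist_eq, sub_zero] at h1 h2
        exact (abs_sub _ _).trans (by linarith)
      refine ⟨((hs m - hs n) / ε) • ((hs m - hs n)⁻¹ • (q (hs m) - q (hs n))), ?_, ?_⟩
      · refine hBac.1 _ ?_ (smul_mem_smul_set (hqB _ _ (hsδ m) (hsδ n) (hs0 m) (hs0 n) hmn))
        rw [norm_div, Real.norm_eq_abs, Real.norm_eq_abs, abs_of_pos hε]
        exact div_le_one_of_le₀ hlt hε.le
      · rw [smul_smul, smul_smul]
        have : ε * ((hs m - hs n) / ε) * (hs m - hs n)⁻¹ = 1 := by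
          have := sub_ne_zero.2 hmn
          field_simp
        rw [this, one_smul]⟩
  refine ⟨v, B, hB, ?_⟩
  filter_upwards [Metric.closedBall_mem_nhds t hδ0] with y hy
  by_cases hyt : y = t
  · exact ⟨0, hB0, by simp [hyt]⟩
  set h := y - t with hh
  have h0 : h ≠ 0 := sub_ne_zero.2 hyt
  have hhδ : |h| ≤ δ := by simpa [Real.dist_eq] using hy
  -- Letting h' → 0 in (h - h')⁻¹ (q h - q h') stays in the closed set `B`.
  refine ⟨h⁻¹ • (q h - v), ?_, ?_⟩
  · have hlim : Tendsto (fun n => (h - hs n)⁻¹ • (q h - q (hs n))) atTop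
        (𝓝 ((h - 0)⁻¹ • (q h - v))) :=
      ((hslim.const_sub h).inv₀ (by simpa using h0)).smul (hv.const_sub (q h))
    rw [sub_zero] at hlim
    refine hBcl.mem_of_tendsto hlim ?_
    filter_upwards [hslim.eventually_ne h0.symm] with n hn
    exact hqB _ _ hhδ (hsδ n) h0 (hs0 n) hn.symm
  · have hy' : y = t + h := by simp [hh]
    simp only [hq]
    rw [hy', smul_smul, smul_sub, smul_smul]
    have e1 : h ^ 2 * h⁻¹ * h⁻¹ = 1 := by field_simp
    have e2 : h ^ 2 * h⁻¹ = h := by field_simp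
    rw [e1, one_smul, e2]

theorem hasDerivAt_deriv_of_differentiableAt {c : ℝ → E} {t : ℝ} (h : DifferentiableAt ℝ c t) :
    HasDerivAt c (deriv c t) t :=
  h.hasFDerivAt.hasDerivAt

theorem differentiableAt_of_hasDerivAt {c : ℝ → E} {v : E} {t : ℝ} (h : HasDerivAt c v t) :
    DifferentiableAt ℝ c t :=
  HasFDerivAt.differentiableAt h

theorem deriv_eq_of_hasDerivAt {c : ℝ → E} {v : E} {t : ℝ} (h : HasDerivAt c v t) :
    deriv c t = v := by
  have := HasFDerivAt.unique (differentiableAt_of_hasDerivAt h).hasFDerivAt h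
  rw [deriv, this]; simp

theorem HasDerivAt.dual {c : ℝ → E} {v : E} {t : ℝ} (h : HasDerivAt c v t) (l : E →L[ℝ] ℝ) :
    HasDerivAt (fun s => l (c s)) (l v) t := by
  refine HasFDerivAt.of_isLittleOTVS ?_
  have h' := (HasFDerivAt.isLittleOTVS h)
  have h2 := (ContinuousLinearMap.isBigOTVS_comp (l := 𝓝 t)
    (f := fun y => c y - c t - ContinuousLinearMap.toSpanSingleton ℝ v (y - t)) (g := l)).trans_isLittleOTVS h'
  simpa [Function.comp_def] using h2

theorem SmoothCurveOn.contDiffOn_dual {c : ℝ → E} {I : Set ℝ} (hI : IsOpen I)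
    (hc : SmoothCurveOn c I) (l : E →L[ℝ] ℝ) : ContDiffOn ℝ ∞ (fun s => l (c s)) I := by
  have key : ∀ (n : ℕ) (c : ℝ → E), SmoothCurveOn c I → ContDiffOn ℝ n (fun s => l (c s)) I := by
    intro n
    induction n with
    | zero =>
      intro c hc
      rw [Nat.cast_zero, contDiffOn_zero]
      exact fun t ht => ((hasDerivAt_deriv_of_differentiableAt (hc 0 t ht)).dual l).continuousAt.continuousWithinAt
    | succ n ih =>
      intro c hc
      rw [Nat.cast_add, Nat.cast_one, contDiffOn_succ_iff_deriv_of_isOpen hI]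
      refine ⟨fun t ht => ((hasDerivAt_deriv_of_differentiableAt (hc 0 t ht)).dual l).differentiableAt.differentiableWithinAt,
        by simp, ?_⟩
      refine (ih (deriv c) fun m t ht => hc (m + 1) t ht).congr fun t ht => ?_
      exact ((hasDerivAt_deriv_of_differentiableAt (hc 0 t ht)).dual l).deriv
  exact contDiffOn_infty.2 fun n => key n c hc

/-- In a convenient space, scalarwise smooth curves are smooth. -/
theorem smoothCurveOn_of_dual {c : ℝ → E} {I : Set ℝ} (hI : IsOpen I)
    (hc : ∀ l : E →L[ℝ] ℝ, ContDiffOn ℝ ∞ (fun s => l (c s)) I) : SmoothCurveOn c I := by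
  have key : ∀ c : ℝ → E, (∀ l : E →L[ℝ] ℝ, ContDiffOn ℝ ∞ (fun s => l (c s)) I) →
      ∀ t ∈ I, DifferentiableAt ℝ c t := by
    intro c hc t ht
    obtain ⟨v, B, hB, h⟩ := exists_bounded_remainder hI
      (fun l => (hc l).of_le (WithTop.coe_le_coe.2 le_top)) ht
    exact differentiableAt_of_hasDerivAt (hasDerivAt_of_bounded_remainder hB h)
  -- The derivative of a scalarwise smooth curve is scalarwise smooth, so the first-order statement
  -- iterates.
  have step : ∀ n : ℕ, ∀ l : E →L[ℝ] ℝ, ContDiffOn ℝ ∞ (fun s => l (deriv^[n] c s)) I := by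
    intro n
    induction n with
    | zero => exact hc
    | succ n ih =>
      intro l
      rw [Function.iterate_succ']
      have h1 := ((contDiffOn_infty_iff_deriv_of_isOpen hI).1 (ih l)).2
      refine h1.congr fun t ht => ?_
      exact ((hasDerivAt_deriv_of_differentiableAt (key _ ih t ht)).dual l).deriv.symm
  exact fun n t ht => key _ (step n) t ht

theorem smoothCurveOn_iff_dual {c : ℝ → E} {I : Set ℝ} (hI : IsOpen I) :
    SmoothCurveOn c I ↔ ∀ l : E →L[ℝ] ℝ, ContDiffOn ℝ ∞ (fun s => l (c s)) I :=
  ⟨fun h l => h.contDiffOn_dual hI l, smoothCurveOn_of_dual hI⟩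

instance instConvenientSpaceReal : ConvenientSpace ℝ where
  mackey_complete x hx := by
    obtain ⟨B, hB, -, h⟩ := hx
    rw [NormedSpace.isVonNBounded_iff, isBounded_iff_forall_norm_le] at hB
    obtain ⟨C, hC⟩ := hB
    refine cauchySeq_tendsto_of_complete (Metric.cauchySeq_iff.2 fun ε hε => ?_)
    obtain ⟨k, hk⟩ := h (ε / (|C| + 1)) (by positivity)
    refine ⟨k, fun m hm n hn => ?_⟩
    obtain ⟨b, hb, e⟩ := hk m n hm hn
    rw [dist_eq_norm, e, norm_smul, Real.norm_of_nonneg (by positivity), div_mul_eq_mul_div,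
      div_lt_iff₀ (by positivity)]
    have := (hC b hb).trans (le_abs_self C)
    nlinarith

instance instConvenientSpaceProd : ConvenientSpace (E × F) where
  mackey_complete x hx := by
    obtain ⟨B, hB, hBc, h⟩ := hx
    have h1 : MackeyCauchy fun n => (x n).1 := by
      refine ⟨Prod.fst '' B, hB.image (ContinuousLinearMap.fst ℝ E F), ⟨?_, ?_⟩, fun ε hε => ?_⟩
      · rintro a ha _ ⟨_, ⟨b, hb, rfl⟩, rfl⟩
        exact ⟨a • b, hBc.1 a ha (smul_mem_smul_set hb), rfl⟩
      · exact hBc.2.linear_image (LinearMap.fst ℝ E F)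
      · obtain ⟨k, hk⟩ := h ε hε
        refine ⟨k, fun m n hm hn => ?_⟩
        obtain ⟨b, hb, e⟩ := hk m n hm hn
        exact ⟨b.1, mem_image_of_mem _ hb, congrArg Prod.fst e⟩
    have h2 : MackeyCauchy fun n => (x n).2 := by
      refine ⟨Prod.snd '' B, hB.image (ContinuousLinearMap.snd ℝ E F), ⟨?_, ?_⟩, fun ε hε => ?_⟩
      · rintro a ha _ ⟨_, ⟨b, hb, rfl⟩, rfl⟩
        exact ⟨a • b, hBc.1 a ha (smul_mem_smul_set hb), rfl⟩
      · exact hBc.2.linear_image (LinearMap.snd ℝ E F)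
      · obtain ⟨k, hk⟩ := h ε hε
        refine ⟨k, fun m n hm hn => ?_⟩
        obtain ⟨b, hb, e⟩ := hk m n hm hn
        exact ⟨b.2, mem_image_of_mem _ hb, congrArg Prod.snd e⟩
    obtain ⟨l1, hl1⟩ := ConvenientSpace.mackey_complete _ h1
    obtain ⟨l2, hl2⟩ := ConvenientSpace.mackey_complete _ h2
    exact ⟨(l1, l2), hl1.prodMk_nhds hl2⟩

end Convenient
end

noncomputable section
open scoped ContDiff Pointwise

/-! ## Smooth curves through rapidly converging sequences -/

section SpecialCurves

/-- Rescaling by 2 ^ (n + 3) multiplies the k-th derivative by 8 ^ k * (2 ^ k) ^ n; for fixed k the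
factorial decay of the coefficients beats this geometric growth. -/
theorem contDiff_tsum_scaled {ψ : ℝ → ℝ} (hψ : ContDiff ℝ ∞ ψ) (hc : HasCompactSupport ψ)
    {a : ℕ → ℝ} {C : ℝ} (ha : ∀ n, |a n| ≤ C * ((n.factorial : ℝ))⁻¹) (τ : ℕ → ℝ) :
    ContDiff ℝ ∞ fun t => ∑' n, a n * ψ (2 ^ (n + 3) * (t - τ n)) := by
  have hM : ∀ k : ℕ, ∃ M, ∀ x, ‖iteratedFDeriv ℝ k ψ x‖ ≤ M := fun k =>
    (hψ.continuous_iteratedFDeriv (WithTop.coe_le_coe.2 le_top)).bounded_above_of_compact_support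
      (hc.iteratedFDeriv k)
  choose M hM using hM
  refine contDiff_tsum (N := ⊤) (v := fun k n => C * (8 ^ k * M k) * ((2 ^ k) ^ n / n.factorial))
    (fun n => ?_) (fun k _ => ?_) (fun k n x _ => ?_)
  · exact contDiff_const.mul (hψ.comp (by fun_prop))
  · exact (Real.summable_pow_div_factorial _).mul_left _
  · rw [norm_iteratedFDeriv_eq_norm_iteratedDeriv]
    have h1 : ContDiff ℝ k ψ := hψ.of_le (WithTop.coe_le_coe.2 le_top)
    have e1 : iteratedDeriv k (fun t => a n * ψ (2 ^ (n + 3) * (t - τ n))) x =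
        a n * ((2 ^ (n + 3)) ^ k * iteratedDeriv k ψ (2 ^ (n + 3) * (x - τ n))) := by
      have h2 := congrFun (iteratedDeriv_comp_sub_const k (fun t => ψ (2 ^ (n + 3) * t)) (τ n)) x
      have h3 := congrFun (iteratedDeriv_comp_const_mul h1 (2 ^ (n + 3))) (x - τ n)
      rw [iteratedDeriv_const_mul_field, h2, h3]
    rw [e1, norm_mul, norm_mul, norm_pow, norm_pow, Real.norm_ofNat]
    have h4 : ‖iteratedDeriv k ψ (2 ^ (n + 3) * (x - τ n))‖ ≤ M k := by
      rw [← norm_iteratedFDeriv_eq_norm_iteratedDeriv]; exact hM k _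
    calc ‖a n‖ * ((2 ^ (n + 3)) ^ k * ‖iteratedDeriv k ψ (2 ^ (n + 3) * (x - τ n))‖)
        ≤ (C * ((n.factorial : ℝ))⁻¹) * ((2 ^ (n + 3)) ^ k * M k) := by
          gcongr
          · exact (abs_nonneg _).trans (ha n)
          · exact ha n
      _ = C * (8 ^ k * M k) * ((2 ^ k) ^ n / n.factorial) := by
          have : ((2:ℝ) ^ (n + 3)) ^ k = 8 ^ k * (2 ^ k) ^ n := by
            rw [← pow_mul, ← pow_mul, show (8:ℝ) = 2 ^ 3 by norm_num, ← pow_mul, ← pow_add]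
            congr 1; ring
          rw [this]; ring

/-- The intervals of radius 2 ^ (-n - 2) about the points 2 ^ (-n) are pairwise disjoint, so at each
parameter at most one bump is active. -/
theorem two_pow_sub_le_of_ne {m n : ℕ} (h : m ≠ n) {t : ℝ}
    (hm : |2 ^ (m + 3) * (t - (2 ^ m)⁻¹)| < 2) (hn : |2 ^ (n + 3) * (t - (2 ^ n)⁻¹)| < 2) :
    False := by
  wlog hlt : m < n generalizing m n
  · exact this h.symm hn hm (lt_of_le_of_ne (not_lt.1 hlt) h.symm)
  have e : ∀ k : ℕ, (2:ℝ) ^ (k + 3) * (t - (2 ^ k)⁻¹) = 8 * (2 ^ k * t - 1) := by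
    intro k; rw [pow_add]; field_simp; ring
  rw [e, abs_lt] at hm hn
  obtain ⟨d, rfl⟩ := Nat.exists_eq_add_of_lt hlt
  have h2 : (1:ℝ) ≤ 2 ^ d := one_le_pow₀ (by norm_num)
  have e2 : (2:ℝ) ^ (m + d + 1) * t = 2 * 2 ^ d * (2 ^ m * t) := by ring
  rw [e2] at hn
  nlinarith

variable {E : Type*} [AddCommGroup E] [Module ℝ E] [TopologicalSpace E] [ConvenientSpace E]

/-- The special curve lemma: a smooth curve with prescribed affine pieces near the points
`2⁻ⁿ`, for rapidly decreasing coefficients. -/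
theorem exists_smoothCurve_through {K : Set E} (hK : Bornology.IsVonNBounded ℝ K) {a b : ℕ → E}
    (ha : ∀ n, a n ∈ K) (hb : ∀ n, b n ∈ K) :
    ∃ γ : ℝ → E, SmoothCurveOn γ univ ∧ γ 0 = 0 ∧ ∀ n : ℕ, ∀ᶠ t in 𝓝 ((2 ^ n)⁻¹ : ℝ),
      γ t = ((n.factorial : ℝ))⁻¹ • (a n + (t - (2 ^ n)⁻¹) • b n) := by
  let θ : ContDiffBump (0:ℝ) := ⟨1, 2, one_pos, one_lt_two⟩
  have hθ0 : ∀ u : ℝ, 2 ≤ |u| → θ u = 0 := fun u hu => by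
    apply θ.zero_of_le_dist; simpa [Real.dist_eq] using hu
  have hθ1 : ∀ u : ℝ, |u| ≤ 1 → θ u = 1 := fun u hu => by
    apply θ.one_of_mem_closedBall; simpa using hu
  -- The bump is 1 for |2 ^ (n + 3) (t - 2⁻ⁿ)| ≤ 1, so near 2⁻ⁿ exactly the prescribed affine piece
  -- remains.
  let w : ℕ → ℝ → E := fun n t =>
    θ (2 ^ (n + 3) * (t - (2 ^ n)⁻¹)) • ((n.factorial : ℝ))⁻¹ • (a n + (t - (2 ^ n)⁻¹) • b n)
  have hw : ∀ t n, w n t ≠ 0 → |2 ^ (n + 3) * (t - (2 ^ n)⁻¹)| < 2 := by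
    intro t n h
    by_contra h'
    exact h (by simp only [w]; rw [hθ0 _ (not_lt.1 h'), zero_smul])
  have hone : ∀ t n, |2 ^ (n + 3) * (t - (2 ^ n)⁻¹)| < 2 → ∀ m, m ≠ n → w m t = 0 := by
    intro t n hn m hmn
    by_contra h'
    exact two_pow_sub_le_of_ne hmn (hw t m h') hn
  have hfin : ∀ t, (Function.support fun n => w n t).Finite := by
    intro t
    by_cases hex : ∃ n, w n t ≠ 0
    · obtain ⟨n, hn⟩ := hex
      refine (finite_singleton n).subset fun m hm => ?_
      by_contra hmn
      exact hm (hone t n (hw t n hn) m hmn)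
    · push Not at hex
      refine finite_empty.subset fun m hm => (hm (hex m)).elim
  refine ⟨fun t => ∑ᶠ n, w n t, ?_, ?_, fun n => ?_⟩
  · rw [smoothCurveOn_iff_dual isOpen_univ]
    intro l
    rw [contDiffOn_univ]
    obtain ⟨C, hC⟩ := hK.exists_dual_bound l
    -- The constant and the linear parts give two scaled series; in the second the factor t - 2⁻ⁿ is
    -- absorbed into the profile u θ(u), at the cost of (2 ^ (n + 3))⁻¹.
    have hl : ∀ t, l (∑ᶠ n, w n t) =
        (∑' n, ((n.factorial : ℝ)⁻¹ * l (a n)) * θ (2 ^ (n + 3) * (t - (2 ^ n)⁻¹))) +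
        ∑' n, ((n.factorial : ℝ)⁻¹ * l (b n) * (2 ^ (n + 3))⁻¹) *
          (fun u => u * θ u) (2 ^ (n + 3) * (t - (2 ^ n)⁻¹)) := by
      intro t
      have hs : (Function.support fun n : ℕ => θ (2 ^ (n + 3) * (t - (2 ^ n)⁻¹))).Finite := by
        by_cases hex : ∃ n : ℕ, θ (2 ^ (n + 3) * (t - (2 ^ n)⁻¹)) ≠ 0
        · obtain ⟨n, hn⟩ := hex
          refine (finite_singleton n).subset fun m hm => ?_
          by_contra hmn
          have h1 : |2 ^ (n + 3) * (t - (2 ^ n)⁻¹)| < 2 := by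
            by_contra h; exact hn (hθ0 _ (not_lt.1 h))
          have h2 : |2 ^ (m + 3) * (t - (2 ^ m)⁻¹)| < 2 := by
            by_contra h; exact hm (hθ0 _ (not_lt.1 h))
          exact two_pow_sub_le_of_ne hmn h2 h1
        · push Not at hex
          refine finite_empty.subset fun m hm => (hm (hex m)).elim
      have h1 : l (∑ᶠ n, w n t) = ∑ᶠ n, l (w n t) :=
        (l : E →+ ℝ).map_finsum (hfin t)
      have hS1 : Summable fun n : ℕ => ((n.factorial : ℝ)⁻¹ * l (a n)) *
          θ (2 ^ (n + 3) * (t - (2 ^ n)⁻¹)) :=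
        summable_of_hasFiniteSupport (hs.subset fun n hn h => hn (by simp only [h, mul_zero]))
      have hS2 : Summable fun n : ℕ => ((n.factorial : ℝ)⁻¹ * l (b n) * (2 ^ (n + 3))⁻¹) *
          (fun u => u * θ u) (2 ^ (n + 3) * (t - (2 ^ n)⁻¹)) :=
        summable_of_hasFiniteSupport (hs.subset fun n hn h => hn (by simp only [h, mul_zero]))
      rw [h1, ← hS1.tsum_add hS2, ← tsum_eq_finsum (L := SummationFilter.unconditional ℕ)]
      · refine tsum_congr fun n => ?_
        simp only [w, map_smul, map_add, smul_eq_mul]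
        field_simp
      · exact (hfin t).subset fun n hn h => hn (by simp only [h, map_zero])
    simp_rw [hl]
    have hC0 : 0 ≤ C := (abs_nonneg _).trans (hC _ (ha 0))
    refine ContDiff.add (contDiff_tsum_scaled (C := C) θ.contDiff θ.hasCompactSupport ?_ _)
      (contDiff_tsum_scaled (C := C) (contDiff_id.mul θ.contDiff)
        (θ.hasCompactSupport.mul_left) ?_ _)
    · intro n
      rw [abs_mul, abs_of_nonneg (by positivity), mul_comm]
      gcongr
      exact hC _ (ha n)
    · intro n
      rw [abs_mul, abs_mul, abs_of_nonneg (by positivity : (0:ℝ) ≤ (n.factorial : ℝ)⁻¹), abs_inv]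
      have h1 : |(2:ℝ) ^ (n + 3)|⁻¹ ≤ 1 := by
        rw [abs_of_nonneg (by positivity)]
        exact inv_le_one_of_one_le₀ (one_le_pow₀ (by norm_num))
      have h2 := hC _ (hb n)
      calc (n.factorial : ℝ)⁻¹ * |l (b n)| * |(2:ℝ) ^ (n + 3)|⁻¹
          ≤ (n.factorial : ℝ)⁻¹ * C * 1 := by gcongr
        _ = C * (n.factorial : ℝ)⁻¹ := by ring
  · have : ∀ n, w n 0 = 0 := by
      intro n
      simp only [w]
      rw [hθ0, zero_smul]
      have : (2:ℝ) ^ (n + 3) * (0 - (2 ^ n)⁻¹) = -8 := by rw [pow_add]; field_simp; norm_num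
      rw [this]; norm_num
    simp [this]
  · have hcont : ContinuousAt (fun t : ℝ => |2 ^ (n + 3) * (t - (2 ^ n)⁻¹)|) (2 ^ n)⁻¹ := by
      fun_prop
    have : ∀ᶠ t in 𝓝 ((2 ^ n)⁻¹ : ℝ), |2 ^ (n + 3) * (t - (2 ^ n)⁻¹)| < 1 :=
      hcont.eventually_lt_const (by simp)
    filter_upwards [this] with t ht
    rw [finsum_eq_single _ n (hone t n (ht.trans one_lt_two))]
    simp only [w]
    rw [hθ1 _ ht.le, one_smul]

end SpecialCurves

/-! ## The uniform boundedness principle in convenient spaces -/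

section UniformBoundedness

variable {G H : Type*} [AddCommGroup G] [Module ℝ G] [TopologicalSpace G] [ConvenientSpace G]
  [AddCommGroup H] [Module ℝ H] [TopologicalSpace H] [ConvenientSpace H]

/-- Mackey completeness suffices to sum a geometric series in a closed bounded disk, all increments
being multiples of elements of one `B`. The constant 3 / 2 · 3⁻ⁿ is the tail of Σ 3⁻ᵏ from k = n on.
-/
theorem exists_limit_of_geometric {B : Set G} (hB : Bornology.IsVonNBounded ℝ B)
    (hBc : AbsConvex ℝ B) (hBcl : IsClosed B) {y : ℕ → G}
    (hy : ∀ n : ℕ, y (n + 1) - y n ∈ (((3:ℝ) ^ n)⁻¹) • B) :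
    ∃ x, ∀ n : ℕ, x - y n ∈ (3 / 2 * ((3:ℝ) ^ n)⁻¹) • B := by
  have hB0 : (0:G) ∈ B := by
    obtain ⟨b, hb, -⟩ := hy 0
    simpa using hBc.1 (0:ℝ) (by simp) (smul_mem_smul_set (a := (0:ℝ)) hb)
  have hdiff : ∀ n k : ℕ, y (n + k) - y n ∈
      (3 / 2 * ((3:ℝ) ^ n)⁻¹ - 3 / 2 * ((3:ℝ) ^ (n + k))⁻¹) • B := by
    intro n k
    induction k with
    | zero => exact ⟨0, hB0, by simp⟩
    | succ k ih =>
      have h1 := add_mem_add (hy (n + k)) ih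
      have hanti : ((3:ℝ) ^ (n + k))⁻¹ ≤ ((3:ℝ) ^ n)⁻¹ := by
        gcongr
        · norm_num
        · omega
      rw [← hBc.2.add_smul (by positivity) (by linarith)] at h1
      convert h1 using 1
      · congr 1
        rw [← add_assoc, pow_succ]
        field_simp
        ring
      · rw [← add_assoc, sub_add_sub_cancel]
  have hmono : ∀ n k : ℕ, y (n + k) - y n ∈ (3 / 2 * ((3:ℝ) ^ n)⁻¹) • B := by
    intro n k
    have hanti : ((3:ℝ) ^ (n + k))⁻¹ ≤ ((3:ℝ) ^ n)⁻¹ := by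
      gcongr
      · norm_num
      · omega
    have hpos : (0:ℝ) < ((3:ℝ) ^ (n + k))⁻¹ := by positivity
    refine hBc.1.smul_mono ?_ (hdiff n k)
    rw [Real.norm_of_nonneg (by linarith), Real.norm_of_nonneg (by positivity)]
    linarith
  have hlim0 : Tendsto (fun n : ℕ => 3 / 2 * ((3:ℝ) ^ n)⁻¹) atTop (𝓝 0) := by
    have := (tendsto_pow_atTop_nhds_zero_of_lt_one (r := (3:ℝ)⁻¹) (by norm_num)
      (by norm_num)).const_mul (3/2)
    simpa using this
  obtain ⟨x, hx⟩ := ConvenientSpace.mackey_complete y ⟨B, hB, hBc, by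
    intro ε hε
    obtain ⟨k, hk⟩ := (hlim0.eventually_lt_const (half_pos hε)).exists
    refine ⟨k, fun m n hm hn => ?_⟩
    obtain ⟨p, rfl⟩ := Nat.exists_eq_add_of_le hm
    obtain ⟨q, rfl⟩ := Nat.exists_eq_add_of_le hn
    have h1 : ∀ p, y (k + p) - y k ∈ (ε / 2) • B := fun p =>
      hBc.1.smul_mono (by
        rw [Real.norm_of_nonneg (by positivity), Real.norm_of_nonneg (by positivity)]
        exact hk.le) (hmono k p)
    have h2 : -(y (k + q) - y k) ∈ (ε / 2) • B := (hBc.1.smul _).neg_mem_iff.2 (h1 q)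
    have h3 := add_mem_add (h1 p) h2
    rw [← hBc.2.add_smul (by positivity) (by positivity), add_halves] at h3
    obtain ⟨b, hb, e⟩ := h3
    exact ⟨b, hb, by simp only [] at e; rw [e]; abel⟩⟩
  refine ⟨x, fun n => ?_⟩
  have h1 : Tendsto (fun k => y (n + k) - y n) atTop (𝓝 (x - y n)) := by
    have : Tendsto (fun k => y (n + k)) atTop (𝓝 x) := by
      simpa [add_comm] using (tendsto_add_atTop_iff_nat n).2 hx
    exact this.sub_const _
  exact (hBcl.smul₀ _).mem_of_tendsto h1 (Eventually.of_forall (hmono n))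

/-- The Banach-Steinhaus theorem on a Banach disk. -/
theorem uniform_bound_of_pointwise {ι : Type*} {B : Set G} (hB : Bornology.IsVonNBounded ℝ B)
    (hBc : AbsConvex ℝ B) (hBcl : IsClosed B) {T : ι → G →ₗ[ℝ] ℝ}
    (hT : ∀ i, ∃ C, ∀ b ∈ B, |T i b| ≤ C) (hp : ∀ g, ∃ C, ∀ i, |T i g| ≤ C) :
    ∃ C, ∀ i, ∀ b ∈ B, |T i b| ≤ C := by
  by_contra hcon
  push Not at hcon
  -- A sliding hump replaces the Baire argument. The factor 5 / 4 says that `b` nearly attains the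
  -- supremum of |T i| on `B`, which is finite by `hT`.
  have hch : ∀ n : ℕ, ∃ (i : ι) (b : G), b ∈ B ∧ (4:ℝ) ^ n < |T i b| ∧
      ∀ b' ∈ B, |T i b'| ≤ 5 / 4 * |T i b| := by
    intro n
    obtain ⟨i, b, hb, hlt⟩ := hcon (2 * (4:ℝ) ^ n)
    obtain ⟨C, hC⟩ := hT i
    set R := (fun b => |T i b|) '' B
    have hR : BddAbove R := ⟨C, by rintro _ ⟨b, hb, rfl⟩; exact hC b hb⟩
    have hle : 2 * (4:ℝ) ^ n < sSup R := hlt.trans_le (le_csSup hR ⟨b, hb, rfl⟩)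
    have h4 : (0:ℝ) < 4 ^ n := by positivity
    obtain ⟨_, ⟨b', hb', rfl⟩, hb'2⟩ := exists_lt_of_lt_csSup (s := R) ⟨_, b, hb, rfl⟩
      (show 4 / 5 * sSup R < sSup R by linarith)
    refine ⟨i, b', hb', by simp only [] at hb'2; linarith, fun b'' hb'' => ?_⟩
    have := le_csSup hR ⟨b'', hb'', rfl⟩
    simp only [] at this hb'2
    linarith
  choose i b hb h4 hsup using hch
  -- The sign of the increment is chosen so that |T (i n)| is at least 3⁻ⁿ |T (i n) (b n)| at the
  -- new point: the values at y ± 3⁻ⁿ b differ by twice 3⁻ⁿ T (i n) (b n), so one of them is large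
  -- enough.
  let y : ℕ → G := fun n => Nat.rec 0 (fun n x =>
    if ((3:ℝ) ^ n)⁻¹ * |T (i n) (b n)| ≤ |T (i n) (x + ((3:ℝ) ^ n)⁻¹ • b n)| then
      x + ((3:ℝ) ^ n)⁻¹ • b n else x - ((3:ℝ) ^ n)⁻¹ • b n) n
  have hy : ∀ n, y (n + 1) =
    if ((3:ℝ) ^ n)⁻¹ * |T (i n) (b n)| ≤ |T (i n) (y n + ((3:ℝ) ^ n)⁻¹ • b n)| then
      y n + ((3:ℝ) ^ n)⁻¹ • b n else y n - ((3:ℝ) ^ n)⁻¹ • b n := fun n => rfl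
  have hy1 : ∀ n, ((3:ℝ) ^ n)⁻¹ * |T (i n) (b n)| ≤ |T (i n) (y (n + 1))| := by
    intro n
    rw [hy]
    split_ifs with h
    · exact h
    · push Not at h
      have h3 : (0:ℝ) < ((3:ℝ) ^ n)⁻¹ := by positivity
      simp only [map_add, map_sub, map_smul, smul_eq_mul] at h ⊢
      have e : 2 * (((3:ℝ) ^ n)⁻¹ * T (i n) (b n)) =
        (T (i n) (y n) + ((3:ℝ) ^ n)⁻¹ * T (i n) (b n)) -
        (T (i n) (y n) - ((3:ℝ) ^ n)⁻¹ * T (i n) (b n)) := by ring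
      have h5 := abs_sub (T (i n) (y n) + ((3:ℝ) ^ n)⁻¹ * T (i n) (b n))
        (T (i n) (y n) - ((3:ℝ) ^ n)⁻¹ * T (i n) (b n))
      rw [← e, abs_mul, abs_mul, abs_two, abs_of_pos h3] at h5
      linarith
  have hy2 : ∀ n : ℕ, y (n + 1) - y n ∈ (((3:ℝ) ^ n)⁻¹) • B := by
    intro n
    rw [hy]
    split_ifs
    · rw [add_sub_cancel_left]; exact smul_mem_smul_set (hb n)
    · rw [sub_sub_cancel_left]
      exact (hBc.1.smul _).neg_mem_iff.2 (smul_mem_smul_set (hb n))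
  obtain ⟨x, hx⟩ := exists_limit_of_geometric hB hBc hBcl hy2
  obtain ⟨C, hC⟩ := hp x
  -- The later increments add an element of (1 / 2) 3⁻ⁿ B, on which |T (i n)| is at most (5 / 8) 3⁻ⁿ
  -- |T (i n) (b n)|. There remains (3 / 8) 3⁻ⁿ |T (i n) (b n)|, and |T (i n) (b n)| > 4ⁿ.
  have hbig : ∀ n : ℕ, 3 / 8 * (4 / 3 : ℝ) ^ n ≤ C := by
    intro n
    obtain ⟨b', hb', e⟩ := hx (n + 1)
    have h3 : (0:ℝ) < ((3:ℝ) ^ n)⁻¹ := by positivity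
    have hxe : x = y (n + 1) + (1 / 2 * ((3:ℝ) ^ n)⁻¹) • b' := by
      have : (3 / 2 * ((3:ℝ) ^ (n + 1))⁻¹) = 1 / 2 * ((3:ℝ) ^ n)⁻¹ := by
        rw [pow_succ]; field_simp
      simp only [this] at e
      rw [e]; abel
    have h5 : |T (i n) x| ≤ C := hC (i n)
    have h6 : T (i n) (y (n + 1)) = T (i n) x - (1 / 2 * ((3:ℝ) ^ n)⁻¹) * T (i n) b' := by
      rw [hxe]; simp
    have h7 := hy1 n
    rw [h6] at h7
    have h8 := h7.trans (abs_sub _ _)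
    rw [abs_mul, abs_of_pos (by positivity : 0 < 1 / 2 * ((3:ℝ) ^ n)⁻¹)] at h8
    have h9 := hsup n b' hb'
    have h10 := mul_le_mul_of_nonneg_left h9 (by positivity : 0 ≤ 1 / 2 * ((3:ℝ) ^ n)⁻¹)
    have h11 := mul_le_mul_of_nonneg_left (h4 n).le h3.le
    have h12 : (4 / 3 : ℝ) ^ n = ((3:ℝ) ^ n)⁻¹ * 4 ^ n := by rw [div_pow]; field_simp
    rw [h12]
    linarith
  obtain ⟨n, hn⟩ := ((tendsto_pow_atTop_atTop_of_one_lt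
    (by norm_num : (1:ℝ) < 4 / 3)).eventually_gt_atTop (8 / 3 * C)).exists
  linarith [hbig n]

/-- A linear map that preserves bounded sets. -/
def IsBoundedLinear (T : G →ₗ[ℝ] H) : Prop :=
  ∀ K : Set G, Bornology.IsVonNBounded ℝ K → Bornology.IsVonNBounded ℝ (T '' K)

theorem isBoundedLinear_real_iff {T : G →ₗ[ℝ] ℝ} :
    IsBoundedLinear T ↔ ∀ K : Set G, Bornology.IsVonNBounded ℝ K → ∃ C, ∀ x ∈ K, |T x| ≤ C := by
  refine forall₂_congr fun K hK => ?_
  rw [NormedSpace.isVonNBounded_iff, isBounded_iff_forall_norm_le]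
  simp

theorem isBoundedLinear_iff_dual {T : G →ₗ[ℝ] H} :
    IsBoundedLinear T ↔ ∀ l : H →L[ℝ] ℝ, IsBoundedLinear (l.toLinearMap ∘ₗ T) := by
  constructor
  · intro h l K hK
    have := (h K hK).image l
    rwa [image_image] at this
  · intro h K hK
    refine isVonNBounded_of_forall_dual fun l => ?_
    obtain ⟨C, hC⟩ := isBoundedLinear_real_iff.1 (h l) K hK
    exact ⟨C, by rintro _ ⟨x, hx, rfl⟩; exact hC x hx⟩

/-- Convergent sequences are pointwise bounded, so uniform boundedness applies on the closed hull of
each bounded set, and the common bound survives in the limit. -/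
theorem isBoundedLinear_of_tendsto {T : ℕ → G →ₗ[ℝ] ℝ} {T₀ : G →ₗ[ℝ] ℝ}
    (hT : ∀ n, IsBoundedLinear (T n)) (h : ∀ g, Tendsto (fun n => T n g) atTop (𝓝 (T₀ g))) :
    IsBoundedLinear T₀ := by
  rw [isBoundedLinear_real_iff]
  intro K hK
  obtain ⟨C, hC⟩ := uniform_bound_of_pointwise (isVonNBounded_closedAbsConvexHull hK)
    absConvex_convexClosedHull isClosed_closedAbsConvexHull
    (fun n => isBoundedLinear_real_iff.1 (hT n) _ (isVonNBounded_closedAbsConvexHull hK))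
    (fun g => by
      obtain ⟨C, hC⟩ := ((h g).norm.bddAbove_range)
      exact ⟨C, fun n => hC ⟨n, rfl⟩⟩)
  exact ⟨C, fun x hx => le_of_tendsto (h x).abs
    (Eventually.of_forall fun n => hC n x (subset_closedAbsConvexHull hx))⟩

/-- Expand η(s) to first order with remainder (s - t)² b, where b stays in a bounded set. Uniform
boundedness bounds the functionals T s, s near t, on that set, so the remainder stays quadratically
small although T is only pointwise smooth. -/
theorem hasDerivAt_apply_curve {T : ℝ → G →ₗ[ℝ] ℝ} {η : ℝ → G} {I : Set ℝ} (hI : IsOpen I)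
    (hT : ∀ t ∈ I, IsBoundedLinear (T t)) (hs : ∀ g, ContDiffOn ℝ ∞ (fun t => T t g) I)
    (hη : SmoothCurveOn η I) {t : ℝ} (ht : t ∈ I) :
    HasDerivAt (fun s => T s (η s)) (deriv (fun s => T s (η t)) t + T t (deriv η t)) t := by
  obtain ⟨v, B, hB, hr⟩ := exists_bounded_remainder hI
    (fun l => (hη.contDiffOn_dual hI l).of_le (WithTop.coe_le_coe.2 le_top)) ht
  have hv : deriv η t = v := deriv_eq_of_hasDerivAt (hasDerivAt_of_bounded_remainder hB hr)
  obtain ⟨δ, hδ0, hδ⟩ := Metric.nhds_basis_closedBall.mem_iff.1 (hI.mem_nhds ht)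
  have hBh := isVonNBounded_closedAbsConvexHull hB
  obtain ⟨C, hC⟩ := uniform_bound_of_pointwise (ι := Metric.closedBall t δ)
    (T := fun s => T s.1) hBh absConvex_convexClosedHull isClosed_closedAbsConvexHull
    (fun s => isBoundedLinear_real_iff.1 (hT s.1 (hδ s.2)) _ hBh)
    (fun g => by
      obtain ⟨C, hC⟩ := (isCompact_closedBall t δ).exists_bound_of_continuousOn
        ((hs g).continuousOn.mono hδ)
      exact ⟨C, fun s => hC s.1 s.2⟩)
  have hd : ∀ g, HasDerivAt (fun s => T s g) (deriv (fun s => T s g) t) t := fun g =>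
    (((hs g).differentiableOn (by simp)).differentiableAt (hI.mem_nhds ht)).hasDerivAt
  have h2 : HasDerivAt (fun s => (s - t) * T s v) (1 * T t v + (t - t) *
      deriv (fun s => T s v) t) t := ((hasDerivAt_id t).sub_const t).mul (hd v)
  have h3 : HasDerivAt (fun s => T s (η s) - T s (η t) - (s - t) * T s v) 0 t := by
    refine hasDerivAt_of_bounded_remainder (B := Metric.closedBall 0 C)
      (NormedSpace.isVonNBounded_closedBall ℝ ℝ C) ?_
    filter_upwards [hr, Metric.closedBall_mem_nhds t hδ0] with y ⟨b, hb, e⟩ hy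
    refine ⟨T y b, by simpa using hC ⟨y, hy⟩ b (subset_closedAbsConvexHull hb), ?_⟩
    have e' : η y = η t + (y - t) • v + (y - t) ^ 2 • b := by rw [← e]; abel
    rw [e']
    simp only [map_add, map_smul, smul_eq_mul, sub_self, zero_mul, mul_zero, sub_zero]
    ring
  have h4 := (h3.add h2).add (hd (η t))
  rw [hv]
  refine (h4.congr_of_eventuallyEq (Eventually.of_forall fun s => ?_)).congr_deriv (by ring)
  simp

/-- If `T t` are bounded functionals depending pointwise smoothly on `t`, then `T t (η t)` is
smooth for every smooth curve `η`. -/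
theorem contDiffOn_apply_curve {I : Set ℝ} (hI : IsOpen I) {T : ℝ → G →ₗ[ℝ] ℝ} {η : ℝ → G}
    (hT : ∀ t ∈ I, IsBoundedLinear (T t)) (hs : ∀ g, ContDiffOn ℝ ∞ (fun t => T t g) I)
    (hη : SmoothCurveOn η I) : ContDiffOn ℝ ∞ (fun t => T t (η t)) I := by
  classical
  have key : ∀ (n : ℕ) (T : ℝ → G →ₗ[ℝ] ℝ) (η : ℝ → G), (∀ t ∈ I, IsBoundedLinear (T t)) →
      (∀ g, ContDiffOn ℝ ∞ (fun t => T t g) I) → SmoothCurveOn η I →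
      ContDiffOn ℝ n (fun t => T t (η t)) I := by
    intro n
    induction n with
    | zero =>
      intro T η hT hs hη
      rw [Nat.cast_zero, contDiffOn_zero]
      exact fun t ht => (hasDerivAt_apply_curve hI hT hs hη ht).continuousAt.continuousWithinAt
    | succ n ih =>
      intro T η hT hs hη
      rw [Nat.cast_add, Nat.cast_one, contDiffOn_succ_iff_deriv_of_isOpen hI]
      refine ⟨fun t ht =>
        (hasDerivAt_apply_curve hI hT hs hη ht).differentiableAt.differentiableWithinAt,
        by simp, ?_⟩
      have hd : ∀ g, ∀ t ∈ I, HasDerivAt (fun s => T s g) (deriv (fun s => T s g) t) t :=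
        fun g t ht =>
          (((hs g).differentiableOn (by simp)).differentiableAt (hI.mem_nhds ht)).hasDerivAt
      -- The pointwise derivative of T is again a family of functionals to which the induction
      -- applies; its values outside `I` do not matter.
      let T' : ℝ → G →ₗ[ℝ] ℝ := fun t =>
        if ht : t ∈ I then
          { toFun := fun g => deriv (fun s => T s g) t
            map_add' := fun g g' => by
              have := ((hd g t ht).add (hd g' t ht)).deriv
              rw [← this]; congr 1; ext s; simp
            map_smul' := fun c g => by
              have := ((hd g t ht).const_mul c).deriv
              rw [RingHom.id_apply, smul_eq_mul, ← this]; congr 1; ext s; simp }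
        else 0
      have hT' : ∀ t ∈ I, ∀ g, T' t g = deriv (fun s => T s g) t := by
        intro t ht g
        simp only [T', dif_pos ht]; rfl
      have h1 : ContDiffOn ℝ n (fun t => T' t (η t)) I := by
        refine ih T' η (fun t ht => ?_) (fun g => ?_) hη
        · obtain ⟨δ, hδ0, hδ⟩ := Metric.nhds_basis_closedBall.mem_iff.1 (hI.mem_nhds ht)
          -- T' t is a pointwise limit of difference quotients, which are bounded functionals.
          refine isBoundedLinear_of_tendsto
            (T := fun n : ℕ => ((δ / (n + 1))⁻¹) • (T (t + δ / (n + 1)) - T t)) (fun n => ?_)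
            (fun g => ?_)
          · rw [isBoundedLinear_real_iff]
            intro K hK
            have hmem : t + δ / (n + 1) ∈ I := hδ (by
              rw [Metric.mem_closedBall, Real.dist_eq, add_sub_cancel_left,
                abs_of_pos (by positivity)]
              exact div_le_self hδ0.le (by linarith [n.cast_nonneg (α := ℝ)]))
            obtain ⟨C, hC⟩ := isBoundedLinear_real_iff.1 (hT _ hmem) K hK
            obtain ⟨C', hC'⟩ := isBoundedLinear_real_iff.1 (hT _ ht) K hK
            refine ⟨|(δ / (n + 1))⁻¹| * (C + C'), fun x hx => ?_⟩
            simp only [LinearMap.smul_apply, LinearMap.sub_apply, smul_eq_mul, abs_mul]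
            gcongr
            exact (abs_sub _ _).trans (add_le_add (hC x hx) (hC' x hx))
          · rw [hT' t ht]
            have h0 := (hd g t ht).tendsto_slope_zero
            have hlim : Tendsto (fun n : ℕ => δ / ((n:ℝ) + 1)) atTop (𝓝[≠] 0) := by
              refine tendsto_nhdsWithin_iff.2 ⟨?_, Eventually.of_forall fun n => ?_⟩
              · have := (tendsto_one_div_add_atTop_nhds_zero_nat (𝕜 := ℝ)).const_mul δ
                simpa [div_eq_mul_inv] using this
              · have : δ / ((n:ℝ) + 1) ≠ 0 := by positivity
                exact this
            exact h0.comp hlim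
        · have := ((contDiffOn_infty_iff_deriv_of_isOpen hI).1 (hs g)).2
          exact this.congr fun t ht => hT' t ht g
      have h2 : ContDiffOn ℝ n (fun t => T t (deriv η t)) I :=
        ih T (deriv η) hT hs fun m t ht => hη (m + 1) t ht
      refine (h1.add h2).congr fun t ht => ?_
      rw [(hasDerivAt_apply_curve hI hT hs hη ht).deriv, ← hT' t ht]
  exact contDiffOn_infty.2 fun n => key n T η hT hs hη

theorem SmoothCurveOn.apply_curve {I : Set ℝ} (hI : IsOpen I) {T : ℝ → G →ₗ[ℝ] H} {η : ℝ → G}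
    (hT : ∀ t ∈ I, IsBoundedLinear (T t)) (hs : ∀ g, SmoothCurveOn (fun t => T t g) I)
    (hη : SmoothCurveOn η I) : SmoothCurveOn (fun t => T t (η t)) I := by
  rw [smoothCurveOn_iff_dual hI]
  intro l
  exact contDiffOn_apply_curve hI (T := fun t => l.toLinearMap ∘ₗ T t)
    (fun t ht => isBoundedLinear_iff_dual.1 (hT t ht) l)
    (fun g => (hs g).contDiffOn_dual hI l) hη

/-- If `t ↦ T t (η t)` is continuous at `0` for all smooth curves `η`, then `T 0` is bounded. -/
theorem isBoundedLinear_of_forall_curve {T : ℝ → G →ₗ[ℝ] ℝ}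
    (h : ∀ η : ℝ → G, SmoothCurveOn η univ → ContinuousAt (fun t => T t (η t)) 0) :
    IsBoundedLinear (T 0) := by
  rw [isBoundedLinear_real_iff]
  intro K hK
  have hlim0 : Tendsto (fun n : ℕ => ((2:ℝ) ^ n)⁻¹) atTop (𝓝 0) := by
    have := (tendsto_pow_atTop_nhds_zero_of_lt_one (r := (2:ℝ)⁻¹) (by norm_num) (by norm_num))
    simpa using this
  have hconst : ∀ g, Tendsto (fun n : ℕ => T ((2:ℝ) ^ n)⁻¹ g) atTop (𝓝 (T 0 g)) := by
    intro g
    have hg : SmoothCurveOn (fun _ : ℝ => g) univ := by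
      rw [smoothCurveOn_iff_dual isOpen_univ]
      exact fun l => contDiffOn_const
    exact (h _ hg).tendsto.comp hlim0
  set B := closedAbsConvexHull ℝ K
  have hBb : Bornology.IsVonNBounded ℝ B := isVonNBounded_closedAbsConvexHull hK
  -- If T 2⁻ⁿ is bounded on `B` for infinitely many n, uniform boundedness along these n bounds the
  -- limit T 0. Otherwise there are points `b n` with |T 2⁻ⁿ (b n)| > n! for large n, and a special
  -- curve through b n / n! at 2⁻ⁿ contradicts continuity at 0.
  by_cases hfr : ∃ᶠ n : ℕ in atTop, ∃ C, ∀ b ∈ B, |T ((2:ℝ) ^ n)⁻¹ b| ≤ C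
  · obtain ⟨φ, hφ, hφ2⟩ := extraction_of_frequently_atTop hfr
    obtain ⟨C, hC⟩ := uniform_bound_of_pointwise hBb absConvex_convexClosedHull
      isClosed_closedAbsConvexHull hφ2 (fun g => by
        obtain ⟨C, hC⟩ := ((hconst g).comp hφ.tendsto_atTop).norm.bddAbove_range
        exact ⟨C, fun n => hC ⟨n, rfl⟩⟩)
    exact ⟨C, fun x hx => le_of_tendsto ((hconst x).comp hφ.tendsto_atTop).abs
      (Eventually.of_forall fun n => hC n x (subset_closedAbsConvexHull hx))⟩
  · exfalso
    have hch : ∀ n : ℕ, ∃ b, b ∈ insert (0:G) B ∧ ((¬ ∃ C, ∀ b ∈ B, |T ((2:ℝ) ^ n)⁻¹ b| ≤ C) →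
        (n.factorial : ℝ) < |T ((2:ℝ) ^ n)⁻¹ b|) := by
      intro n
      by_cases hn : ∃ C, ∀ b ∈ B, |T ((2:ℝ) ^ n)⁻¹ b| ≤ C
      · exact ⟨0, mem_insert _ _, fun h => (h hn).elim⟩
      · have hn' := hn
        push Not at hn'
        obtain ⟨b, hb, hlt⟩ := hn' n.factorial
        exact ⟨b, mem_insert_of_mem _ hb, fun _ => hlt⟩
    choose b hb hlt using hch
    obtain ⟨γ, hγ, hγ0, hγn⟩ := exists_smoothCurve_through (K := insert 0 B)
      ((Bornology.isVonNBounded_insert _).2 hBb) (a := b) (b := fun _ => 0) hb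
      (fun _ => mem_insert _ _)
    have h1 : Tendsto (fun n : ℕ => |T ((2:ℝ) ^ n)⁻¹ (γ ((2:ℝ) ^ n)⁻¹)|) atTop (𝓝 0) := by
      have := ((h γ hγ).tendsto.comp hlim0).abs
      simpa [hγ0] using this
    have h2 := h1.eventually_lt_const one_pos
    obtain ⟨n, hn1, hn2⟩ := (h2.and (not_frequently.1 hfr)).exists
    have h3 := hlt n hn2
    rw [(hγn n).self_of_nhds] at hn1
    simp only [sub_self, zero_smul, add_zero, map_smul, smul_eq_mul, abs_mul, abs_inv,
      Nat.abs_cast] at hn1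
    rw [inv_mul_lt_iff₀ (by positivity), mul_one] at hn1
    linarith

end UniformBoundedness
end

noncomputable section
open scoped ContDiff FourierTransform
open MeasureTheory

/-! ## Boman's theorem in the plane -/

section Fourier

/-- The transform of the k-th derivative is (2πiw)ᵏ times that of `g`, and is bounded by the L¹ norm
over [-R, R]. The constant is explicit so that the estimate is uniform over the slices of a function
of two variables. -/
theorem norm_fourier_pow_mul_le {g : ℝ → ℂ} {R M : ℝ} (hR : 0 ≤ R) (hg : ContDiff ℝ ∞ g)
    (hsupp : ∀ x, R < |x| → g x = 0) {k : ℕ} (hM : ∀ x, ‖iteratedDeriv k g x‖ ≤ M) (w : ℝ) :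
    (2 * Real.pi * |w|) ^ k * ‖𝓕 g w‖ ≤ 2 * R * M := by
  have hts : tsupport g ⊆ Icc (-R) R := by
    refine closure_minimal (fun x hx => ?_) isClosed_Icc
    by_contra h
    refine hx (hsupp x ?_)
    by_contra h'
    exact h (abs_le.1 (not_lt.1 h'))
  have hc : HasCompactSupport g := isCompact_Icc.of_isClosed_subset (isClosed_tsupport g) hts
  have hsup : ∀ n x, R < |x| → iteratedDeriv n g x = 0 := by
    intro n x hx
    have : tsupport (iteratedDeriv n g) ⊆ tsupport g := by
      rw [iteratedDeriv_eq_equiv_comp]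
      refine (closure_mono ?_).trans (tsupport_iteratedFDeriv_subset (𝕜 := ℝ) n)
      exact Function.support_comp_subset (by simp) _
    by_contra h
    have h2 := hts (this (subset_tsupport _ h))
    exact absurd (abs_le.2 h2) (not_le.2 hx)
  have hint : ∀ n : ℕ, Integrable (iteratedDeriv n g) := fun n => by
    refine (hg.continuous_iteratedDeriv n (WithTop.coe_le_coe.2 le_top)).integrable_of_hasCompactSupport ?_
    refine HasCompactSupport.intro (isCompact_Icc (a := -R) (b := R)) fun x hx => hsup n x ?_
    by_contra h'
    exact hx (abs_le.1 (not_lt.1 h'))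
  have h1 := congrFun (Real.fourier_iteratedDeriv (N := ⊤) hg (fun n _ => hint n) (n := k) le_top) w
  have h2 : ‖𝓕 (iteratedDeriv k g) w‖ ≤ 2 * R * M := by
    refine (VectorFourier.norm_fourierIntegral_le_integral_norm _ _ _ _ _).trans ?_
    have h3 : ∫ x, ‖iteratedDeriv k g x‖ = ∫ x in Icc (-R) R, ‖iteratedDeriv k g x‖ := by
      refine (setIntegral_eq_integral_of_forall_compl_eq_zero fun x hx => ?_).symm
      rw [hsup k x, norm_zero]
      by_contra h'
      exact hx (abs_le.1 (not_lt.1 h'))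
    rw [h3]
    have h4 := norm_setIntegral_le_of_norm_le_const (μ := volume) (s := Icc (-R) R)
      (f := fun x => ‖iteratedDeriv k g x‖) (C := M) (by simp) (fun x _ => by simpa using hM x)
    refine (le_abs_self _).trans (h4.trans_eq ?_)
    rw [Measure.real, Real.volume_Icc, ENNReal.toReal_ofReal (by linarith)]
    ring
  rw [h1, norm_smul, norm_pow] at h2
  convert h2 using 3
  simp [abs_of_pos Real.pi_pos]

/-- Decay in the first frequency variable of the Fourier transform of a compactly supported
function of two variables with bounded first partial derivatives of all orders. -/
theorem norm_integral_fourierChar_prod_le {F : ℝ × ℝ → ℂ} {R M : ℝ} (hR : 0 ≤ R) {k : ℕ}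
    (hF : Continuous F) (hd : ∀ y, ContDiff ℝ ∞ fun x => F (x, y))
    (hs1 : ∀ x y, R < |x| → F (x, y) = 0) (hs2 : ∀ x y, R < |y| → F (x, y) = 0)
    (hM : ∀ y x, ‖iteratedDeriv k (fun x => F (x, y)) x‖ ≤ M) (a b : ℝ) :
    (2 * Real.pi * |a|) ^ k * ‖∫ p : ℝ × ℝ, Real.fourierChar (-(p.1 * a + p.2 * b)) • F p‖ ≤
      2 * R * (2 * R * M) := by
  have hcs : HasCompactSupport F := by
    refine HasCompactSupport.intro ((isCompact_Icc (a := -R) (b := R)).prod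
      (isCompact_Icc (a := -R) (b := R))) fun p hp => ?_
    by_cases h1 : R < |p.1|
    · exact hs1 _ _ h1
    · by_cases h2 : R < |p.2|
      · exact hs2 _ _ h2
      · exact (hp ⟨abs_le.1 (not_lt.1 h1), abs_le.1 (not_lt.1 h2)⟩).elim
  have hint : Integrable (fun p : ℝ × ℝ => Real.fourierChar (-(p.1 * a + p.2 * b)) • F p) := by
    refine Continuous.integrable_of_hasCompactSupport ?_ ?_
    · have h1 : Continuous fun p : ℝ × ℝ => -(p.1 * a + p.2 * b) := by fun_prop
      exact (Real.continuous_fourierChar.comp h1).smul hF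
    · exact hcs.smul_left
  -- By Fubini the plane integral becomes an integral over y of one-dimensional transforms of
  -- slices, to which `norm_fourier_pow_mul_le` applies.
  have hinner : ∀ y, ∫ x, Real.fourierChar (-(x * a + y * b)) • F (x, y) =
      Real.fourierChar (-(y * b)) • 𝓕 (fun x => F (x, y)) a := by
    intro y
    rw [Real.fourier_eq, Circle.smul_def, ← integral_smul]
    refine integral_congr_ae (Eventually.of_forall fun x => ?_)
    simp only [← Circle.smul_def]
    rw [smul_smul, ← AddChar.map_add_eq_mul]
    congr 2
    simp
    ring
  rw [Measure.volume_eq_prod, integral_prod_symm _ hint]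
  simp_rw [hinner]
  have hz : ∀ y, R < |y| → Real.fourierChar (-(y * b)) • 𝓕 (fun x => F (x, y)) a = 0 := by
    intro y hy
    have : (fun x => F (x, y)) = 0 := by ext x; exact hs2 x y hy
    rw [this, Real.fourier_eq]
    simp
  have h3 : ∫ y, Real.fourierChar (-(y * b)) • 𝓕 (fun x => F (x, y)) a =
      ∫ y in Icc (-R) R, Real.fourierChar (-(y * b)) • 𝓕 (fun x => F (x, y)) a := by
    refine (setIntegral_eq_integral_of_forall_compl_eq_zero fun y hy => hz y ?_).symm
    by_contra h'
    exact hy (abs_le.1 (not_lt.1 h'))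
  have hpos : 0 ≤ (2 * Real.pi * |a|) ^ k := by positivity
  rw [h3, ← abs_of_nonneg hpos, ← Real.norm_eq_abs, ← norm_smul, ← integral_smul]
  have h4 := norm_setIntegral_le_of_norm_le_const (μ := volume) (s := Icc (-R) R)
    (f := fun y => ((2 * Real.pi * |a|) ^ k : ℝ) •
      (Real.fourierChar (-(y * b)) • 𝓕 (fun x => F (x, y)) a)) (C := 2 * R * M) (by simp)
    (fun y _ => by
      rw [norm_smul, Circle.norm_smul, Real.norm_of_nonneg hpos]
      exact norm_fourier_pow_mul_le hR (hd y) (fun x hx => hs1 x y hx) (hM y) a)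
  refine h4.trans_eq ?_
  rw [Measure.real, Real.volume_Icc, ENNReal.toReal_ofReal (by linarith)]
  ring

/-- A continuous compactly supported function on the plane is smooth as soon as its pure partial
derivatives of all orders exist and are bounded. -/
theorem contDiff_of_bounded_partials {F : ℝ × ℝ → ℂ} {R : ℝ} (hR : 0 ≤ R) (hF : Continuous F)
    (hd1 : ∀ y, ContDiff ℝ ∞ fun x => F (x, y)) (hd2 : ∀ x, ContDiff ℝ ∞ fun y => F (x, y))
    (hs1 : ∀ x y, R < |x| → F (x, y) = 0) (hs2 : ∀ x y, R < |y| → F (x, y) = 0)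
    (hM1 : ∀ k, ∃ M, ∀ y x, ‖iteratedDeriv k (fun x => F (x, y)) x‖ ≤ M)
    (hM2 : ∀ k, ∃ M, ∀ x y, ‖iteratedDeriv k (fun y => F (x, y)) y‖ ≤ M) : ContDiff ℝ ∞ F := by
  -- The plane is identified with ℂ, whose inner product gives access to the Fourier transform and
  -- its inversion.
  set g : ℂ → ℂ := fun z => F (z.re, z.im) with hg
  have hgc : Continuous g := hF.comp (by fun_prop)
  have hcs : HasCompactSupport g := by
    refine HasCompactSupport.intro (isCompact_closedBall (0:ℂ) (2 * R)) fun z hz => ?_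
    by_cases h1 : R < |z.re|
    · exact hs1 _ _ h1
    · by_cases h2 : R < |z.im|
      · exact hs2 _ _ h2
      · refine (hz ?_).elim
        rw [mem_closedBall_zero_iff]
        exact (Complex.norm_le_abs_re_add_abs_im z).trans (by linarith)
  have hgi : Integrable g := hgc.integrable_of_hasCompactSupport hcs
  have hfour : ∀ w : ℂ, 𝓕 g w =
      ∫ p : ℝ × ℝ, Real.fourierChar (-(p.1 * w.re + p.2 * w.im)) • F p := by
    intro w
    rw [Real.fourier_eq, ← Complex.volume_preserving_equiv_real_prod.symm.integral_comp
      (Complex.measurableEquivRealProd.symm.measurableEmbedding)]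
    refine integral_congr_ae (Eventually.of_forall fun p => ?_)
    simp only [hg, Complex.measurableEquivRealProd_symm_apply, Complex.inner]
    simp [mul_comm]
  have hfour2 : ∀ w : ℂ, 𝓕 g w =
      ∫ p : ℝ × ℝ, Real.fourierChar (-(p.1 * w.im + p.2 * w.re)) • F p.swap := by
    intro w
    rw [hfour, Measure.volume_eq_prod, ← integral_prod_swap]
    refine integral_congr_ae (Eventually.of_forall fun p => ?_)
    simp [add_comm]
  -- Each pure partial derivative gives decay in one frequency variable. Since ‖w‖ is controlled by
  -- the larger of the two, this is decay in every direction, without any mixed derivative.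
  have hdec : ∀ k : ℕ, ∃ C, ∀ w : ℂ, ‖w‖ ^ k * ‖𝓕 g w‖ ≤ C := by
    intro k
    obtain ⟨M1, hM1⟩ := hM1 k
    obtain ⟨M2, hM2⟩ := hM2 k
    refine ⟨2 * R * (2 * R * M1) + 2 * R * (2 * R * M2), fun w => ?_⟩
    have e1 := norm_integral_fourierChar_prod_le hR hF hd1 hs1 hs2 hM1 w.re w.im
    have e2 := norm_integral_fourierChar_prod_le (F := fun p => F p.swap) hR
      (hF.comp continuous_swap) hd2 (fun x y h => hs2 y x h) (fun x y h => hs1 y x h) hM2 w.im w.re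
    rw [← hfour] at e1
    rw [← hfour2] at e2
    have hpi : (1:ℝ) ≤ Real.pi := by linarith [Real.pi_gt_three]
    have hw : ‖w‖ ≤ 2 * Real.pi * |w.re| ∨ ‖w‖ ≤ 2 * Real.pi * |w.im| := by
      have h := Complex.norm_le_abs_re_add_abs_im w
      rcases le_total |w.re| |w.im| with h1 | h1
      · right; nlinarith [abs_nonneg w.im]
      · left; nlinarith [abs_nonneg w.re]
    have p1 : 0 ≤ (2 * Real.pi * |w.re|) ^ k * ‖𝓕 g w‖ := by positivity
    have p2 : 0 ≤ (2 * Real.pi * |w.im|) ^ k * ‖𝓕 g w‖ := by positivity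
    rcases hw with h | h
    · have : ‖w‖ ^ k * ‖𝓕 g w‖ ≤ (2 * Real.pi * |w.re|) ^ k * ‖𝓕 g w‖ := by gcongr
      linarith
    · have : ‖w‖ ^ k * ‖𝓕 g w‖ ≤ (2 * Real.pi * |w.im|) ^ k * ‖𝓕 g w‖ := by gcongr
      linarith
  have hcont : Continuous (𝓕 g) := by
    have := Real.contDiff_fourier (N := 0) (f := g) (fun n hn => by
      have : n = 0 := by simpa using hn
      subst this
      simpa using hgi.norm)
    exact this.continuous
  have hint : ∀ n : ℕ, Integrable fun w => ‖w‖ ^ n * ‖𝓕 g w‖ := by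
    intro n
    obtain ⟨C1, h1⟩ := hdec 0
    obtain ⟨C2, h2⟩ := hdec (n + (volume : Measure ℂ).integrablePower)
    exact integrable_of_le_of_pow_mul_le (fun w => by simpa using h1 w) h2
      hcont.aestronglyMeasurable
  have hint0 : Integrable (𝓕 g) := by
    have := hint 0
    simp only [pow_zero, one_mul] at this
    exact (integrable_norm_iff hcont.aestronglyMeasurable).1 this
  -- g is the inverse transform of a function all of whose moments are integrable, hence smooth.
  have hinv := hgc.fourierInv_fourier_eq hgi hint0
  have hgs : ContDiff ℝ ∞ g := by
    rw [← hinv]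
    have h1 : ContDiff ℝ ∞ (𝓕 (𝓕 g)) := Real.contDiff_fourier (N := ⊤) fun n _ => hint n
    have h2 : 𝓕⁻ (𝓕 g) = fun v => 𝓕 (𝓕 g) (-v) := by
      ext v; exact Real.fourierInv_eq_fourier_neg _ _
    rw [h2]
    exact h1.comp contDiff_neg
  have : F = fun p => g (Complex.equivRealProdCLM.symm p) := by
    ext p; simp [hg]
  rw [this]
  exact hgs.comp Complex.equivRealProdCLM.symm.contDiff

end Fourier

/-! ### From smoothness along curves to smoothness in the plane. -/

section Boman

theorem smoothCurveOn_real_iff {c : ℝ → ℝ} {I : Set ℝ} (hI : IsOpen I) :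
    SmoothCurveOn c I ↔ ContDiffOn ℝ ∞ c I := by
  rw [smoothCurveOn_iff_dual hI]
  constructor
  · intro h; exact h (ContinuousLinearMap.id ℝ ℝ)
  · intro h l; exact l.contDiff.comp_contDiffOn h

theorem smoothCurveOn_plane_iff {c : ℝ → ℝ × ℝ} {I : Set ℝ} (hI : IsOpen I) :
    SmoothCurveOn c I ↔ ContDiffOn ℝ ∞ c I := by
  rw [smoothCurveOn_iff_dual hI]
  constructor
  · intro h
    exact (h (ContinuousLinearMap.fst ℝ ℝ ℝ)).prodMk (h (ContinuousLinearMap.snd ℝ ℝ ℝ))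
  · intro h l; exact l.contDiff.comp_contDiffOn h

/-- The special curve with coefficients n! (y n - x), bounded by the assumed decay, translated by x.
The velocity v / n! at `y n` serves to probe derivatives in the direction v. -/
theorem exists_planeCurve_through {x : ℝ × ℝ} {y : ℕ → ℝ × ℝ}
    (hy : ∀ n, ‖y n - x‖ ≤ ((n.factorial : ℝ))⁻¹) (v : ℝ × ℝ) :
    ∃ γ : ℝ → ℝ × ℝ, ContDiff ℝ ∞ γ ∧ γ 0 = x ∧ ∀ n : ℕ, ∀ᶠ t in 𝓝 ((2 ^ n)⁻¹ : ℝ),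
      γ t = y n + ((n.factorial : ℝ)⁻¹ * (t - (2 ^ n)⁻¹)) • v := by
  obtain ⟨γ, hγ, h0, h⟩ := exists_smoothCurve_through (E := ℝ × ℝ)
    (K := Metric.closedBall 0 (max 1 ‖v‖)) (NormedSpace.isVonNBounded_closedBall ℝ _ _)
    (a := fun n => (n.factorial : ℝ) • (y n - x)) (b := fun _ => v)
    (fun n => by
      rw [mem_closedBall_zero_iff, norm_smul, Real.norm_natCast]
      refine le_trans ?_ (le_max_left _ _)
      have := hy n
      rwa [← le_inv_mul_iff₀ (by positivity), mul_one]) (fun n => by simp)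
  refine ⟨fun t => x + γ t, ?_, by simp [h0], fun n => ?_⟩
  · exact contDiff_const.add (contDiffOn_univ.1 ((smoothCurveOn_plane_iff isOpen_univ).1 hγ))
  · filter_upwards [h n] with t ht
    have hn : (n.factorial : ℝ) ≠ 0 := by positivity
    rw [ht, smul_add, smul_smul, smul_smul, inv_mul_cancel₀ hn, one_smul]
    abel

theorem tendsto_two_pow_inv : Tendsto (fun n : ℕ => ((2:ℝ) ^ n)⁻¹) atTop (𝓝 0) := by
  have := (tendsto_pow_atTop_nhds_zero_of_lt_one (r := (2:ℝ)⁻¹) (by norm_num) (by norm_num))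
  simpa using this

/-- The `c^∞`-topology of the plane is its usual topology. -/
theorem isOpen_of_forall_curve {A : Set (ℝ × ℝ)}
    (h : ∀ c : ℝ → ℝ × ℝ, ContDiff ℝ ∞ c → IsOpen (c ⁻¹' A)) : IsOpen A := by
  rw [isOpen_iff_mem_nhds]
  intro x hx
  by_contra hn
  have : ∀ n : ℕ, ∃ y, ‖y - x‖ ≤ ((n.factorial : ℝ))⁻¹ ∧ y ∉ A := by
    intro n
    by_contra hcon
    push Not at hcon
    exact hn (mem_of_superset (Metric.closedBall_mem_nhds x
      (show (0:ℝ) < ((n.factorial : ℝ))⁻¹ by positivity)) fun y hy => hcon y (by simpa [dist_eq_norm] using hy))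
  choose y hy hyA using this
  obtain ⟨γ, hγ, h0, hγn⟩ := exists_planeCurve_through hy 0
  have h1 : γ ⁻¹' A ∈ 𝓝 (0:ℝ) := (h γ hγ).mem_nhds (by rwa [mem_preimage, h0])
  obtain ⟨n, hn⟩ := (tendsto_two_pow_inv.eventually h1).exists
  have := (hγn n).self_of_nhds
  rw [smul_zero, add_zero] at this
  exact hyA n (by rw [← this]; exact hn)

/-- Preimages of open sets are open along every smooth curve, and in the plane this test detects
openness. -/
theorem ConvSmoothOn.continuousOn_plane {f : ℝ × ℝ → ℝ} {W : Set (ℝ × ℝ)} (hW : IsOpen W)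
    (hf : ConvSmoothOn f W) : ContinuousOn f W := by
  rw [continuousOn_open_iff hW]
  intro O hO
  refine isOpen_of_forall_curve fun c hc => ?_
  have hI : IsOpen (c ⁻¹' W) := hW.preimage hc.continuous
  have h1 := (smoothCurveOn_real_iff hI).1
    (hf (c ⁻¹' W) c hI ((smoothCurveOn_plane_iff hI).2 hc.contDiffOn) (mapsTo_preimage _ _))
  exact h1.continuousOn.isOpen_inter_preimage hI hO

/-- Otherwise points y n tend to `x` factorially fast with k-th derivative in direction v beyond
(n!)ᵏ n. Along a curve through them with velocity v / n! only the factor (n!)ᵏ is lost, so the k-th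
derivative of the composite would be unbounded on 2⁻ⁿ → 0, though it is continuous. -/
theorem exists_bound_iteratedDeriv_line {f : ℝ × ℝ → ℝ} (hf : ConvSmoothOn f univ) (v : ℝ × ℝ)
    (k : ℕ) (x : ℝ × ℝ) :
    ∃ U ∈ 𝓝 x, ∃ C, ∀ y ∈ U, |iteratedDeriv k (fun s : ℝ => f (y + s • v)) 0| ≤ C := by
  by_contra hcon
  push Not at hcon
  have : ∀ n : ℕ, ∃ y, ‖y - x‖ ≤ ((n.factorial : ℝ))⁻¹ ∧
      (n.factorial : ℝ) ^ k * n < |iteratedDeriv k (fun s : ℝ => f (y + s • v)) 0| := by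
    intro n
    obtain ⟨y, hy, hlt⟩ := hcon _ (Metric.closedBall_mem_nhds x
      (show (0:ℝ) < ((n.factorial : ℝ))⁻¹ by positivity)) ((n.factorial : ℝ) ^ k * n)
    exact ⟨y, by simpa [dist_eq_norm] using hy, hlt⟩
  choose y hy hlt using this
  obtain ⟨γ, hγ, h0, hγn⟩ := exists_planeCurve_through hy v
  have hs : ∀ c : ℝ → ℝ × ℝ, ContDiff ℝ ∞ c → ContDiff ℝ ∞ fun t => f (c t) := fun c hc =>
    contDiffOn_univ.1 ((smoothCurveOn_real_iff isOpen_univ).1 (hf univ c isOpen_univ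
      ((smoothCurveOn_plane_iff isOpen_univ).2 hc.contDiffOn) (mapsTo_univ _ _)))
  have hcont : Continuous (iteratedDeriv k fun t => f (γ t)) :=
    (hs γ hγ).continuous_iteratedDeriv k (WithTop.coe_le_coe.2 le_top)
  have hder : ∀ n : ℕ, iteratedDeriv k (fun t => f (γ t)) ((2 ^ n)⁻¹) =
      ((n.factorial : ℝ)⁻¹) ^ k * iteratedDeriv k (fun s : ℝ => f (y n + s • v)) 0 := by
    intro n
    have h1 : (fun t => f (γ t)) =ᶠ[𝓝 ((2 ^ n)⁻¹ : ℝ)]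
        fun t => f (y n + ((n.factorial : ℝ)⁻¹ * (t - (2 ^ n)⁻¹)) • v) := by
      filter_upwards [hγn n] with t ht
      rw [ht]
    have h2 : ContDiff ℝ k (fun s : ℝ => f (y n + s • v)) :=
      (hs _ (contDiff_const.add (contDiff_id.smul contDiff_const))).of_le
        (WithTop.coe_le_coe.2 le_top)
    rw [h1.iteratedDeriv_eq k]
    have h3 := congrFun (iteratedDeriv_comp_sub_const k
      (fun t : ℝ => f (y n + ((n.factorial : ℝ)⁻¹ * t) • v)) ((2 ^ n)⁻¹)) ((2 ^ n)⁻¹)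
    have h4 := congrFun (iteratedDeriv_comp_const_mul h2 ((n.factorial : ℝ)⁻¹)) 0
    simp only [sub_self] at h3
    rw [h3, h4, mul_zero]
  have hlim := (hcont.tendsto 0).comp tendsto_two_pow_inv
  obtain ⟨C, hC⟩ := hlim.norm.bddAbove_range
  obtain ⟨n, hn⟩ := exists_nat_gt C
  have h5 : ‖iteratedDeriv k (fun t => f (γ t)) ((2 ^ n)⁻¹)‖ ≤ C := hC ⟨n, rfl⟩
  rw [hder, norm_mul, norm_pow, norm_inv, Real.norm_natCast, inv_pow] at h5
  rw [inv_mul_le_iff₀ (by positivity)] at h5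
  have h6 := hlt n
  rw [Real.norm_eq_abs] at h5
  have h7 : (n.factorial : ℝ) ^ k * C < (n.factorial : ℝ) ^ k * n := by gcongr
  linarith

/-- Compactness of the support makes the local bounds on pure derivatives global, and off the
support these derivatives vanish; then `contDiff_of_bounded_partials` applies. -/
theorem ConvSmoothOn.contDiff_of_hasCompactSupport {f : ℝ × ℝ → ℝ} (hf : ConvSmoothOn f univ)
    (hc : HasCompactSupport f) : ContDiff ℝ ∞ f := by
  have hs : ∀ c : ℝ → ℝ × ℝ, ContDiff ℝ ∞ c → ContDiff ℝ ∞ fun t => f (c t) := fun c hc =>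
    contDiffOn_univ.1 ((smoothCurveOn_real_iff isOpen_univ).1 (hf univ c isOpen_univ
      ((smoothCurveOn_plane_iff isOpen_univ).2 hc.contDiffOn) (mapsTo_univ _ _)))
  have hcont : Continuous f := continuousOn_univ.1 (hf.continuousOn_plane isOpen_univ)
  have hbd : ∀ (v : ℝ × ℝ) (k : ℕ), ∃ M, ∀ y,
      |iteratedDeriv k (fun s : ℝ => f (y + s • v)) 0| ≤ M := by
    intro v k
    obtain ⟨M, hM⟩ : ∃ M, ∀ y ∈ tsupport f,
        |iteratedDeriv k (fun s : ℝ => f (y + s • v)) 0| ≤ M := by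
      refine hc.isCompact.induction_on
        (p := fun s => ∃ M, ∀ y ∈ s, |iteratedDeriv k (fun s : ℝ => f (y + s • v)) 0| ≤ M)
        ⟨0, by simp⟩ (fun s t hst ⟨M, hM⟩ => ⟨M, fun y hy => hM y (hst hy)⟩)
        (fun s t ⟨M, hM⟩ ⟨M', hM'⟩ => ⟨max M M', fun y hy => ?_⟩) (fun x _ => ?_)
      · rcases hy with hy | hy
        · exact (hM y hy).trans (le_max_left _ _)
        · exact (hM' y hy).trans (le_max_right _ _)
      · obtain ⟨U, hU, C, hC⟩ := exists_bound_iteratedDeriv_line hf v k x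
        exact ⟨U, mem_nhdsWithin_of_mem_nhds hU, C, hC⟩
    refine ⟨max M 0, fun y => ?_⟩
    by_cases hy : y ∈ tsupport f
    · exact (hM y hy).trans (le_max_left _ _)
    · have h1 : (fun s : ℝ => f (y + s • v)) =ᶠ[𝓝 0] fun _ => 0 := by
        have hcl : ContinuousAt (fun s : ℝ => y + s • v) 0 := by fun_prop
        have : ∀ᶠ s in 𝓝 (0:ℝ), y + s • v ∈ (tsupport f)ᶜ :=
          hcl.eventually ((isClosed_tsupport f).isOpen_compl.mem_nhds (by simpa using hy))
        filter_upwards [this] with s hs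
        exact image_eq_zero_of_notMem_tsupport hs
      rw [h1.iteratedDeriv_eq k]
      have : iteratedDeriv k (fun _ : ℝ => (0:ℝ)) 0 = 0 := by
        simp
      rw [this, abs_zero]
      exact le_max_right _ _
  obtain ⟨R, hR⟩ := hc.isCompact.isBounded.exists_norm_le
  have hsupp : ∀ p : ℝ × ℝ, |R| < ‖p‖ → f p = 0 := by
    intro p hp
    by_contra h
    exact absurd ((hR p (subset_tsupport f h)).trans (le_abs_self R)) (not_le.2 hp)
  have hco : ∀ (k : ℕ) {g : ℝ → ℝ} (hg : ContDiff ℝ ∞ g) (s : ℝ),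
      ‖iteratedDeriv k (fun s => (g s : ℂ)) s‖ = |iteratedDeriv k g s| := by
    intro k g hg s
    rw [← norm_iteratedFDeriv_eq_norm_iteratedDeriv, ← Real.norm_eq_abs,
      ← norm_iteratedFDeriv_eq_norm_iteratedDeriv]
    exact Complex.ofRealLI.norm_iteratedFDeriv_comp_left (hg.contDiffAt (x := s))
      (WithTop.coe_le_coe.2 le_top)
  have hF := contDiff_of_bounded_partials (F := fun p => (f p : ℂ)) (abs_nonneg R)
    (Complex.continuous_ofReal.comp hcont)
    (fun y => Complex.ofRealCLM.contDiff.comp (hs _ (contDiff_id.prodMk contDiff_const)))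
    (fun x => Complex.ofRealCLM.contDiff.comp (hs _ (contDiff_const.prodMk contDiff_id)))
    (fun x y h => by rw [hsupp (x, y) (h.trans_le (norm_fst_le (x, y)))]; simp)
    (fun x y h => by rw [hsupp (x, y) (h.trans_le (norm_snd_le (x, y)))]; simp)
    (fun k => by
      obtain ⟨M, hM⟩ := hbd (1, 0) k
      refine ⟨M, fun y x => ?_⟩
      rw [hco k (g := fun x => f (x, y)) (hs _ (contDiff_id.prodMk contDiff_const))]
      have := congrFun (iteratedDeriv_comp_const_add k (fun s => f (s, y)) x) 0
      rw [add_zero] at this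
      rw [← this]
      convert hM (x, y) using 5
      simp)
    (fun k => by
      obtain ⟨M, hM⟩ := hbd (0, 1) k
      refine ⟨M, fun x y => ?_⟩
      rw [hco k (g := fun y => f (x, y)) (hs _ (contDiff_const.prodMk contDiff_id))]
      have := congrFun (iteratedDeriv_comp_const_add k (fun s => f (x, s)) y) 0
      rw [add_zero] at this
      rw [← this]
      convert hM (x, y) using 5
      simp)
  have := Complex.reCLM.contDiff.comp hF
  simpa [Function.comp_def] using this

/-- **Boman's theorem** in the plane. -/
theorem ConvSmoothOn.contDiffOn_plane {f : ℝ × ℝ → ℝ} {W : Set (ℝ × ℝ)} (hW : IsOpen W)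
    (hf : ConvSmoothOn f W) : ContDiffOn ℝ ∞ f W := by
  intro x hx
  obtain ⟨r, hr0, hr⟩ := Metric.nhds_basis_closedBall.mem_iff.1 (hW.mem_nhds hx)
  let χ : ContDiffBump x := ⟨r / 2, r, half_pos hr0, half_lt_self hr0⟩
  have hχW : tsupport χ ⊆ W := by rw [χ.tsupport_eq]; exact hr
  -- The product with a bump supported in `W` is smooth along all curves, also those leaving `W`,
  -- and equals `f` near `x`.
  have hF : ConvSmoothOn (fun p => χ p * f p) univ := by
    intro I c hI hc _
    have hc' := (smoothCurveOn_plane_iff hI).1 hc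
    rw [smoothCurveOn_real_iff hI]
    intro t ht
    refine ContDiffAt.contDiffWithinAt ?_
    have hct : ContDiffAt ℝ ∞ c t := hc'.contDiffAt (hI.mem_nhds ht)
    by_cases htW : c t ∈ W
    · have hJ : IsOpen (I ∩ c ⁻¹' W) := hc'.continuousOn.isOpen_inter_preimage hI hW
      have h1 := (smoothCurveOn_real_iff hJ).1 (hf _ c hJ
        ((smoothCurveOn_plane_iff hJ).2 (hc'.mono inter_subset_left)) fun s hs => hs.2)
      exact (χ.contDiff.contDiffAt.comp t hct).mul (h1.contDiffAt (hJ.mem_nhds ⟨ht, htW⟩))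
    · have h1 : ∀ᶠ s in 𝓝 t, c s ∈ (tsupport χ)ᶜ := hct.continuousAt.eventually
        ((isClosed_tsupport χ).isOpen_compl.mem_nhds fun h => htW (hχW h))
      refine (contDiffAt_const (c := (0:ℝ))).congr_of_eventuallyEq ?_
      filter_upwards [h1] with s hs
      rw [image_eq_zero_of_notMem_tsupport hs, zero_mul]
  have h1 := hF.contDiff_of_hasCompactSupport χ.hasCompactSupport.mul_right
  refine (h1.contDiffAt.congr_of_eventuallyEq ?_).contDiffWithinAt
  filter_upwards [χ.eventuallyEq_one] with p hp
  simp only [hp, Pi.one_apply, one_mul]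

end Boman
end

noncomputable section
open scoped ContDiff

/-! ## Calculus of convenient smooth maps -/

section ConvenientRules

variable {E F G H : Type*}
  [AddCommGroup E] [Module ℝ E] [TopologicalSpace E] [ConvenientSpace E]
  [AddCommGroup F] [Module ℝ F] [TopologicalSpace F] [ConvenientSpace F]
  [AddCommGroup G] [Module ℝ G] [TopologicalSpace G] [ConvenientSpace G]
  [AddCommGroup H] [Module ℝ H] [TopologicalSpace H] [ConvenientSpace H]

/-! ### Smooth curves -/

theorem SmoothCurveOn.hasDerivAt {c : ℝ → E} {I : Set ℝ} (hc : SmoothCurveOn c I) {t : ℝ}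
    (ht : t ∈ I) : HasDerivAt c (deriv c t) t :=
  hasDerivAt_deriv_of_differentiableAt (hc 0 t ht)

theorem SmoothCurveOn.deriv_eq_of_dual {c : ℝ → E} {I : Set ℝ} (hc : SmoothCurveOn c I) {t : ℝ}
    (ht : t ∈ I) {v : E} (h : ∀ l : E →L[ℝ] ℝ, HasDerivAt (fun s => l (c s)) (l v) t) :
    deriv c t = v :=
  eq_of_forall_dual fun l => ((hc.hasDerivAt ht).dual l).unique (h l)

theorem SmoothCurveOn.congr {c c' : ℝ → E} {I : Set ℝ} (hI : IsOpen I) (hc : SmoothCurveOn c I)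
    (h : EqOn c' c I) : SmoothCurveOn c' I := by
  rw [smoothCurveOn_iff_dual hI] at hc ⊢
  exact fun l => (hc l).congr fun t ht => by rw [h ht]

theorem SmoothCurveOn.deriv_congr {c c' : ℝ → E} {I : Set ℝ} (hI : IsOpen I)
    (hc : SmoothCurveOn c I) (h : EqOn c' c I) {t : ℝ} (ht : t ∈ I) : deriv c' t = deriv c t := by
  refine (hc.congr hI h).deriv_eq_of_dual ht fun l => ?_
  refine ((hc.hasDerivAt ht).dual l).congr_of_eventuallyEq ?_
  filter_upwards [hI.mem_nhds ht] with s hs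
  rw [h hs]

theorem SmoothCurveOn.mono {c : ℝ → E} {I J : Set ℝ} (hc : SmoothCurveOn c I) (h : J ⊆ I) :
    SmoothCurveOn c J := fun n t ht => hc n t (h ht)

theorem SmoothCurveOn.of_local {c : ℝ → E} {I : Set ℝ}
    (h : ∀ t ∈ I, ∃ J : Set ℝ, t ∈ J ∧ SmoothCurveOn c J) : SmoothCurveOn c I := by
  intro n t ht
  obtain ⟨J, htJ, hJ⟩ := h t ht
  exact hJ n t htJ

theorem SmoothCurveOn.deriv_curve {c : ℝ → E} {I : Set ℝ} (hc : SmoothCurveOn c I) :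
    SmoothCurveOn (deriv c) I := fun n t ht => hc (n + 1) t ht

theorem SmoothCurveOn.comp_real {c : ℝ → E} {I J : Set ℝ} (hI : IsOpen I) (hJ : IsOpen J)
    (hc : SmoothCurveOn c I) {h : ℝ → ℝ} (hh : ContDiffOn ℝ ∞ h J) (hm : MapsTo h J I) :
    SmoothCurveOn (fun t => c (h t)) J := by
  rw [smoothCurveOn_iff_dual hI] at hc
  rw [smoothCurveOn_iff_dual hJ]
  exact fun l => (hc l).comp hh hm

theorem smoothCurveOn_const (x : E) {I : Set ℝ} (hI : IsOpen I) :
    SmoothCurveOn (fun _ => x) I := by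
  rw [smoothCurveOn_iff_dual hI]; exact fun l => contDiffOn_const

theorem SmoothCurveOn.add {c d : ℝ → E} {I : Set ℝ} (hI : IsOpen I) (hc : SmoothCurveOn c I)
    (hd : SmoothCurveOn d I) : SmoothCurveOn (fun t => c t + d t) I := by
  rw [smoothCurveOn_iff_dual hI] at *
  intro l
  simpa using (hc l).add (hd l)

theorem SmoothCurveOn.smul {a : ℝ → ℝ} {c : ℝ → E} {I : Set ℝ} (hI : IsOpen I)
    (ha : ContDiffOn ℝ ∞ a I) (hc : SmoothCurveOn c I) : SmoothCurveOn (fun t => a t • c t) I := by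
  rw [smoothCurveOn_iff_dual hI] at *
  intro l
  simpa using ha.mul (hc l)

theorem smoothCurveOn_prodMk {c : ℝ → E} {d : ℝ → F} {I : Set ℝ} (hI : IsOpen I)
    (hc : SmoothCurveOn c I) (hd : SmoothCurveOn d I) : SmoothCurveOn (fun t => (c t, d t)) I := by
  rw [smoothCurveOn_iff_dual hI] at *
  intro l
  have h1 := (hc (l.comp (ContinuousLinearMap.inl ℝ E F))).add
    (hd (l.comp (ContinuousLinearMap.inr ℝ E F)))
  refine h1.congr fun t _ => ?_
  simp [← map_add]

theorem SmoothCurveOn.fst {c : ℝ → E × F} {I : Set ℝ} (hI : IsOpen I) (hc : SmoothCurveOn c I) :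
    SmoothCurveOn (fun t => (c t).1) I := by
  rw [smoothCurveOn_iff_dual hI] at *
  exact fun l => hc (l.comp (ContinuousLinearMap.fst ℝ E F))

theorem SmoothCurveOn.snd {c : ℝ → E × F} {I : Set ℝ} (hI : IsOpen I) (hc : SmoothCurveOn c I) :
    SmoothCurveOn (fun t => (c t).2) I := by
  rw [smoothCurveOn_iff_dual hI] at *
  exact fun l => hc (l.comp (ContinuousLinearMap.snd ℝ E F))

theorem deriv_prodMk {c : ℝ → E} {d : ℝ → F} {I : Set ℝ} (hI : IsOpen I)
    (hc : SmoothCurveOn c I) (hd : SmoothCurveOn d I) {t : ℝ} (ht : t ∈ I) :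
    deriv (fun t => (c t, d t)) t = (deriv c t, deriv d t) := by
  refine (smoothCurveOn_prodMk hI hc hd).deriv_eq_of_dual ht fun l => ?_
  have h1 := ((hc.hasDerivAt ht).dual (l.comp (ContinuousLinearMap.inl ℝ E F))).add
    ((hd.hasDerivAt ht).dual (l.comp (ContinuousLinearMap.inr ℝ E F)))
  refine (h1.congr_of_eventuallyEq (Eventually.of_forall fun s => ?_)).congr_deriv ?_
  · simp [← map_add]
  · simp [← map_add]

/-! ### Open sets for the `c^∞`-topology -/

/-- `s` is open for the `c^∞`-topology. -/
def CInfOpen (s : Set E) : Prop := IsOpen (X := CInf E) s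

theorem cInfOpen_iff {s : Set E} :
    CInfOpen s ↔ ∀ c : ℝ → E, SmoothCurveOn c univ → IsOpen (c ⁻¹' s) := by
  refine (isOpen_iSup_iff (s := (s : Set (CInf E)))).trans ?_
  simp only [Subtype.forall]
  rfl

/-- With a cut-off χ, the map s ↦ t + χ(s)(s - t) stays near t and is the identity close to t. It
extends germs of curves to the whole line, where the curves defining the c^∞-topology live. -/
theorem exists_global_reparametrization {I : Set ℝ} (hI : IsOpen I) {t : ℝ} (ht : t ∈ I) :
    ∃ h : ℝ → ℝ, ContDiff ℝ ∞ h ∧ (∀ s, h s ∈ I) ∧ ∀ᶠ s in 𝓝 t, h s = s := by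
  obtain ⟨r, hr0, hr⟩ := Metric.isOpen_iff.1 hI t ht
  let χ : ContDiffBump t := ⟨r / 4, r / 2, by positivity, by linarith⟩
  refine ⟨fun s => t + χ s * (s - t), ?_, fun s => hr ?_, ?_⟩
  · exact contDiff_const.add (χ.contDiff.mul (contDiff_id.sub contDiff_const))
  · rw [Metric.mem_ball, Real.dist_eq, add_sub_cancel_left, abs_mul, abs_of_nonneg χ.nonneg]
    by_cases hs : dist s t < r / 2
    · rw [Real.dist_eq] at hs
      have := mul_le_of_le_one_left (abs_nonneg (s - t)) (χ.le_one (x := s))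
      linarith
    · rw [χ.zero_of_le_dist (not_lt.1 hs), zero_mul]; exact hr0
  · filter_upwards [χ.eventuallyEq_one] with s hs
    rw [hs]; simp

theorem CInfOpen.isOpen_preimage {s : Set E} (hs : CInfOpen s) {I : Set ℝ} (hI : IsOpen I)
    {c : ℝ → E} (hc : SmoothCurveOn c I) : IsOpen (I ∩ c ⁻¹' s) := by
  rw [isOpen_iff_mem_nhds]
  rintro t ⟨ht, hts⟩
  obtain ⟨h, hh, hhI, hht⟩ := exists_global_reparametrization hI ht
  have h1 := cInfOpen_iff.1 hs (fun s => c (h s))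
    (hc.comp_real hI isOpen_univ hh.contDiffOn fun s _ => hhI s)
  have h2 : (fun s => c (h s)) ⁻¹' s ∈ 𝓝 t :=
    h1.mem_nhds (by rw [mem_preimage, hht.self_of_nhds]; exact hts)
  filter_upwards [h2, hht, hI.mem_nhds ht] with u hu hhu huI
  rw [mem_preimage, hhu] at hu
  exact ⟨huI, hu⟩

theorem cInfOpen_univ : CInfOpen (univ : Set E) := isOpen_univ (X := CInf E)

theorem CInfOpen.prod_univ {s : Set E} (hs : CInfOpen s) :
    CInfOpen (s ×ˢ (univ : Set F)) := by
  rw [cInfOpen_iff]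
  intro c hc
  have := hs.isOpen_preimage isOpen_univ (hc.fst isOpen_univ)
  convert this using 1
  ext t; simp

/-! ### Smooth maps -/

theorem ConvSmoothOn.mono {f : E → F} {s t : Set E} (hf : ConvSmoothOn f s) (h : t ⊆ s) :
    ConvSmoothOn f t := fun I c hI hc hm => hf I c hI hc fun _ hx => h (hm hx)

theorem ConvSmoothOn.congr {f g : E → F} {s : Set E} (hf : ConvSmoothOn f s) (h : EqOn g f s) :
    ConvSmoothOn g s := fun I c hI hc hm => (hf I c hI hc hm).congr hI fun _ ht => h (hm ht)

theorem ConvSmoothOn.comp {f : E → F} {g : F → G} {s : Set E} {t : Set F}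
    (hg : ConvSmoothOn g t) (hf : ConvSmoothOn f s) (h : MapsTo f s t) :
    ConvSmoothOn (fun x => g (f x)) s :=
  fun I c hI hc hm => hg I _ hI (hf I c hI hc hm) fun _ hx => h (hm hx)

theorem ConvSmoothOn.of_local {f : E → F} {s : Set E}
    (h : ∀ x ∈ s, ∃ D, CInfOpen D ∧ x ∈ D ∧ ConvSmoothOn f (D ∩ s)) : ConvSmoothOn f s := by
  intro I c hI hc hm
  refine SmoothCurveOn.of_local fun t ht => ?_
  obtain ⟨D, hD, hx, hf⟩ := h _ (hm ht)
  have hJ := hD.isOpen_preimage hI hc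
  exact ⟨I ∩ c ⁻¹' D, ⟨ht, hx⟩, hf _ c hJ (hc.mono inter_subset_left) fun u hu => ⟨hu.2, hm hu.1⟩⟩

theorem convSmoothOn_const (y : F) (s : Set E) : ConvSmoothOn (fun _ : E => y) s :=
  fun _ _ hI _ _ => smoothCurveOn_const y hI

theorem convSmoothOn_id (s : Set E) : ConvSmoothOn (fun x : E => x) s := fun _ _ _ hc _ => hc

theorem ConvSmoothOn.add {f g : E → F} {s : Set E} (hf : ConvSmoothOn f s)
    (hg : ConvSmoothOn g s) : ConvSmoothOn (fun x => f x + g x) s :=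
  fun I c hI hc hm => (hf I c hI hc hm).add hI (hg I c hI hc hm)

theorem ConvSmoothOn.smul {a : E → ℝ} {f : E → F} {s : Set E} (ha : ConvSmoothOn a s)
    (hf : ConvSmoothOn f s) : ConvSmoothOn (fun x => a x • f x) s :=
  fun I c hI hc hm => SmoothCurveOn.smul hI
    ((smoothCurveOn_real_iff hI).1 (ha I c hI hc hm)) (hf I c hI hc hm)

theorem ConvSmoothOn.neg {f : E → F} {s : Set E} (hf : ConvSmoothOn f s) :
    ConvSmoothOn (fun x => -f x) s := by
  have := (convSmoothOn_const (-1 : ℝ) s).smul hf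
  simpa using this

theorem ConvSmoothOn.sub {f g : E → F} {s : Set E} (hf : ConvSmoothOn f s)
    (hg : ConvSmoothOn g s) : ConvSmoothOn (fun x => f x - g x) s := by
  simpa [sub_eq_add_neg] using hf.add hg.neg

theorem ConvSmoothOn.prodMk {f : E → F} {g : E → G} {s : Set E} (hf : ConvSmoothOn f s)
    (hg : ConvSmoothOn g s) : ConvSmoothOn (fun x => (f x, g x)) s :=
  fun I c hI hc hm => smoothCurveOn_prodMk hI (hf I c hI hc hm) (hg I c hI hc hm)

theorem convSmoothOn_fst (s : Set (E × F)) : ConvSmoothOn (fun x : E × F => x.1) s :=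
  fun _ _ hI hc _ => hc.fst hI

theorem convSmoothOn_snd (s : Set (E × F)) : ConvSmoothOn (fun x : E × F => x.2) s :=
  fun _ _ hI hc _ => hc.snd hI

theorem ContinuousLinearMap.convSmoothOn (l : E →L[ℝ] ℝ) (s : Set E) : ConvSmoothOn l s :=
  fun _ _ hI hc _ => (smoothCurveOn_real_iff hI).2 (hc.contDiffOn_dual hI l)

theorem convSmoothOn_curve {c : ℝ → E} {I : Set ℝ} (hI : IsOpen I) (hc : SmoothCurveOn c I) :
    ConvSmoothOn c I :=
  fun _ _ hJ hd hm => hc.comp_real hI hJ ((smoothCurveOn_real_iff hJ).1 hd) hm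

/-! ### Two-parameter families -/

theorem isOpen_preimage_plane {D : Set E} (hD : CInfOpen D) {φ : ℝ × ℝ → E} {W : Set (ℝ × ℝ)}
    (hW : IsOpen W) (hφ : ConvSmoothOn φ W) : IsOpen (W ∩ φ ⁻¹' D) := by
  refine isOpen_of_forall_curve fun c hc => ?_
  have hI : IsOpen (c ⁻¹' W) := hW.preimage hc.continuous
  exact hD.isOpen_preimage hI (hφ _ c hI ((smoothCurveOn_plane_iff hI).2 hc.contDiffOn)
    (mapsTo_preimage _ _))

theorem ConvSmoothOn.contDiffOn_dual_plane {g : ℝ × ℝ → E} {W : Set (ℝ × ℝ)} (hW : IsOpen W)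
    (hg : ConvSmoothOn g W) (l : E →L[ℝ] ℝ) : ContDiffOn ℝ ∞ (fun p => l (g p)) W :=
  ConvSmoothOn.contDiffOn_plane hW ((l.convSmoothOn univ).comp hg (mapsTo_univ _ _))

theorem convSmoothOn_affine_family (x v w : E) :
    ConvSmoothOn (fun p : ℝ × ℝ => x + p.1 • v + p.2 • w) univ :=
  ((convSmoothOn_const x _).add ((convSmoothOn_fst _).smul (convSmoothOn_const v _))).add
    ((convSmoothOn_snd _).smul (convSmoothOn_const w _))

theorem smoothCurveOn_line (x v : E) : SmoothCurveOn (fun t : ℝ => x + t • v) univ :=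
  (smoothCurveOn_const x isOpen_univ).add isOpen_univ
    (SmoothCurveOn.smul isOpen_univ contDiffOn_id (smoothCurveOn_const v isOpen_univ))

theorem CInfOpen.isOpen_line {D : Set E} (hD : CInfOpen D) (x v : E) :
    IsOpen {t : ℝ | x + t • v ∈ D} := by
  have := hD.isOpen_preimage isOpen_univ (smoothCurveOn_line x v)
  rwa [univ_inter] at this

theorem ConvSmoothOn.smoothCurveOn_line {f : E → F} {D : Set E} (hD : CInfOpen D)
    (hf : ConvSmoothOn f D) (x v : E) :
    SmoothCurveOn (fun t : ℝ => f (x + t • v)) {t : ℝ | x + t • v ∈ D} :=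
  hf _ _ (hD.isOpen_line x v) ((_root_.smoothCurveOn_line x v).mono (subset_univ _)) fun _ ht => ht

theorem ConvSmoothOn.hasDerivAt_line {f : E → F} {D : Set E} (hD : CInfOpen D)
    (hf : ConvSmoothOn f D) {x : E} (hx : x ∈ D) (v : E) :
    HasDerivAt (fun t : ℝ => f (x + t • v)) (dirDeriv f x v) 0 :=
  (hf.smoothCurveOn_line hD x v).hasDerivAt (by simpa using hx)

theorem dirDeriv_eq_of_dual {f : E → F} {D : Set E} (hD : CInfOpen D)
    (hf : ConvSmoothOn f D) {x : E} (hx : x ∈ D) {v : E} {w : F}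
    (h : ∀ l : F →L[ℝ] ℝ, HasDerivAt (fun t : ℝ => l (f (x + t • v))) (l w) 0) :
    dirDeriv f x v = w :=
  (hf.smoothCurveOn_line hD x v).deriv_eq_of_dual (by simpa using hx) h

theorem dirDeriv_congr {f g : E → F} {D : Set E} (hD : CInfOpen D) (hf : ConvSmoothOn f D)
    (h : EqOn g f D) {x : E} (hx : x ∈ D) (v : E) : dirDeriv g x v = dirDeriv f x v :=
  (hf.smoothCurveOn_line hD x v).deriv_congr (hD.isOpen_line x v) (fun _ ht => h ht)
    (by simpa using hx)

/-- The derivative of a smooth map is smooth. -/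
theorem ConvSmoothOn.dirDeriv {f : E → F} {D : Set E} (hD : CInfOpen D) (hf : ConvSmoothOn f D) :
    ConvSmoothOn (fun q : E × E => dirDeriv f q.1 q.2) (D ×ˢ univ) := by
  intro I c hI hc hm
  have h1 := convSmoothOn_curve hI (hc.fst hI)
  have h2 := convSmoothOn_curve hI (hc.snd hI)
  have hW₀ : IsOpen ((univ : Set ℝ) ×ˢ I) := isOpen_univ.prod hI
  -- A curve (x(t), v(t)) yields the two-parameter family x(t) + s v(t). By Boman's theorem `f` of
  -- it is scalarwise smooth in (s, t), and the curve in question is its partial derivative in s at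
  -- s = 0.
  have hφ : ConvSmoothOn (fun p : ℝ × ℝ => (c p.2).1 + p.1 • (c p.2).2) (univ ×ˢ I) :=
    (h1.comp (convSmoothOn_snd _) fun p hp => hp.2).add
      ((convSmoothOn_fst _).smul (h2.comp (convSmoothOn_snd _) fun p hp => hp.2))
  have hW := isOpen_preimage_plane hD hW₀ hφ
  have hg := hf.comp (hφ.mono inter_subset_left) fun p hp => hp.2
  have hmem : ∀ t ∈ I, ((0:ℝ), t) ∈ (univ ×ˢ I) ∩
      (fun p : ℝ × ℝ => (c p.2).1 + p.1 • (c p.2).2) ⁻¹' D := fun t ht =>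
    ⟨⟨mem_univ _, ht⟩, by simpa using (hm ht).1⟩
  rw [smoothCurveOn_iff_dual hI]
  intro l
  have hl := hg.contDiffOn_dual_plane hW l
  have hfd := ((contDiffOn_infty_iff_fderiv_of_isOpen hW).1 hl).2
  have h3 : ContDiffOn ℝ ∞ (fun t : ℝ => fderiv ℝ
      (fun p : ℝ × ℝ => l (f ((c p.2).1 + p.1 • (c p.2).2))) ((0:ℝ), t) (1, 0)) I :=
    (hfd.comp (contDiff_const.prodMk contDiff_id).contDiffOn hmem).clm_apply contDiffOn_const
  refine h3.congr fun t ht => ?_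
  have h4 := (hf.hasDerivAt_line hD (hm ht).1 (c t).2).dual l
  have h5 := (((hl.differentiableOn (by simp)).differentiableAt
    (hW.mem_nhds (hmem t ht))).hasFDerivAt).comp_hasDerivAt (0:ℝ)
      ((hasDerivAt_id (0:ℝ)).prodMk (hasDerivAt_const (0:ℝ) t))
  exact h4.unique h5

/-! ### Hadamard's lemma and the chain rule -/

/-- Differentiation under the integral replaces g by g' and raises the power of u by one; the factor
u ^ n is there to close the induction on the order of differentiability. -/
theorem contDiff_integral_pow_mul (g : ℝ → ℝ) (hg : ContDiff ℝ ∞ g) (n : ℕ) :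
    ContDiff ℝ ∞ fun r : ℝ => ∫ u in (0:ℝ)..1, u ^ n * g (u * r) := by
  have key : ∀ (N : ℕ) (g : ℝ → ℝ) (n : ℕ), ContDiff ℝ ∞ g →
      ContDiff ℝ N fun r : ℝ => ∫ u in (0:ℝ)..1, u ^ n * g (u * r) := by
    intro N
    have hder : ∀ (g : ℝ → ℝ) (n : ℕ), ContDiff ℝ ∞ g → ∀ r : ℝ,
        HasDerivAt (fun r : ℝ => ∫ u in (0:ℝ)..1, u ^ n * g (u * r))
          (∫ u in (0:ℝ)..1, u ^ (n + 1) * deriv g (u * r)) r := by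
      intro g n hg r
      have hgc : Continuous g := hg.continuous
      have hg'c : Continuous (deriv g) := hg.continuous_deriv (by simp)
      obtain ⟨C, hC⟩ := (isCompact_closedBall (0:ℝ) (|r| + 1)).exists_bound_of_continuousOn
        hg'c.continuousOn
      refine (intervalIntegral.hasDerivAt_integral_of_dominated_loc_of_deriv_le
        (bound := fun _ => C) (F' := fun r u => u ^ (n + 1) * deriv g (u * r))
        (s := Metric.ball r 1) (Metric.ball_mem_nhds r one_pos)
        (Eventually.of_forall fun s => ?_) ?_ ?_ ?_ ?_ ?_).2
      · exact (by fun_prop : Continuous fun u => u ^ n * g (u * s)).aestronglyMeasurable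
      · exact (by fun_prop : Continuous fun u => u ^ n * g (u * r)).intervalIntegrable _ _
      · exact (by fun_prop : Continuous fun u =>
          u ^ (n + 1) * deriv g (u * r)).aestronglyMeasurable
      · refine Eventually.of_forall fun u hu s hs => ?_
        rw [uIoc_of_le zero_le_one] at hu
        rw [norm_mul, norm_pow, Real.norm_of_nonneg hu.1.le]
        have h1 : u ^ (n + 1) ≤ 1 := pow_le_one₀ hu.1.le hu.2
        have h2 : |s| ≤ |r| + 1 := by
          rw [Metric.mem_ball, Real.dist_eq] at hs
          have := abs_sub_abs_le_abs_sub s r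
          linarith
        have h3 : u * s ∈ Metric.closedBall (0:ℝ) (|r| + 1) := by
          rw [mem_closedBall_zero_iff, norm_mul, Real.norm_of_nonneg hu.1.le]
          exact (mul_le_of_le_one_left (abs_nonneg _) hu.2).trans h2
        exact (mul_le_of_le_one_left (norm_nonneg _) h1).trans (hC _ h3)
      · exact intervalIntegrable_const
      · refine Eventually.of_forall fun u _ s _ => ?_
        have h1 : HasDerivAt g (deriv g (u * s)) (u * s) :=
          (hg.differentiable (by simp) _).hasDerivAt
        have h2 := (h1.comp s ((hasDerivAt_id s).const_mul u)).const_mul (u ^ n)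
        refine h2.congr_deriv ?_
        rw [pow_succ]; simp; ring
    induction N with
    | zero =>
      intro g n hg
      rw [Nat.cast_zero, contDiff_zero]
      exact continuous_iff_continuousAt.2 fun r => (hder g n hg r).continuousAt
    | succ N ih =>
      intro g n hg
      rw [Nat.cast_add, Nat.cast_one, contDiff_succ_iff_deriv]
      refine ⟨fun r => (hder g n hg r).differentiableAt, by simp, ?_⟩
      have : deriv (fun r : ℝ => ∫ u in (0:ℝ)..1, u ^ n * g (u * r)) =
          fun r => ∫ u in (0:ℝ)..1, u ^ (n + 1) * deriv g (u * r) := by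
        ext r; exact (hder g n hg r).deriv
      rw [this]
      exact ih (deriv g) (n + 1) (contDiff_infty_iff_deriv.1 hg).2
  exact contDiff_infty.2 fun N => key N g n hg

/-- Hadamard's lemma for smooth curves. -/
theorem exists_smooth_divided_difference {c : ℝ → E} (hc : SmoothCurveOn c univ) (t : ℝ) :
    ∃ q : ℝ → E, SmoothCurveOn q univ ∧ q 0 = deriv c t ∧ ∀ r, c (t + r) = c t + r • q r := by
  classical
  refine ⟨fun r => if r = 0 then deriv c t else r⁻¹ • (c (t + r) - c t), ?_, by simp, ?_⟩
  · rw [smoothCurveOn_iff_dual isOpen_univ]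
    intro l
    have hg : ContDiff ℝ ∞ fun r => l (c (t + r)) :=
      (contDiffOn_univ.1 (hc.contDiffOn_dual isOpen_univ l)).comp (contDiff_const.add contDiff_id)
    have hg' := (contDiff_infty_iff_deriv.1 hg).2
    -- Scalarwise the divided difference is ∫₀¹ g'(u r) du, also at r = 0.
    refine (contDiff_integral_pow_mul _ hg' 0).contDiffOn.congr fun r _ => ?_
    simp only [pow_zero, one_mul]
    split_ifs with h
    · subst h
      simp only [mul_zero, intervalIntegral.integral_const, sub_zero, one_smul]
      have h1 := (hc.hasDerivAt (mem_univ t)).dual l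
      have h2 := deriv_comp_const_add (fun s => l (c s)) t 0
      rw [add_zero, h1.deriv] at h2
      simpa using h2.symm
    · have h1 := intervalIntegral.integral_comp_mul_right (a := 0) (b := 1)
        (deriv fun r => l (c (t + r))) h
      rw [h1, zero_mul, one_mul, intervalIntegral.integral_deriv_eq_sub
        (fun x _ => hg.differentiable (by simp) x) (hg'.continuous.intervalIntegrable _ _)]
      simp
  · intro r
    by_cases h : r = 0
    · simp [h]
    · simp only [if_neg h, smul_smul, mul_inv_cancel₀ h, one_smul]; abel

/-- The chain rule along smooth curves. -/
theorem ConvSmoothOn.hasDerivAt_comp_curve {f : E → F} {D : Set E} (hD : CInfOpen D)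
    (hf : ConvSmoothOn f D) {I : Set ℝ} (hI : IsOpen I) {c : ℝ → E} (hc : SmoothCurveOn c I)
    (hm : MapsTo c I D) {t : ℝ} (ht : t ∈ I) :
    deriv (fun s => f (c s)) t = _root_.dirDeriv f (c t) (deriv c t) := by
  obtain ⟨h, hh, hhI, hht⟩ := exists_global_reparametrization hI ht
  have hc' : SmoothCurveOn (fun s => c (h s)) univ :=
    hc.comp_real hI isOpen_univ hh.contDiffOn fun s _ => hhI s
  obtain ⟨q, hq, hq0, hqc⟩ := exists_smooth_divided_difference hc' t
  have hht0 : h t = t := hht.self_of_nhds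
  obtain ⟨J, hJh, hJ, htJ⟩ := eventually_nhds_iff.1 (hht.and (hI.mem_nhds ht))
  have hder : deriv (fun s => c (h s)) t = deriv c t :=
    (hc.mono fun s hs => (hJh s hs).2).deriv_congr hJ
      (fun s hs => congrArg c (hJh s hs).1) htJ
  rw [hder] at hq0
  refine (hf I c hI hc hm).deriv_eq_of_dual ht fun l => ?_
  -- Near t the curve is the diagonal of (r, s) ↦ c t + r q(s). At the origin the partial derivative
  -- in s vanishes, the family being constant for r = 0, and the one in r is the directional
  -- derivative along q 0.
  have hφ : ConvSmoothOn (fun p : ℝ × ℝ => c t + p.1 • q p.2) univ :=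
    (convSmoothOn_const _ _).add ((convSmoothOn_fst _).smul
      ((convSmoothOn_curve isOpen_univ hq).comp (convSmoothOn_snd _) (mapsTo_univ _ _)))
  have hW := isOpen_preimage_plane hD isOpen_univ hφ
  have h0 : ((0:ℝ), (0:ℝ)) ∈ univ ∩ (fun p : ℝ × ℝ => c t + p.1 • q p.2) ⁻¹' D :=
    ⟨mem_univ _, by simpa using hm ht⟩
  have hg := hf.comp (hφ.mono inter_subset_left) fun p hp => hp.2
  have hl := ((hg.contDiffOn_dual_plane hW l).differentiableOn (by simp)).differentiableAt
    (hW.mem_nhds h0)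
  have hc1 : HasDerivAt (fun s : ℝ => (s, (0:ℝ))) (1, 0) 0 :=
    (hasDerivAt_id (0:ℝ)).prodMk (hasDerivAt_const (0:ℝ) (0:ℝ))
  have hc2 : HasDerivAt (fun s : ℝ => ((0:ℝ), s)) (0, 1) 0 :=
    (hasDerivAt_const (0:ℝ) (0:ℝ)).prodMk (hasDerivAt_id (0:ℝ))
  have h1 := HasFDerivAt.comp_hasDerivAt_of_eq (0:ℝ) hl.hasFDerivAt hc1 rfl
  have h2 := HasFDerivAt.comp_hasDerivAt_of_eq (0:ℝ) hl.hasFDerivAt hc2 rfl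
  have hc3 : HasDerivAt (fun s : ℝ => (s, s)) (1, 1) 0 :=
    (hasDerivAt_id (0:ℝ)).prodMk (hasDerivAt_id (0:ℝ))
  have h3 := HasFDerivAt.comp_hasDerivAt_of_eq (0:ℝ) hl.hasFDerivAt hc3 rfl
  set L := fderiv ℝ (fun p : ℝ × ℝ => l (f (c t + p.1 • q p.2))) (0, 0)
  have e2 : L (0, 1) = 0 := by
    refine h2.unique ?_
    refine (hasDerivAt_const (0:ℝ) (l (f (c t)))).congr_of_eventuallyEq
      (Eventually.of_forall fun s => ?_)
    simp
  have e1 : L (1, 0) = l (_root_.dirDeriv f (c t) (deriv c t)) := by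
    refine h1.unique ?_
    have := (hf.hasDerivAt_line hD (hm ht) (q 0)).dual l
    rw [hq0] at this
    refine this.congr_of_eventuallyEq (Eventually.of_forall fun s => ?_)
    simp [hq0]
  have e3 : L (1, 1) = l (_root_.dirDeriv f (c t) (deriv c t)) := by
    have : ((1:ℝ), (1:ℝ)) = (1, 0) + (0, 1) := by simp
    rw [this, map_add, e2, add_zero, e1]
  rw [e3] at h3
  have h4 : HasDerivAt (fun s : ℝ => l (f (c (h (t + (s - t)))))) (l (_root_.dirDeriv f (c t)
      (deriv c t))) t := by
    have h5 : HasDerivAt (fun s : ℝ => l (f (c (h (t + s))))) (l (_root_.dirDeriv f (c t)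
        (deriv c t))) (t - t) := by
      rw [sub_self]
      refine h3.congr_of_eventuallyEq (Eventually.of_forall fun s => ?_)
      simp [hqc, hht0]
    have := HasDerivAt.comp (h := fun s : ℝ => s - t) t h5 ((hasDerivAt_id t).sub_const t)
    rwa [mul_one] at this
  refine h4.congr_of_eventuallyEq ?_
  filter_upwards [hht] with s hs
  rw [add_sub_cancel, hs]

/-! ### Rules for directional derivatives -/

/-- Directional derivatives are not linear in the direction for general maps. Here the restriction
to the plane x + s v + t w is differentiable by Boman's theorem, and its differential is linear. -/
theorem dirDeriv_comb {f : E → F} {D : Set E} (hD : CInfOpen D) (hf : ConvSmoothOn f D) {x : E}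
    (hx : x ∈ D) (a b : ℝ) (v w : E) :
    dirDeriv f x (a • v + b • w) = a • dirDeriv f x v + b • dirDeriv f x w := by
  refine dirDeriv_eq_of_dual hD hf hx fun l => ?_
  have hW := isOpen_preimage_plane hD isOpen_univ (convSmoothOn_affine_family x v w)
  have h0 : ((0:ℝ), (0:ℝ)) ∈ univ ∩ (fun p : ℝ × ℝ => x + p.1 • v + p.2 • w) ⁻¹' D :=
    ⟨mem_univ _, by simpa using hx⟩
  have hg := hf.comp ((convSmoothOn_affine_family x v w).mono inter_subset_left) fun p hp => hp.2
  have hl := ((hg.contDiffOn_dual_plane hW l).differentiableOn (by simp)).differentiableAt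
    (hW.mem_nhds h0)
  have hc1 : HasDerivAt (fun s : ℝ => (s, (0:ℝ))) (1, 0) 0 :=
    (hasDerivAt_id (0:ℝ)).prodMk (hasDerivAt_const (0:ℝ) (0:ℝ))
  have hc2 : HasDerivAt (fun s : ℝ => ((0:ℝ), s)) (0, 1) 0 :=
    (hasDerivAt_const (0:ℝ) (0:ℝ)).prodMk (hasDerivAt_id (0:ℝ))
  have h1 := HasFDerivAt.comp_hasDerivAt_of_eq (0:ℝ) hl.hasFDerivAt hc1 rfl
  have h2 := HasFDerivAt.comp_hasDerivAt_of_eq (0:ℝ) hl.hasFDerivAt hc2 rfl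
  have hab : HasDerivAt (fun s : ℝ => (s * a, s * b)) (a, b) 0 := by
    simpa using ((hasDerivAt_id (0:ℝ)).mul_const a).prodMk ((hasDerivAt_id (0:ℝ)).mul_const b)
  have h3 := HasFDerivAt.comp_hasDerivAt_of_eq (0:ℝ) hl.hasFDerivAt hab (by simp)
  set L := fderiv ℝ (fun p : ℝ × ℝ => l (f (x + p.1 • v + p.2 • w))) (0, 0)
  have e1 : L (1, 0) = l (dirDeriv f x v) := by
    refine h1.unique (((hf.hasDerivAt_line hD hx v).dual l).congr_of_eventuallyEq
      (Eventually.of_forall fun s => ?_))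
    simp
  have e2 : L (0, 1) = l (dirDeriv f x w) := by
    refine h2.unique (((hf.hasDerivAt_line hD hx w).dual l).congr_of_eventuallyEq
      (Eventually.of_forall fun s => ?_))
    simp
  have e3 : L (a, b) = l (a • dirDeriv f x v + b • dirDeriv f x w) := by
    have : (a, b) = a • ((1:ℝ), (0:ℝ)) + b • ((0:ℝ), (1:ℝ)) := by simp
    rw [this, map_add, map_smul, map_smul, e1, e2]; simp
  rw [e3] at h3
  refine h3.congr_of_eventuallyEq (Eventually.of_forall fun s => ?_)
  simp [smul_add, smul_smul, add_assoc]

theorem dirDeriv_add {f : E → F} {D : Set E} (hD : CInfOpen D) (hf : ConvSmoothOn f D) {x : E}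
    (hx : x ∈ D) (v w : E) : dirDeriv f x (v + w) = dirDeriv f x v + dirDeriv f x w := by
  simpa using dirDeriv_comb hD hf hx 1 1 v w

theorem dirDeriv_smul {f : E → F} {D : Set E} (hD : CInfOpen D) (hf : ConvSmoothOn f D) {x : E}
    (hx : x ∈ D) (a : ℝ) (v : E) : dirDeriv f x (a • v) = a • dirDeriv f x v := by
  simpa using dirDeriv_comb hD hf hx a 0 v 0

/-- The derivative as a linear map. -/
def dirDerivLin (f : E → F) {D : Set E} (hD : CInfOpen D) (hf : ConvSmoothOn f D) {x : E}
    (hx : x ∈ D) : E →ₗ[ℝ] F where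
  toFun := dirDeriv f x
  map_add' := dirDeriv_add hD hf hx
  map_smul' := dirDeriv_smul hD hf hx

/-- Scalarwise restriction to the plane x + s v + t w reduces this to Schwarz's theorem in two
variables, available by Boman's theorem. -/
theorem dirDeriv_symm {f : E → F} {D : Set E} (hD : CInfOpen D) (hf : ConvSmoothOn f D) {x : E}
    (hx : x ∈ D) (v w : E) :
    dirDeriv (fun y => dirDeriv f y v) x w = dirDeriv (fun y => dirDeriv f y w) x v := by
  have hsm : ∀ v, ConvSmoothOn (fun y => dirDeriv f y v) D := fun v =>
    (hf.dirDeriv hD).comp ((convSmoothOn_id _).prodMk (convSmoothOn_const v _))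
      fun y hy => ⟨hy, mem_univ _⟩
  refine eq_of_forall_dual fun l => ?_
  have hφ := convSmoothOn_affine_family x v w
  have hW := isOpen_preimage_plane hD isOpen_univ hφ
  set W := univ ∩ (fun p : ℝ × ℝ => x + p.1 • v + p.2 • w) ⁻¹' D
  have h0 : ((0:ℝ), (0:ℝ)) ∈ W := ⟨mem_univ _, by simpa using hx⟩
  have hg := hf.comp (hφ.mono inter_subset_left) fun p (hp : p ∈ W) => hp.2
  have hl := hg.contDiffOn_dual_plane hW l
  set g : ℝ × ℝ → ℝ := fun p => l (f (x + p.1 • v + p.2 • w))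
  have hd : ∀ p ∈ W, HasFDerivAt g (fderiv ℝ g p) p := fun p hp =>
    ((hl.differentiableOn (by simp)).differentiableAt (hW.mem_nhds hp)).hasFDerivAt
  have hd1 : ∀ p ∈ W, fderiv ℝ g p (1, 0) = l (dirDeriv f (x + p.1 • v + p.2 • w) v) := by
    intro p hp
    have hc : HasDerivAt (fun s : ℝ => p + s • ((1:ℝ), (0:ℝ))) (1, 0) 0 := by
      simpa using ((hasDerivAt_id (0:ℝ)).smul_const ((1:ℝ), (0:ℝ))).const_add p
    have h1 := HasFDerivAt.comp_hasDerivAt_of_eq (0:ℝ) (hd p hp) hc (by simp)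
    refine h1.unique (((hf.hasDerivAt_line hD hp.2 v).dual l).congr_of_eventuallyEq
      (Eventually.of_forall fun s => ?_))
    simp only [Function.comp_apply, g, Prod.fst_add, Prod.snd_add, Prod.smul_fst, Prod.smul_snd,
      smul_eq_mul, mul_one, mul_zero, add_zero, add_smul]
    congr 2; abel
  have hd2 : ∀ p ∈ W, fderiv ℝ g p (0, 1) = l (dirDeriv f (x + p.1 • v + p.2 • w) w) := by
    intro p hp
    have hc : HasDerivAt (fun s : ℝ => p + s • ((0:ℝ), (1:ℝ))) (0, 1) 0 := by
      simpa using ((hasDerivAt_id (0:ℝ)).smul_const ((0:ℝ), (1:ℝ))).const_add p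
    have h1 := HasFDerivAt.comp_hasDerivAt_of_eq (0:ℝ) (hd p hp) hc (by simp)
    refine h1.unique (((hf.hasDerivAt_line hD hp.2 w).dual l).congr_of_eventuallyEq
      (Eventually.of_forall fun s => ?_))
    simp only [Function.comp_apply, g, Prod.fst_add, Prod.snd_add, Prod.smul_fst, Prod.smul_snd,
      smul_eq_mul, mul_one, mul_zero, add_zero, add_smul]
    congr 2; abel
  have hfd := ((contDiffOn_infty_iff_fderiv_of_isOpen hW).1 hl).2
  have hd0 : HasFDerivAt (fderiv ℝ g) (fderiv ℝ (fderiv ℝ g) (0, 0)) (0, 0) :=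
    ((hfd.differentiableOn (by simp)).differentiableAt (hW.mem_nhds h0)).hasFDerivAt
  have hsymm := (hl.contDiffAt (hW.mem_nhds h0)).isSymmSndFDerivAt
    (by simp only [minSmoothness_of_isRCLikeNormedField]; exact (WithTop.coe_le_coe.2 le_top))
  have k1 : fderiv ℝ (fderiv ℝ g) (0, 0) (0, 1) (1, 0) =
      l (dirDeriv (fun y => dirDeriv f y v) x w) := by
    have hc : HasDerivAt (fun s : ℝ => ((0:ℝ), s)) (0, 1) 0 :=
      (hasDerivAt_const (0:ℝ) (0:ℝ)).prodMk (hasDerivAt_id (0:ℝ))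
    have h1 := (HasFDerivAt.comp_hasDerivAt_of_eq (0:ℝ) hd0 hc rfl).clm_apply
      (hasDerivAt_const (0:ℝ) ((1:ℝ), (0:ℝ)))
    rw [map_zero, add_zero] at h1
    refine h1.unique ((((hsm v).hasDerivAt_line hD hx w).dual l).congr_of_eventuallyEq ?_)
    filter_upwards [(hD.isOpen_line x w).mem_nhds (show (0:ℝ) ∈ _ by simpa using hx)] with s hs
    have := hd1 (0, s) ⟨mem_univ _, by simpa using hs⟩
    simpa using this
  have k2 : fderiv ℝ (fderiv ℝ g) (0, 0) (1, 0) (0, 1) =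
      l (dirDeriv (fun y => dirDeriv f y w) x v) := by
    have hc : HasDerivAt (fun s : ℝ => (s, (0:ℝ))) (1, 0) 0 :=
      (hasDerivAt_id (0:ℝ)).prodMk (hasDerivAt_const (0:ℝ) (0:ℝ))
    have h1 := (HasFDerivAt.comp_hasDerivAt_of_eq (0:ℝ) hd0 hc rfl).clm_apply
      (hasDerivAt_const (0:ℝ) ((0:ℝ), (1:ℝ)))
    rw [map_zero, add_zero] at h1
    refine h1.unique ((((hsm w).hasDerivAt_line hD hx v).dual l).congr_of_eventuallyEq ?_)
    filter_upwards [(hD.isOpen_line x v).mem_nhds (show (0:ℝ) ∈ _ by simpa using hx)] with s hs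
    have := hd2 (s, 0) ⟨mem_univ _, by simpa using hs⟩
    simpa using this
  rw [← k1, ← k2]
  exact hsymm _ _

theorem ConvSmoothOn.dirDeriv_const {f : E → F} {D : Set E} (hD : CInfOpen D)
    (hf : ConvSmoothOn f D) (v : E) : ConvSmoothOn (fun y => _root_.dirDeriv f y v) D :=
  (hf.dirDeriv hD).comp ((convSmoothOn_id _).prodMk (convSmoothOn_const v _))
    fun _ hy => ⟨hy, mem_univ _⟩

theorem ConvSmoothOn.dirDeriv_apply {f : E → F} {D : Set E} (hD : CInfOpen D)
    (hf : ConvSmoothOn f D) {v : E → E} (hv : ConvSmoothOn v D) :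
    ConvSmoothOn (fun y => _root_.dirDeriv f y (v y)) D :=
  (hf.dirDeriv hD).comp ((convSmoothOn_id _).prodMk hv) fun _ hy => ⟨hy, mem_univ _⟩

theorem dirDeriv_comp {f : E → F} {g : F → G} {D : Set E} {D' : Set F} (hD : CInfOpen D)
    (hD' : CInfOpen D') (hg : ConvSmoothOn g D') (hf : ConvSmoothOn f D) (hm : MapsTo f D D')
    {x : E} (hx : x ∈ D) (v : E) :
    dirDeriv (fun y => g (f y)) x v = dirDeriv g (f x) (dirDeriv f x v) := by
  have := hg.hasDerivAt_comp_curve hD' (hD.isOpen_line x v) (hf.smoothCurveOn_line hD x v)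
    (fun t ht => hm ht) (t := 0) (by simpa using hx)
  simpa [dirDeriv] using this

theorem dirDeriv_prodMk {f : E → F} {g : E → G} {D : Set E} (hD : CInfOpen D)
    (hf : ConvSmoothOn f D) (hg : ConvSmoothOn g D) {x : E} (hx : x ∈ D) (v : E) :
    dirDeriv (fun y => (f y, g y)) x v = (dirDeriv f x v, dirDeriv g x v) :=
  deriv_prodMk (hD.isOpen_line x v) (hf.smoothCurveOn_line hD x v) (hg.smoothCurveOn_line hD x v)
    (by simpa using hx)

theorem dirDeriv_fun_add {f g : E → F} {D : Set E} (hD : CInfOpen D)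
    (hf : ConvSmoothOn f D) (hg : ConvSmoothOn g D) {x : E} (hx : x ∈ D) (v : E) :
    dirDeriv (fun y => f y + g y) x v = dirDeriv f x v + dirDeriv g x v := by
  refine dirDeriv_eq_of_dual hD (hf.add hg) hx fun l => ?_
  have := ((hf.hasDerivAt_line hD hx v).dual l).add ((hg.hasDerivAt_line hD hx v).dual l)
  simp only [map_add]
  exact this

theorem dirDeriv_fun_neg {f : E → F} {D : Set E} (hD : CInfOpen D)
    (hf : ConvSmoothOn f D) {x : E} (hx : x ∈ D) (v : E) :
    dirDeriv (fun y => -f y) x v = -dirDeriv f x v := by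
  refine dirDeriv_eq_of_dual hD hf.neg hx fun l => ?_
  have := ((hf.hasDerivAt_line hD hx v).dual l).neg
  simp only [map_neg]
  exact this

theorem dirDeriv_fun_sub {f g : E → F} {D : Set E} (hD : CInfOpen D)
    (hf : ConvSmoothOn f D) (hg : ConvSmoothOn g D) {x : E} (hx : x ∈ D) (v : E) :
    dirDeriv (fun y => f y - g y) x v = dirDeriv f x v - dirDeriv g x v := by
  simp only [sub_eq_add_neg]
  rw [dirDeriv_fun_add hD hf hg.neg hx, dirDeriv_fun_neg hD hg hx]

theorem dirDeriv_const (y : F) (x v : E) : dirDeriv (fun _ : E => y) x v = 0 :=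
  dirDeriv_eq_of_dual cInfOpen_univ (convSmoothOn_const y univ) (mem_univ x) fun l => by
    simpa using hasDerivAt_const (0:ℝ) (l y)

theorem dirDeriv_id (x v : E) : dirDeriv (fun y : E => y) x v = v :=
  dirDeriv_eq_of_dual cInfOpen_univ (convSmoothOn_id univ) (mem_univ x) fun l => by
    simpa using ((hasDerivAt_id (0:ℝ)).mul_const (l v)).const_add (l x)

/-- Product rule for maps that are linear in the second variable. -/
theorem dirDeriv_apply_linear {P : E → F →ₗ[ℝ] G} {D : Set E} (hD : CInfOpen D)
    (hP : ConvSmoothOn (fun q : E × F => P q.1 q.2) (D ×ˢ univ)) {i : H → E} {b : H → F}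
    {D' : Set H} (hD' : CInfOpen D') (hi : ConvSmoothOn i D') (hb : ConvSmoothOn b D')
    (hm : MapsTo i D' D) {x : H} (hx : x ∈ D') (v : H) :
    dirDeriv (fun y => P (i y) (b y)) x v =
      dirDeriv (fun z => P z (b x)) (i x) (dirDeriv i x v) + P (i x) (dirDeriv b x v) := by
  have hDu : CInfOpen (D ×ˢ (univ : Set F)) := hD.prod_univ
  have hmem : (i x, b x) ∈ D ×ˢ (univ : Set F) := ⟨hm hx, mem_univ _⟩
  have h1 := dirDeriv_comp hD' hDu hP (hi.prodMk hb) (fun y hy => ⟨hm hy, mem_univ _⟩) hx v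
  simp only [] at h1
  rw [h1, dirDeriv_prodMk hD' hi hb hx]
  have h2 : (dirDeriv i x v, dirDeriv b x v) = (dirDeriv i x v, 0) + (0, dirDeriv b x v) := by simp
  rw [h2, dirDeriv_add hDu hP hmem]
  congr 1
  · simp [dirDeriv]
  · refine dirDeriv_eq_of_dual hDu hP hmem fun l => ?_
    have := ((hasDerivAt_id (0:ℝ)).mul_const (l (P (i x) (dirDeriv b x v)))).const_add
      (l (P (i x) (b x)))
    simpa using this

end ConvenientRules
end

noncomputable section
open scoped ContDiff

/-! ## Smooth families of linear maps -/

section LinearFamilies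

variable {E F G H : Type*}
  [AddCommGroup E] [Module ℝ E] [TopologicalSpace E] [ConvenientSpace E]
  [AddCommGroup F] [Module ℝ F] [TopologicalSpace F] [ConvenientSpace F]
  [AddCommGroup G] [Module ℝ G] [TopologicalSpace G] [ConvenientSpace G]
  [AddCommGroup H] [Module ℝ H] [TopologicalSpace H] [ConvenientSpace H]

theorem isBoundedLinear_of_subsingleton [Subsingleton H] (T : G →ₗ[ℝ] H) : IsBoundedLinear T :=
  fun _ _ => Bornology.IsVonNBounded.of_subsingleton

/-- A pointwise smooth family of bounded linear maps is smooth. -/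
theorem convSmoothOn_family {Q : F → G →ₗ[ℝ] H} {D : Set F}
    (hb : ∀ y ∈ D, IsBoundedLinear (Q y)) (hs : ∀ g, ConvSmoothOn (fun y => Q y g) D) :
    ConvSmoothOn (fun q : F × G => Q q.1 q.2) (D ×ˢ univ) := by
  intro I c hI hc hm
  exact SmoothCurveOn.apply_curve hI (T := fun t => Q (c t).1) (η := fun t => (c t).2)
    (fun t ht => hb _ (hm ht).1)
    (fun g => hs g I _ hI (hc.fst hI) fun t ht => (hm ht).1) (hc.snd hI)

theorem SmoothCurveOn.continuousAt_dual {c : ℝ → E} {I : Set ℝ} (hI : IsOpen I)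
    (hc : SmoothCurveOn c I) {t : ℝ} (ht : t ∈ I) (l : E →L[ℝ] ℝ) :
    ContinuousAt (fun s => l (c s)) t :=
  ((hc.contDiffOn_dual hI l).contDiffAt (hI.mem_nhds ht)).continuousAt

theorem exists_dual_eq_one {v : F} (hv : v ≠ 0) : ∃ l : F →L[ℝ] ℝ, l v = 1 := by
  by_contra! h
  refine hv (eq_of_forall_dual fun l => ?_)
  by_contra hl
  rw [map_zero] at hl
  exact h ((l v)⁻¹ • l) (by simp [hl])

/-- A family of linear maps that preserves smoothness of sections is smooth. -/
theorem convSmoothOn_of_sections {Q : F → G →ₗ[ℝ] H} {D : Set F} (hD : CInfOpen D)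
    (hs : ∀ a : F → G, ConvSmoothOn a D → ConvSmoothOn (fun y => Q y (a y)) D)
    (hF : Subsingleton F → Subsingleton H) :
    ConvSmoothOn (fun q : F × G => Q q.1 q.2) (D ×ˢ univ) := by
  refine convSmoothOn_family (fun y₀ hy₀ => ?_) fun g => hs _ (convSmoothOn_const g D)
  -- Over a trivial base there is no line along which to vary a section; `hF` then makes the target
  -- trivial, so that boundedness is automatic.
  rcases subsingleton_or_nontrivial F with hsub | hnt
  · have := hF hsub
    exact isBoundedLinear_of_subsingleton _
  · obtain ⟨v, hv⟩ := exists_ne (0 : F)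
    obtain ⟨l, hl⟩ := exists_dual_eq_one hv
    refine isBoundedLinear_iff_dual.2 fun k => ?_
    have := isBoundedLinear_of_forall_curve (T := fun t : ℝ => k.toLinearMap ∘ₗ Q (y₀ + t • v))
      fun η hη => by
        -- Since l v = 1, this section takes the value η(t) at y₀ + t v. So any smooth curve is
        -- realised along the line, and continuity at t = 0 forces the map at y₀ to be bounded.
        have ha : ConvSmoothOn (fun y => η (l (y - y₀))) D :=
          (convSmoothOn_curve isOpen_univ hη).comp (((l.convSmoothOn univ).comp
            ((convSmoothOn_id D).sub (convSmoothOn_const y₀ D)) (mapsTo_univ _ _)))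
            (mapsTo_univ _ _)
        have h1 := ((hs _ ha).smoothCurveOn_line hD y₀ v).continuousAt_dual (hD.isOpen_line y₀ v)
          (show (0:ℝ) ∈ _ by simpa using hy₀) k
        simpa [hl] using h1
    simpa using this

/-! ### The pairing -/

variable {Eb Fb : Type*} [AddCommGroup Eb] [Module ℝ Eb] [TopologicalSpace Eb] [ConvenientSpace Eb]
  [AddCommGroup Fb] [Module ℝ Fb] [TopologicalSpace Fb] [ConvenientSpace Fb]

theorem FlatModel.ext_pair (β : FlatModel E Eb) {ξ η : Eb}
    (h : ∀ v, β.pair ξ v = β.pair η v) : ξ = η :=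
  sub_eq_zero.1 (β.injective _ fun v => by rw [map_sub, LinearMap.sub_apply, h, sub_self])

theorem FlatModel.isBoundedLinear_left (β : FlatModel E Eb) (v : E) :
    IsBoundedLinear (β.pair.flip v) := by
  intro K hK
  refine (β.bounded K {v} hK (Bornology.isVonNBounded_singleton v)).subset ?_
  rintro _ ⟨ξ, hξ, rfl⟩
  exact ⟨ξ, hξ, v, rfl, rfl⟩

theorem FlatModel.isBoundedLinear_right (β : FlatModel E Eb) (ξ : Eb) :
    IsBoundedLinear (β.pair ξ) := by
  intro K hK
  refine (β.bounded {ξ} K (Bornology.isVonNBounded_singleton ξ) hK).subset ?_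
  rintro _ ⟨v, hv, rfl⟩
  exact ⟨ξ, rfl, v, hv, rfl⟩

/-- The pairing is bounded in each variable separately, and `convSmoothOn_family` upgrades this to
joint smoothness; no joint continuity is needed. -/
theorem FlatModel.convSmoothOn_pair (β : FlatModel E Eb) :
    ConvSmoothOn (fun q : Eb × E => β.pair q.1 q.2) univ := by
  have h0 : ∀ v, ConvSmoothOn (fun ξ => β.pair ξ v) univ := by
    intro v I c hI hc _
    exact SmoothCurveOn.apply_curve hI (T := fun _ => β.pair.flip v)
      (fun t _ => β.isBoundedLinear_left v) (fun g => smoothCurveOn_const _ hI) hc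
  have := convSmoothOn_family (Q := fun ξ => β.pair ξ) (fun y _ => β.isBoundedLinear_right y) h0
  simpa using this

theorem ConvSmoothOn.pair (β : FlatModel E Eb) {a : F → Eb} {X : F → E} {D : Set F}
    (ha : ConvSmoothOn a D) (hX : ConvSmoothOn X D) :
    ConvSmoothOn (fun y => β.pair (a y) (X y)) D :=
  β.convSmoothOn_pair.comp (ha.prodMk hX) (mapsTo_univ _ _)

theorem dirDeriv_pair (β : FlatModel E Eb) {a : F → Eb} {X : F → E} {D : Set F} (hD : CInfOpen D)
    (ha : ConvSmoothOn a D) (hX : ConvSmoothOn X D) {y : F} (hy : y ∈ D) (v : F) :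
    dirDeriv (fun z => β.pair (a z) (X z)) y v =
      β.pair (dirDeriv a y v) (X y) + β.pair (a y) (dirDeriv X y v) := by
  have h := dirDeriv_apply_linear (P := fun ξ => β.pair ξ) (D := univ) cInfOpen_univ
    (by simpa using β.convSmoothOn_pair) hD ha hX (mapsTo_univ _ _) hy v
  rw [h]
  congr 1
  have hs : ConvSmoothOn (fun ξ => β.pair ξ (X y)) univ :=
    (convSmoothOn_id _).pair β (convSmoothOn_const _ _)
  refine dirDeriv_eq_of_dual cInfOpen_univ hs (mem_univ _) fun l => ?_
  have := ((hasDerivAt_id (0:ℝ)).mul_const (l (β.pair (dirDeriv a y v) (X y)))).const_add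
    (l (β.pair (a y) (X y)))
  refine (this.congr_of_eventuallyEq (Eventually.of_forall fun s => ?_)).congr_deriv (by simp)
  simp only [map_add, LinearMap.add_apply, map_smul, LinearMap.smul_apply]
  rfl

theorem ConvSmoothOn.apply_linear {P : E → F →ₗ[ℝ] G} {D : Set E}
    (hP : ConvSmoothOn (fun q : E × F => P q.1 q.2) (D ×ˢ univ)) {i : H → E} {b : H → F}
    {D' : Set H} (hi : ConvSmoothOn i D') (hb : ConvSmoothOn b D') (hm : MapsTo i D' D) :
    ConvSmoothOn (fun y => P (i y) (b y)) D' :=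
  hP.comp (hi.prodMk hb) fun _ hy => ⟨hm hy, mem_univ _⟩

theorem dirDeriv_pair_const (β : FlatModel E Eb) (ξ : Eb) (x v : E) :
    dirDeriv (fun y => β.pair ξ y) x v = β.pair ξ v := by
  rw [dirDeriv_pair β cInfOpen_univ (convSmoothOn_const ξ _) (convSmoothOn_id _) (mem_univ x),
    dirDeriv_const, dirDeriv_id]
  simp

theorem dirDeriv_family_const {Q : E → F →ₗ[ℝ] G} {D : Set E} (hD : CInfOpen D)
    (hQ : ConvSmoothOn (fun q : E × F => Q q.1 q.2) (D ×ˢ univ)) {b : E → F}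
    (hb : ConvSmoothOn b D) {x : E} (hx : x ∈ D) (v : E) :
    dirDeriv (fun y => Q y (b y)) x v =
      dirDeriv (fun y => Q y (b x)) x v + Q x (dirDeriv b x v) := by
  have := dirDeriv_apply_linear hD hQ hD (convSmoothOn_id D) hb (mapsTo_id D) hx v
  rwa [dirDeriv_id] at this

/-- The derivative of a field of covectors in `E^♭` that is a differential is symmetric. -/
theorem pair_dirDeriv_symm (β : FlatModel E Eb) {φ : E → ℝ} {a : E → Eb} {D : Set E}
    (hD : CInfOpen D) (hφ : ConvSmoothOn φ D) (ha : ConvSmoothOn a D)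
    (h : ∀ y ∈ D, ∀ v, β.pair (a y) v = dirDeriv φ y v) {y : E} (hy : y ∈ D) (v w : E) :
    β.pair (dirDeriv a y v) w = β.pair (dirDeriv a y w) v := by
  have key : ∀ v w, β.pair (dirDeriv a y v) w = dirDeriv (fun z => dirDeriv φ z w) y v := by
    intro v w
    have h1 := dirDeriv_pair β hD ha (convSmoothOn_const w D) hy v
    rw [dirDeriv_const, map_zero, add_zero] at h1
    rw [← h1]
    exact dirDeriv_congr hD (hφ.dirDeriv_const hD w) (fun z hz => h z hz w) hy v
  rw [key, key, dirDeriv_symm hD hφ hy]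

/-- The differential of a bracket `-⟨a, p(b)⟩` -/
theorem dirDeriv_neg_pair_apply (β : FlatModel E Eb) {p : E → Eb →ₗ[ℝ] E} {D : Set E}
    (hD : CInfOpen D) (hp : ConvSmoothOn (fun q : E × Eb => p q.1 q.2) (D ×ˢ univ))
    (hanti : ∀ y ∈ D, ∀ ξ η, β.pair ξ (p y η) = -β.pair η (p y ξ)) {a b : E → Eb}
    (ha : ConvSmoothOn a D) (hb : ConvSmoothOn b D) {y : E} (hy : y ∈ D) (v : E) :
    dirDeriv (fun z => -β.pair (a z) (p z (b z))) y v =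
      -β.pair (dirDeriv a y v) (p y (b y)) - β.pair (a y) (dirDeriv (fun z => p z (b y)) y v)
        + β.pair (dirDeriv b y v) (p y (a y)) := by
  have hpb : ConvSmoothOn (fun z => p z (b z)) D := hp.apply_linear (convSmoothOn_id D) hb
    (mapsTo_id D)
  rw [dirDeriv_fun_neg hD (ha.pair β hpb) hy, dirDeriv_pair β hD ha hpb hy,
    dirDeriv_family_const hD hp hb hy, map_add, hanti y hy (a y)]
  ring

/-! ### The derivative of an anchor whose bracket preserves admissible functions -/

/-- Brackets of the linear functions ⟨ξ, y⟩ and ⟨η, y⟩ produce B(ξ, η), smooth in the point for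
fixed ξ and η. Joint smoothness requires boundedness in ξ and in η. This is drawn from brackets with
nonlinear functions, whose differentials follow an arbitrary smooth curve in E^♭ up to a controlled
term. -/
theorem exists_anchor_derivative (β : FlatModel E Eb) {p : E → Eb →ₗ[ℝ] E} {D : Set E}
    (hD : CInfOpen D) (hp : ConvSmoothOn (fun q : E × Eb => p q.1 q.2) (D ×ˢ univ))
    (hanti : ∀ y ∈ D, ∀ ξ η, β.pair ξ (p y η) = -β.pair η (p y ξ))
    (hbr : ∀ (φ ψ : E → ℝ) (a b : E → Eb), ConvSmoothOn φ D → ConvSmoothOn ψ D →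
      ConvSmoothOn a D → ConvSmoothOn b D → (∀ y ∈ D, ∀ v, β.pair (a y) v = dirDeriv φ y v) →
      (∀ y ∈ D, ∀ v, β.pair (b y) v = dirDeriv ψ y v) → ∃ c : E → Eb, ConvSmoothOn c D ∧
        ∀ y ∈ D, ∀ v, β.pair (c y) v = dirDeriv (fun z => -β.pair (a z) (p z (b z))) y v) :
    ∃ B : E → Eb →ₗ[ℝ] Eb →ₗ[ℝ] Eb,
      ConvSmoothOn (fun q : E × Eb × Eb => B q.1 q.2.1 q.2.2) (D ×ˢ univ) ∧
      ∀ y ∈ D, ∀ ξ η v, β.pair (B y ξ η) v = β.pair ξ (dirDeriv (fun z => p z η) y v) := by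
  classical
  have hpη : ∀ η, ConvSmoothOn (fun z => p z η) D := fun η =>
    hp.apply_linear (convSmoothOn_id D) (convSmoothOn_const η D) (mapsTo_id D)
  have hlin : ∀ ξ : Eb, ConvSmoothOn (fun y => β.pair ξ y) D := fun ξ =>
    (convSmoothOn_const ξ D).pair β (convSmoothOn_id D)
  have h0 : ∀ ξ η, ∃ c : E → Eb, ConvSmoothOn c D ∧
      ∀ y ∈ D, ∀ v, β.pair (c y) v = β.pair ξ (dirDeriv (fun z => p z η) y v) := by
    intro ξ η
    obtain ⟨c, hc, hcv⟩ := hbr _ _ _ _ (hlin ξ) (hlin η) (convSmoothOn_const ξ D)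
      (convSmoothOn_const η D) (fun y _ v => (dirDeriv_pair_const β ξ y v).symm)
      (fun y _ v => (dirDeriv_pair_const β η y v).symm)
    refine ⟨fun y => -c y, hc.neg, fun y hy v => ?_⟩
    rw [map_neg, LinearMap.neg_apply, hcv y hy v, dirDeriv_neg_pair_apply β hD hp hanti
      (convSmoothOn_const ξ D) (convSmoothOn_const η D) hy, dirDeriv_const, dirDeriv_const]
    simp
  choose B₀ hB₀s hB₀ using h0
  have hdadd : ∀ y ∈ D, ∀ η η' v, dirDeriv (fun z => p z (η + η')) y v =
      dirDeriv (fun z => p z η) y v + dirDeriv (fun z => p z η') y v := by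
    intro y hy η η' v
    rw [← dirDeriv_fun_add hD (hpη η) (hpη η') hy]
    simp only [map_add]
  have hdsmul : ∀ y ∈ D, ∀ (r : ℝ) η v, dirDeriv (fun z => p z (r • η)) y v =
      r • dirDeriv (fun z => p z η) y v := by
    intro y hy r η v
    have h1 := dirDeriv_eq_of_dual hD (hpη (r • η)) hy (v := v)
      (w := r • dirDeriv (fun z => p z η) y v) fun l => by
        have := (((hpη η).hasDerivAt_line hD hy v).dual l).const_mul r
        simpa using this
    exact h1
  let B : E → Eb →ₗ[ℝ] Eb →ₗ[ℝ] Eb := fun y => if hy : y ∈ D then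
    LinearMap.mk₂ ℝ (fun ξ η => B₀ ξ η y)
      (fun ξ ξ' η => β.ext_pair fun v => by simp [hB₀ _ _ y hy])
      (fun r ξ η => β.ext_pair fun v => by simp [hB₀ _ _ y hy])
      (fun ξ η η' => β.ext_pair fun v => by
        rw [hB₀ _ _ y hy, hdadd y hy]; simp [hB₀ _ _ y hy])
      (fun r ξ η => β.ext_pair fun v => by
        rw [hB₀ _ _ y hy, hdsmul y hy]; simp [hB₀ _ _ y hy]) else 0
  have hBe : ∀ y ∈ D, ∀ ξ η, B y ξ η = B₀ ξ η y := fun y hy ξ η => by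
    simp only [B, dif_pos hy, LinearMap.mk₂_apply]
  have hB : ∀ y ∈ D, ∀ ξ η v, β.pair (B y ξ η) v = β.pair ξ (dirDeriv (fun z => p z η) y v) :=
    fun y hy ξ η v => by rw [hBe y hy, hB₀ ξ η y hy]
  have hBs : ∀ ξ η, ConvSmoothOn (fun y => B y ξ η) D := fun ξ η =>
    (hB₀s ξ η).congr fun y hy => hBe y hy ξ η
  have hBanti : ∀ y ∈ D, ∀ ξ η, B y ξ η = -B y η ξ := by
    intro y hy ξ η
    refine β.ext_pair fun v => ?_
    rw [map_neg, LinearMap.neg_apply, hB y hy, hB y hy]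
    have h1 := dirDeriv_pair β hD (convSmoothOn_const ξ D) (hpη η) hy v
    have h2 := dirDeriv_pair β hD (convSmoothOn_const η D) (hpη ξ) hy v
    rw [dirDeriv_const, map_zero, LinearMap.zero_apply, zero_add] at h1 h2
    rw [← h1, ← h2, ← dirDeriv_fun_neg hD ((convSmoothOn_const η D).pair β (hpη ξ)) hy]
    exact dirDeriv_congr hD ((convSmoothOn_const η D).pair β (hpη ξ)).neg
      (fun z hz => hanti z hz ξ η) hy v
  have hbdd : ∀ y ∈ D, ∀ η, IsBoundedLinear ((B y).flip η) := by
    intro y₀ hy₀ η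
    -- A normalised pair provides the coordinate ⟨ξ₀, y - y₀⟩, equal to t at y₀ + t v; without one
    -- the pairing vanishes and E^♭ is trivial.
    by_cases hne : ∃ (ξ₀ : Eb) (v : E), β.pair ξ₀ v = 1
    · obtain ⟨ξ₀, v, hv⟩ := hne
      refine isBoundedLinear_iff_dual.2 fun k => ?_
      have := isBoundedLinear_of_forall_curve
        (T := fun t : ℝ => k.toLinearMap ∘ₗ (B (y₀ + t • v)).flip η) fun Ξ hΞ => by
          have hΞ' := hΞ.deriv_curve
          have hs₀ : ConvSmoothOn (fun y => y - y₀) D :=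
            (convSmoothOn_id D).sub (convSmoothOn_const y₀ D)
          have hl : ConvSmoothOn (fun y => β.pair ξ₀ (y - y₀)) D :=
            (convSmoothOn_const ξ₀ D).pair β hs₀
          have hΞl : ConvSmoothOn (fun y => Ξ (β.pair ξ₀ (y - y₀))) D :=
            (convSmoothOn_curve isOpen_univ hΞ).comp hl (mapsTo_univ _ _)
          have hΞl' : ConvSmoothOn (fun y => deriv Ξ (β.pair ξ₀ (y - y₀))) D :=
            (convSmoothOn_curve isOpen_univ hΞ').comp hl (mapsTo_univ _ _)
          -- The differential of this test function is Ξ(⟨ξ₀, y - y₀⟩) plus a scalar multiple of the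
          -- fixed covector ξ₀, so it takes its values in E^♭.
          have hφ : ConvSmoothOn (fun y => β.pair (Ξ (β.pair ξ₀ (y - y₀))) (y - y₀)) D :=
            hΞl.pair β hs₀
          have ha : ConvSmoothOn (fun y => Ξ (β.pair ξ₀ (y - y₀)) +
              (β.pair (deriv Ξ (β.pair ξ₀ (y - y₀))) (y - y₀)) • ξ₀) D :=
            hΞl.add ((hΞl'.pair β hs₀).smul (convSmoothOn_const ξ₀ D))
          have hsub : ∀ y ∈ D, ∀ w, dirDeriv (fun y => y - y₀) y w = w := fun y hy w => by
            rw [dirDeriv_fun_sub hD (convSmoothOn_id D) (convSmoothOn_const y₀ D) hy,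
              dirDeriv_id, dirDeriv_const, sub_zero]
          have hdl : ∀ y ∈ D, ∀ w, dirDeriv (fun y => β.pair ξ₀ (y - y₀)) y w = β.pair ξ₀ w := by
            intro y hy w
            rw [dirDeriv_pair β hD (convSmoothOn_const ξ₀ D) hs₀ hy, hsub y hy, dirDeriv_const]
            simp
          have hdΞ : ∀ y ∈ D, ∀ w, dirDeriv (fun y => Ξ (β.pair ξ₀ (y - y₀))) y w =
              β.pair ξ₀ w • deriv Ξ (β.pair ξ₀ (y - y₀)) := by
            intro y hy w
            rw [dirDeriv_comp hD cInfOpen_univ (convSmoothOn_curve isOpen_univ hΞ) hl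
              (mapsTo_univ _ _) hy, hdl y hy]
            have h1 : ∀ s r : ℝ, dirDeriv Ξ s r = r • deriv Ξ s := by
              intro s r
              have h2 := dirDeriv_smul cInfOpen_univ (convSmoothOn_curve isOpen_univ hΞ)
                (mem_univ s) r 1
              rw [smul_eq_mul, mul_one] at h2
              rw [h2]
              congr 1
              refine dirDeriv_eq_of_dual cInfOpen_univ (convSmoothOn_curve isOpen_univ hΞ)
                (mem_univ s) fun l => ?_
              have h3 := (hΞ.hasDerivAt (mem_univ s)).dual l
              have h4 : HasDerivAt (fun t : ℝ => l (Ξ t)) (l (deriv Ξ s)) (s + 0) := by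
                rwa [add_zero]
              have h5 := HasDerivAt.comp_const_add s 0 h4
              simpa using h5
            exact h1 _ _
          have hda : ∀ y ∈ D, ∀ w, β.pair (Ξ (β.pair ξ₀ (y - y₀)) +
              (β.pair (deriv Ξ (β.pair ξ₀ (y - y₀))) (y - y₀)) • ξ₀) w =
              dirDeriv (fun y => β.pair (Ξ (β.pair ξ₀ (y - y₀))) (y - y₀)) y w := by
            intro y hy w
            rw [dirDeriv_pair β hD hΞl hs₀ hy, hsub y hy, hdΞ y hy]
            simp only [map_add, map_smul, LinearMap.add_apply, LinearMap.smul_apply, smul_eq_mul]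
            ring
          obtain ⟨c, hc, hcv⟩ := hbr _ _ _ _ hφ (hlin η) ha (convSmoothOn_const η D) hda
            (fun y _ v => (dirDeriv_pair_const β η y v).symm)
          -- The differential c of the bracket is solved for B(Ξ, η): by symmetry of da the term
          -- ⟨da(·), p η⟩ is the covector da(p η), and the multiple of ξ₀ contributes a smooth
          -- multiple of B(ξ₀, η).
          have hres : ConvSmoothOn (fun y => B y (Ξ (β.pair ξ₀ (y - y₀))) η) D := by
            refine ((hc.neg.sub (ha.dirDeriv_apply hD (hpη η))).sub
              ((hΞl'.pair β hs₀).smul (hBs ξ₀ η))).congr fun y hy => ?_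
            rw [eq_sub_iff_add_eq]
            refine β.ext_pair fun w => ?_
            have h1 := hcv y hy w
            rw [dirDeriv_neg_pair_apply β hD hp hanti ha (convSmoothOn_const η D) hy,
              dirDeriv_const, map_zero, LinearMap.zero_apply, add_zero,
              pair_dirDeriv_symm β hD hφ ha hda hy, ← hB y hy] at h1
            simp only [map_sub, map_neg, LinearMap.sub_apply, LinearMap.neg_apply, h1, map_add,
              map_smul, LinearMap.add_apply, LinearMap.smul_apply, smul_eq_mul]
            ring
          have h1 := (hres.smoothCurveOn_line hD y₀ v).continuousAt_dual (hD.isOpen_line y₀ v)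
            (show (0:ℝ) ∈ _ by simpa using hy₀) k
          simpa [hv] using h1
      simpa using this
    · have : Subsingleton Eb := by
        refine subsingleton_of_forall_eq 0 fun ξ => β.injective ξ fun v => ?_
        by_contra h
        exact hne ⟨(β.pair ξ v)⁻¹ • ξ, v, by simp [h]⟩
      exact isBoundedLinear_of_subsingleton _
  refine ⟨B, ?_, hB⟩
  have h1 : ∀ η, ConvSmoothOn (fun q : E × Eb => B q.1 q.2 η) (D ×ˢ univ) := fun η =>
    convSmoothOn_family (Q := fun y => (B y).flip η) (fun y hy => hbdd y hy η) fun ξ => hBs ξ η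
  intro I c hI hc hm
  refine SmoothCurveOn.apply_curve hI (T := fun t => B (c t).1 (c t).2.1)
    (η := fun t => (c t).2.2) (fun t ht => ?_) (fun η => ?_) ((hc.snd hI).snd hI)
  -- Antisymmetry transfers boundedness from the first variable of B to the second.
  · have : B (c t).1 (c t).2.1 = -(B (c t).1).flip (c t).2.1 := by
      ext ξ
      exact hBanti _ (hm ht).1 _ _
    rw [this]
    refine isBoundedLinear_iff_dual.2 fun k => ?_
    have h2 := isBoundedLinear_iff_dual.1 (hbdd _ (hm ht).1 (c t).2.1) k
    rw [isBoundedLinear_real_iff] at h2 ⊢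
    intro K hK
    obtain ⟨C, hC⟩ := h2 K hK
    exact ⟨C, fun x hx => by simpa using hC x hx⟩
  · exact h1 η I (fun t => ((c t).1, (c t).2.1)) hI
      (smoothCurveOn_prodMk hI (hc.fst hI) ((hc.snd hI).fst hI)) fun t ht => ⟨(hm ht).1, mem_univ _⟩

end LinearFamilies
end

noncomputable section
open scoped ContDiff

/-! ## Charts of convenient manifolds -/

section Charts

variable {E Eb G : Type*}
  [AddCommGroup E] [Module ℝ E] [TopologicalSpace E] [ConvenientSpace E]
  [AddCommGroup Eb] [Module ℝ Eb] [TopologicalSpace Eb] [ConvenientSpace Eb]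
  [AddCommGroup G] [Module ℝ G] [TopologicalSpace G] [ConvenientSpace G]
  {M : Type*} [TopologicalSpace M]

section LocalHomeomorph

variable {e : OpenPartialHomeomorph M (CInf E)} {U V : Set M} {x : M} {y : E}

theorem coord_pointAt (hy : y ∈ dom e U) : coord e (pointAt e y) = y := e.right_inv hy.1

theorem pointAt_coord (hx : x ∈ e.source) : pointAt e (coord e x) = x := e.left_inv hx

theorem pointAt_mem_source (hy : y ∈ dom e U) : pointAt e y ∈ e.source := e.map_target hy.1

theorem coord_mem_dom (hx : x ∈ e.source) (hU : x ∈ U) : coord e x ∈ dom e U :=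
  ⟨e.map_source hx, by rw [pointAt_coord hx]; exact hU⟩

theorem dom_mono (h : U ⊆ V) : dom e U ⊆ dom e V := fun _ hy => ⟨hy.1, h hy.2⟩

theorem cInfOpen_dom (hU : IsOpen U) : CInfOpen (dom e U) := e.symm.isOpen_inter_preimage hU

/-- The part of `M` with coordinates in `W`. -/
def chartPart (e : OpenPartialHomeomorph M (CInf E)) (W : Set E) : Set M :=
  {x | x ∈ e.source ∧ coord e x ∈ W}

theorem isOpen_chartPart {W : Set E} (hW : CInfOpen W) : IsOpen (chartPart e W) :=
  e.isOpen_inter_preimage hW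

theorem chartPart_subset_source {W : Set E} : chartPart e W ⊆ e.source := fun _ hx => hx.1

theorem dom_chartPart {W : Set E} (hW : W ⊆ dom e U) : dom e (chartPart e W) = W := by
  ext y
  constructor
  · intro hy
    have := hy.2.2
    rwa [coord_pointAt hy] at this
  · intro hy
    exact ⟨(hW hy).1, pointAt_mem_source (hW hy), by rw [coord_pointAt (hW hy)]; exact hy⟩

end LocalHomeomorph

variable [ChartedSpace (CInf E) M] [ConvManifold E M]
  {e e' : OpenPartialHomeomorph M (CInf E)} {U V : Set M} {x : M}

theorem convSmoothOn_change (he : e ∈ atlas (CInf E) M) (he' : e' ∈ atlas (CInf E) M) :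
    ConvSmoothOn (fun y : E => coord e' (pointAt e y)) (dom e e'.source) :=
  ConvManifold.smooth_change e he e' he'

theorem mapsTo_change (h : U ⊆ e'.source) :
    MapsTo (fun y : E => coord e' (pointAt e y)) (dom e U) (dom e' U) :=
  fun _ hy => coord_mem_dom (h hy.2) hy.2

theorem ConvSmoothOn.change (he : e ∈ atlas (CInf E) M) (he' : e' ∈ atlas (CInf E) M) {f : M → G}
    (hU : U ⊆ e.source) (hf : ConvSmoothOn (fun y => f (pointAt e y)) (dom e U)) :
    ConvSmoothOn (fun y => f (pointAt e' y)) (dom e' U) := by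
  refine (hf.comp ((convSmoothOn_change he' he).mono (dom_mono hU)) (mapsTo_change hU)).congr
    fun y hy => ?_
  simp only [pointAt_coord (hU hy.2)]

theorem dirDeriv_change (he : e ∈ atlas (CInf E) M) (he' : e' ∈ atlas (CInf E) M) {f : M → G}
    (hU : IsOpen U) (hf : ConvSmoothOn (fun y => f (pointAt e y)) (dom e U)) (hx : x ∈ U)
    (hxe : x ∈ e.source) (hxe' : x ∈ e'.source) (v : E) :
    dirDeriv (fun y => f (pointAt e' y)) (coord e' x) v =
      dirDeriv (fun y => f (pointAt e y)) (coord e x)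
        (dirDeriv (fun y => coord e (pointAt e' y)) (coord e' x) v) := by
  have hV : IsOpen (U ∩ e.source) := hU.inter e.open_source
  have h1 := (convSmoothOn_change he' he).mono (dom_mono (U := U ∩ e.source) inter_subset_right)
  have h2 := hf.mono (dom_mono (U := U ∩ e.source) inter_subset_left)
  have hy : coord e' x ∈ dom e' (U ∩ e.source) := coord_mem_dom hxe' ⟨hx, hxe⟩
  have h3 := dirDeriv_comp (cInfOpen_dom hV) (cInfOpen_dom hV) h2 h1
    (mapsTo_change inter_subset_right) hy v
  simp only [pointAt_coord hxe'] at h3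
  rw [← h3]
  refine dirDeriv_congr (cInfOpen_dom hV)
    (h2.comp h1 (mapsTo_change inter_subset_right)) (fun y hy => ?_) hy v
  simp only [pointAt_coord (e := e) hy.2.2]

/-! ### Tangent coordinates -/

theorem diffAt_eq (he : e ∈ atlas (CInf E) M) {f : M → G} (hU : IsOpen U)
    (hf : ConvSmoothOn (fun y => f (pointAt e y)) (dom e U)) (hx : x ∈ U) (hxe : x ∈ e.source)
    (v : E) : diffAt f x v = dirDeriv (fun y => f (pointAt e y)) (coord e x) (tcoord e x v) :=
  dirDeriv_change he (chart_mem_atlas _ x) hU hf hx hxe (mem_chart_source _ x) v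

theorem tcoord_change (he : e ∈ atlas (CInf E) M) (he' : e' ∈ atlas (CInf E) M)
    (hxe : x ∈ e.source) (hxe' : x ∈ e'.source) (v : E) :
    tcoord e' x v = dirDeriv (fun y => coord e' (pointAt e y)) (coord e x) (tcoord e x v) :=
  diffAt_eq he e'.open_source (convSmoothOn_change he he') hxe' hxe v

theorem dirDeriv_coord_pointAt (hxe : x ∈ e.source) (v : E) :
    dirDeriv (fun y => coord e (pointAt e y)) (coord e x) v = v := by
  rw [dirDeriv_congr (cInfOpen_dom isOpen_univ) (convSmoothOn_id _)
    (fun y hy => coord_pointAt (e := e) hy) (coord_mem_dom hxe (mem_univ x)), dirDeriv_id]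

theorem tcoord_chartAt (x : M) (v : E) : tcoord (chartAt (CInf E) x) x v = v :=
  dirDeriv_coord_pointAt (mem_chart_source _ x) v

/-- The coordinates of tangent vectors in a chart. -/
def tcoordEquiv (he : e ∈ atlas (CInf E) M) (hx : x ∈ e.source) : E ≃ₗ[ℝ] E where
  toFun := tcoord e x
  invFun := dirDeriv (fun y => coord (chartAt (CInf E) x) (pointAt e y)) (coord e x)
  map_add' := dirDeriv_add (cInfOpen_dom e.open_source)
    (convSmoothOn_change (chart_mem_atlas _ x) he) (coord_mem_dom (mem_chart_source _ x) hx)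
  map_smul' := dirDeriv_smul (cInfOpen_dom e.open_source)
    (convSmoothOn_change (chart_mem_atlas _ x) he) (coord_mem_dom (mem_chart_source _ x) hx)
  left_inv v := by
    rw [← tcoord_change he (chart_mem_atlas _ x) hx (mem_chart_source _ x), tcoord_chartAt]
  right_inv w := (dirDeriv_change (chart_mem_atlas _ x) he e.open_source
    (convSmoothOn_change (chart_mem_atlas _ x) he) hx (mem_chart_source _ x) hx w).symm.trans
      (dirDeriv_coord_pointAt hx w)

open Classical in
/-- The coordinates of tangent vectors in a chart; by convention the identity outside of the
domain. -/
def tc (e : OpenPartialHomeomorph M (CInf E)) (x : M) : E ≃ₗ[ℝ] E :=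
  if h : e ∈ atlas (CInf E) M ∧ x ∈ e.source then tcoordEquiv h.1 h.2 else LinearEquiv.refl ℝ E

theorem tc_apply (he : e ∈ atlas (CInf E) M) (hx : x ∈ e.source) (v : E) :
    tc e x v = tcoord e x v := by
  rw [tc, dif_pos ⟨he, hx⟩]; rfl

theorem tc_chartAt (x : M) (v : E) : tc (chartAt (CInf E) x) x v = v := by
  rw [tc_apply (chart_mem_atlas _ x) (mem_chart_source _ x), tcoord_chartAt]

theorem tc_chartAt_symm (x : M) (v : E) : (tc (chartAt (CInf E) x) x).symm v = v := by
  rw [LinearEquiv.symm_apply_eq, tc_chartAt]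

theorem tc_tc_symm (he : e ∈ atlas (CInf E) M) (he' : e' ∈ atlas (CInf E) M)
    (hxe : x ∈ e.source) (hxe' : x ∈ e'.source) (w : E) :
    tc e' x ((tc e x).symm w) = dirDeriv (fun y => coord e' (pointAt e y)) (coord e x) w := by
  rw [tc_apply he' hxe', tcoord_change he he' hxe hxe', ← tc_apply he hxe,
    LinearEquiv.apply_symm_apply]

theorem diffAt_eq_tc (he : e ∈ atlas (CInf E) M) {f : M → G} (hU : IsOpen U)
    (hf : ConvSmoothOn (fun y => f (pointAt e y)) (dom e U)) (hx : x ∈ U) (hxe : x ∈ e.source)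
    (v : E) : diffAt f x v = dirDeriv (fun y => f (pointAt e y)) (coord e x) (tc e x v) := by
  rw [tc_apply he hxe, diffAt_eq he hU hf hx hxe]

/-! ### Vector fields -/

theorem vfRep_eq (he : e ∈ atlas (CInf E) M) (X : M → E) {y : E} (hy : y ∈ dom e U) :
    vfRep e X y = tc e (pointAt e y) (X (pointAt e y)) :=
  (tc_apply he (pointAt_mem_source hy) _).symm

theorem vfRep_coord (he : e ∈ atlas (CInf E) M) (X : M → E) (hx : x ∈ e.source) :
    vfRep e X (coord e x) = tc e x (X x) := by
  rw [vfRep_eq he X (coord_mem_dom hx (mem_univ x)), pointAt_coord hx]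

theorem vfRep_chartAt (X : M → E) (x : M) :
    vfRep (chartAt (CInf E) x) X (coord (chartAt (CInf E) x) x) = X x := by
  rw [vfRep_coord (chart_mem_atlas _ x) X (mem_chart_source _ x), tc_chartAt]

theorem smoothVF_of_chart (he : e ∈ atlas (CInf E) M) (hU : U ⊆ e.source) {X : M → E}
    (hX : ConvSmoothOn (vfRep e X) (dom e U)) : SmoothVF X U := by
  intro e' he'
  have h1 := (convSmoothOn_change he' he).mono (dom_mono hU)
  have h2 : ConvSmoothOn (fun y => vfRep e X (coord e (pointAt e' y))) (dom e' U) :=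
    hX.comp h1 (mapsTo_change hU)
  have h3 := ((convSmoothOn_change he he').dirDeriv (cInfOpen_dom e'.open_source)).comp
    (h1.prodMk h2) fun y hy => ⟨⟨(mapsTo_change hU hy).1, by
      rw [pointAt_coord (hU hy.2)]; exact pointAt_mem_source hy⟩, mem_univ _⟩
  refine h3.congr fun y hy => ?_
  have hxe := hU hy.2
  have hxe' := pointAt_mem_source hy
  simp only []
  rw [vfRep_coord he X hxe, ← tc_tc_symm he he' hxe hxe', LinearEquiv.symm_apply_apply,
    vfRep_eq he' X hy]

theorem SmoothVF.mono {X : M → E} (hX : SmoothVF X U) (h : V ⊆ U) : SmoothVF X V :=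
  fun e he => (hX e he).mono (dom_mono h)

theorem SmoothVF.of_local {X : M → E}
    (h : ∀ x ∈ U, ∃ W, IsOpen W ∧ x ∈ W ∧ SmoothVF X (W ∩ U)) : SmoothVF X U := by
  intro e he
  refine ConvSmoothOn.of_local fun y hy => ?_
  obtain ⟨W, hW, hxW, hXW⟩ := h _ hy.2
  refine ⟨dom e W, cInfOpen_dom hW, ⟨hy.1, hxW⟩, (hXW e he).mono fun z hz => ?_⟩
  exact ⟨hz.1.1, hz.1.2, hz.2.2⟩

theorem SmoothVF.congr {X Y : M → E} (hX : SmoothVF X U) (h : ∀ x ∈ U, Y x = X x) :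
    SmoothVF Y U := by
  intro e he
  refine (hX e he).congr fun y hy => ?_
  rw [vfRep_eq he Y hy, vfRep_eq he X hy, h _ hy.2]

/-! ### The bundle `T^♭M` -/

variable (β : FlatModel E Eb) [WeakSubbundle M β]

theorem exists_flat_change (he : e ∈ atlas (CInf E) M) (he' : e' ∈ atlas (CInf E) M) :
    ∃ τ : E × Eb → Eb, ConvSmoothOn τ (dom e e'.source ×ˢ univ) ∧
      ∀ x, x ∈ e.source → x ∈ e'.source → ∀ η v,
        β.pair (τ (coord e x, η)) (tc e x v) = β.pair η (tc e' x v) := by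
  obtain ⟨τ, hτ, h⟩ := WeakSubbundle.transpose_change (M := M) (β := β) e he e' he'
  refine ⟨τ, hτ, fun x hx hx' η v => ?_⟩
  rw [h _ (coord_mem_dom hx hx'), ← tc_tc_symm he he' hx hx', LinearEquiv.symm_apply_apply]

/-- The transposed chart changes to and from the preferred chart are mutually inverse and linear
because elements of E^♭ are determined by the pairing. -/
theorem exists_flat_iso (he : e ∈ atlas (CInf E) M) (hx : x ∈ e.source) :
    ∃ T : Eb ≃ₗ[ℝ] Eb, ∀ ξ v, β.pair (T ξ) (tc e x v) = β.pair ξ v := by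
  obtain ⟨τ, -, h⟩ := exists_flat_change β he (chart_mem_atlas (CInf E) x)
  obtain ⟨τ', -, h'⟩ := exists_flat_change β (chart_mem_atlas (CInf E) x) he
  have hc := mem_chart_source (CInf E) x
  have h1 : ∀ ξ v, β.pair (τ (coord e x, ξ)) (tc e x v) = β.pair ξ v := fun ξ v => by
    rw [h x hx hc, tc_chartAt]
  have h2 : ∀ η v, β.pair (τ' (coord (chartAt (CInf E) x) x, η)) v = β.pair η (tc e x v) :=
    fun η v => by rw [← h' x hc hx, tc_chartAt]
  have ext' : ∀ {ξ η}, (∀ v, β.pair ξ (tc e x v) = β.pair η (tc e x v)) → ξ = η :=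
    fun hv => β.ext_pair fun v => by simpa using hv ((tc e x).symm v)
  refine ⟨{ toFun := fun ξ => τ (coord e x, ξ)
            invFun := fun η => τ' (coord (chartAt (CInf E) x) x, η)
            map_add' := fun ξ ξ' => ext' fun v => ?_
            map_smul' := fun r ξ => ext' fun v => ?_
            left_inv := fun ξ => β.ext_pair fun v => ?_
            right_inv := fun η => ext' fun v => ?_ }, fun ξ v => h1 ξ v⟩
  · simp [h1]
  · simp [h1]
  · rw [h2, h1]
  · rw [h1, h2]

open Classical in
/-- The coordinates of elements of `T^♭M` in a chart; by convention the identity outside of the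
domain. -/
def fc (e : OpenPartialHomeomorph M (CInf E)) (x : M) : Eb ≃ₗ[ℝ] Eb :=
  if h : ∃ T : Eb ≃ₗ[ℝ] Eb, ∀ ξ v, β.pair (T ξ) (tc e x v) = β.pair ξ v then h.choose
  else LinearEquiv.refl ℝ Eb

theorem pair_fc (he : e ∈ atlas (CInf E) M) (hx : x ∈ e.source) (ξ : Eb) (v : E) :
    β.pair (fc β e x ξ) (tc e x v) = β.pair ξ v := by
  have h := exists_flat_iso β he hx
  rw [fc, dif_pos h]
  exact h.choose_spec ξ v

theorem pair_fc_symm (he : e ∈ atlas (CInf E) M) (hx : x ∈ e.source) (η : Eb) (v : E) :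
    β.pair ((fc β e x).symm η) v = β.pair η (tc e x v) := by
  rw [← pair_fc β he hx, LinearEquiv.apply_symm_apply]

theorem fc_eq_of_pair (he : e ∈ atlas (CInf E) M) (hx : x ∈ e.source) {ξ η : Eb}
    (h : ∀ v, β.pair η (tc e x v) = β.pair ξ v) : fc β e x ξ = η := by
  rw [← LinearEquiv.eq_symm_apply]
  exact (β.ext_pair fun v => by rw [pair_fc_symm β he hx, h]).symm

theorem fc_chartAt (x : M) (ξ : Eb) : fc β (chartAt (CInf E) x) x ξ = ξ :=
  fc_eq_of_pair β (chart_mem_atlas _ x) (mem_chart_source _ x) fun v => by rw [tc_chartAt]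

theorem fc_chartAt_symm (x : M) (ξ : Eb) : (fc β (chartAt (CInf E) x) x).symm ξ = ξ := by
  rw [LinearEquiv.symm_apply_eq, fc_chartAt]

theorem flatCoord_iff (he : e ∈ atlas (CInf E) M) (hx : x ∈ e.source) {ξ η : Eb} :
    FlatCoord β e x ξ η ↔ fc β e x ξ = η := by
  constructor
  · intro h
    exact fc_eq_of_pair β he hx fun v => by rw [tc_apply he hx, h v]
  · rintro rfl v
    rw [← tc_apply he hx, pair_fc β he hx]

theorem convSmoothOn_fc_change (he : e ∈ atlas (CInf E) M) (he' : e' ∈ atlas (CInf E) M) :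
    ConvSmoothOn (fun q : E × Eb =>
      fc β e (pointAt e q.1) ((fc β e' (pointAt e q.1)).symm q.2)) (dom e e'.source ×ˢ univ) := by
  obtain ⟨τ, hτ, h⟩ := exists_flat_change β he he'
  refine hτ.congr fun q hq => ?_
  have hx := pointAt_mem_source hq.1
  refine fc_eq_of_pair β he hx fun v => ?_
  have := h _ hx hq.1.2 q.2 v
  rw [coord_pointAt hq.1] at this
  rw [this, pair_fc_symm β he' hq.1.2]

/-- The coordinate expression of a section of `T^♭M`. -/
def flatRep (e : OpenPartialHomeomorph M (CInf E)) (α : M → Eb) (y : E) : Eb :=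
  fc β e (pointAt e y) (α (pointAt e y))

theorem flatRep_coord (α : M → Eb) (hx : x ∈ e.source) :
    flatRep β e α (coord e x) = fc β e x (α x) := by rw [flatRep, pointAt_coord hx]

theorem smoothFlatSection_iff {α : M → Eb} :
    SmoothFlatSection β α U ↔
      ∀ e ∈ atlas (CInf E) M, ConvSmoothOn (flatRep β e α) (dom e U) := by
  constructor
  · intro h e he
    obtain ⟨a, ha, haα⟩ := h e he
    refine ha.congr fun y hy => ?_
    have := haα _ ⟨hy.2, pointAt_mem_source hy⟩
    rw [flatCoord_iff β he (pointAt_mem_source hy), coord_pointAt hy] at this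
    exact this
  · intro h e he
    refine ⟨_, h e he, fun x hx => ?_⟩
    rw [flatCoord_iff β he hx.2, flatRep_coord β α hx.2]

theorem smoothFlatSection_of_chart (he : e ∈ atlas (CInf E) M) (hU : U ⊆ e.source) {α : M → Eb}
    (hα : ConvSmoothOn (flatRep β e α) (dom e U)) : SmoothFlatSection β α U := by
  rw [smoothFlatSection_iff]
  intro e' he'
  have h1 := (convSmoothOn_change he' he).mono (dom_mono hU)
  have h2 : ConvSmoothOn (fun y => flatRep β e α (coord e (pointAt e' y))) (dom e' U) :=
    hα.comp h1 (mapsTo_change hU)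
  refine ((convSmoothOn_fc_change β he' he).comp ((convSmoothOn_id _).prodMk h2)
    fun y hy => ⟨dom_mono hU hy, mem_univ _⟩).congr fun y hy => ?_
  simp only []
  rw [flatRep_coord β α (hU hy.2), LinearEquiv.symm_apply_apply, flatRep]

theorem SmoothFlatSection.mono {α : M → Eb} (hα : SmoothFlatSection β α U) (h : V ⊆ U) :
    SmoothFlatSection β α V := by
  rw [smoothFlatSection_iff] at *
  exact fun e he => (hα e he).mono (dom_mono h)

theorem SmoothFlatSection.of_local {α : M → Eb}
    (h : ∀ x ∈ U, ∃ W, IsOpen W ∧ x ∈ W ∧ SmoothFlatSection β α (W ∩ U)) :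
    SmoothFlatSection β α U := by
  rw [smoothFlatSection_iff]
  intro e he
  refine ConvSmoothOn.of_local fun y hy => ?_
  obtain ⟨W, hW, hxW, hXW⟩ := h _ hy.2
  refine ⟨dom e W, cInfOpen_dom hW, ⟨hy.1, hxW⟩,
    ((smoothFlatSection_iff β).1 hXW e he).mono fun z hz => ?_⟩
  exact ⟨hz.1.1, hz.1.2, hz.2.2⟩

theorem SmoothFlatSection.congr {α γ : M → Eb} (hα : SmoothFlatSection β α U)
    (h : ∀ x ∈ U, γ x = α x) : SmoothFlatSection β γ U := by
  rw [smoothFlatSection_iff] at *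
  intro e he
  refine (hα e he).congr fun y hy => ?_
  rw [flatRep, flatRep, h _ hy.2]

/-- The section with given coordinate expression. -/
def chartSection (e : OpenPartialHomeomorph M (CInf E)) (a : E → Eb) (x : M) : Eb :=
  (fc β e x).symm (a (coord e x))

theorem flatRep_chartSection (a : E → Eb) {y : E} (hy : y ∈ dom e U) :
    flatRep β e (chartSection β e a) y = a y := by
  rw [flatRep, chartSection, LinearEquiv.apply_symm_apply, coord_pointAt hy]

theorem smoothFlatSection_chartSection (he : e ∈ atlas (CInf E) M) (hU : U ⊆ e.source)
    {a : E → Eb} (ha : ConvSmoothOn a (dom e U)) :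
    SmoothFlatSection β (chartSection β e a) U :=
  smoothFlatSection_of_chart β he hU (ha.congr fun _ hy => flatRep_chartSection β a hy)

/-- The vector field with given coordinate expression. -/
def chartField (e : OpenPartialHomeomorph M (CInf E)) (X : E → E) (x : M) : E :=
  (tc e x).symm (X (coord e x))

theorem vfRep_chartField (he : e ∈ atlas (CInf E) M) (X : E → E) {y : E} (hy : y ∈ dom e U) :
    vfRep e (chartField e X) y = X y := by
  rw [vfRep_eq he _ hy, chartField, LinearEquiv.apply_symm_apply, coord_pointAt hy]

theorem smoothVF_chartField (he : e ∈ atlas (CInf E) M) (hU : U ⊆ e.source)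
    {X : E → E} (hX : ConvSmoothOn X (dom e U)) : SmoothVF (chartField e X) U :=
  smoothVF_of_chart he hU (hX.congr fun _ hy => vfRep_chartField he X hy)

theorem pair_flatRep_vfRep (he : e ∈ atlas (CInf E) M) (α : M → Eb) (X : M → E) {y : E}
    (hy : y ∈ dom e U) : β.pair (flatRep β e α y) (vfRep e X y) =
      β.pair (α (pointAt e y)) (X (pointAt e y)) := by
  rw [vfRep_eq he X hy, flatRep, pair_fc β he (pointAt_mem_source hy)]

/-! ### Coordinate expressions of bundle maps -/

/-- The coordinate expression of a bundle map `T^♭M → TM`. -/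
def anchorRep (e : OpenPartialHomeomorph M (CInf E)) (P : M → Eb →ₗ[ℝ] E) (y : E) : Eb →ₗ[ℝ] E :=
  (tc e (pointAt e y)).toLinearMap ∘ₗ P (pointAt e y) ∘ₗ (fc β e (pointAt e y)).symm.toLinearMap

/-- The coordinate expression of a bundle map `TM → TM`. -/
def endoRep (e : OpenPartialHomeomorph M (CInf E)) (N : M → E →ₗ[ℝ] E) (y : E) : E →ₗ[ℝ] E :=
  (tc e (pointAt e y)).toLinearMap ∘ₗ N (pointAt e y) ∘ₗ (tc e (pointAt e y)).symm.toLinearMap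

/-- The coordinate expression of a bundle map `T^♭M → T^♭M`. -/
def flatEndoRep (e : OpenPartialHomeomorph M (CInf E)) (Nt : M → Eb →ₗ[ℝ] Eb) (y : E) :
    Eb →ₗ[ℝ] Eb :=
  (fc β e (pointAt e y)).toLinearMap ∘ₗ Nt (pointAt e y) ∘ₗ
    (fc β e (pointAt e y)).symm.toLinearMap

theorem anchorRep_apply (P : M → Eb →ₗ[ℝ] E) (y : E) (η : Eb) :
    anchorRep β e P y η =
      tc e (pointAt e y) (P (pointAt e y) ((fc β e (pointAt e y)).symm η)) := rfl

theorem endoRep_apply (N : M → E →ₗ[ℝ] E) (y : E) (v : E) :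
    endoRep e N y v = tc e (pointAt e y) (N (pointAt e y) ((tc e (pointAt e y)).symm v)) := rfl

theorem flatEndoRep_apply (Nt : M → Eb →ₗ[ℝ] Eb) (y : E) (η : Eb) :
    flatEndoRep β e Nt y η =
      fc β e (pointAt e y) (Nt (pointAt e y) ((fc β e (pointAt e y)).symm η)) := rfl

theorem vfRep_anchor (he : e ∈ atlas (CInf E) M) (P : M → Eb →ₗ[ℝ] E) (α : M → Eb) {y : E}
    (hy : y ∈ dom e U) :
    vfRep e (fun z => P z (α z)) y = anchorRep β e P y (flatRep β e α y) := by
  rw [vfRep_eq he _ hy, anchorRep_apply, flatRep, LinearEquiv.symm_apply_apply]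

theorem vfRep_endo (he : e ∈ atlas (CInf E) M) (N : M → E →ₗ[ℝ] E) (X : M → E) {y : E}
    (hy : y ∈ dom e U) : vfRep e (fun z => N z (X z)) y = endoRep e N y (vfRep e X y) := by
  rw [vfRep_eq he _ hy, endoRep_apply, vfRep_eq he X hy, LinearEquiv.symm_apply_apply]

theorem flatRep_flatEndo (Nt : M → Eb →ₗ[ℝ] Eb) (α : M → Eb) (y : E) :
    flatRep β e (fun z => Nt z (α z)) y = flatEndoRep β e Nt y (flatRep β e α y) := by
  rw [flatRep, flatEndoRep_apply, flatRep, LinearEquiv.symm_apply_apply]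

theorem anchorRep_chartAt (P : M → Eb →ₗ[ℝ] E) (x : M) (η : Eb) :
    anchorRep β (chartAt (CInf E) x) P (coord (chartAt (CInf E) x) x) η = P x η := by
  rw [anchorRep_apply, pointAt_coord (mem_chart_source _ x), tc_chartAt, fc_chartAt_symm]

theorem endoRep_chartAt (N : M → E →ₗ[ℝ] E) (x : M) (v : E) :
    endoRep (chartAt (CInf E) x) N (coord (chartAt (CInf E) x) x) v = N x v := by
  rw [endoRep_apply, pointAt_coord (mem_chart_source _ x), tc_chartAt, tc_chartAt_symm]

theorem isSmoothAnchor_iff {P : M → Eb →ₗ[ℝ] E} :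
    IsSmoothAnchor β P ↔ ∀ e ∈ atlas (CInf E) M,
      ConvSmoothOn (fun q : E × Eb => anchorRep β e P q.1 q.2) (dom e univ ×ˢ univ) := by
  refine forall₂_congr fun e he => ⟨?_, fun h => ⟨_, h, fun x hx ξ η hη => ?_⟩⟩
  · rintro ⟨p, hp, h⟩
    refine hp.congr fun q hq => ?_
    have hx := pointAt_mem_source hq.1
    have := h _ hx _ q.2 ((flatCoord_iff β he hx).2 ((fc β e _).apply_symm_apply q.2))
    rw [coord_pointAt hq.1] at this
    rw [anchorRep_apply, tc_apply he hx]
    exact this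
  · rw [flatCoord_iff β he hx] at hη
    simp only []
    rw [anchorRep_apply, pointAt_coord hx, tc_apply he hx, ← hη, LinearEquiv.symm_apply_apply]

theorem isSmoothEndo_iff {N : M → E →ₗ[ℝ] E} :
    IsSmoothEndo N ↔ ∀ e ∈ atlas (CInf E) M,
      ConvSmoothOn (fun q : E × E => endoRep e N q.1 q.2) (dom e univ ×ˢ univ) := by
  refine forall₂_congr fun e he => ⟨?_, fun h => ⟨_, h, fun x hx v => ?_⟩⟩
  · rintro ⟨p, hp, h⟩
    refine hp.congr fun q hq => ?_
    have hx := pointAt_mem_source hq.1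
    have := h _ hx ((tc e (pointAt e q.1)).symm q.2)
    rw [coord_pointAt hq.1, ← tc_apply he hx, ← tc_apply he hx, LinearEquiv.apply_symm_apply]
      at this
    exact this
  · simp only []
    rw [endoRep_apply, pointAt_coord hx, tc_apply he hx, ← tc_apply he hx v,
      LinearEquiv.symm_apply_apply]

theorem smooth_flatEndo_iff {Nt : M → Eb →ₗ[ℝ] Eb} :
    (∀ e ∈ atlas (CInf E) M, ∃ q : E × Eb → Eb, ConvSmoothOn q (dom e univ ×ˢ univ) ∧
      ∀ x ∈ e.source, ∀ ξ η : Eb, FlatCoord β e x ξ η →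
        FlatCoord β e x (Nt x ξ) (q (coord e x, η))) ↔ ∀ e ∈ atlas (CInf E) M,
      ConvSmoothOn (fun q : E × Eb => flatEndoRep β e Nt q.1 q.2) (dom e univ ×ˢ univ) := by
  refine forall₂_congr fun e he => ⟨?_, fun h => ⟨_, h, fun x hx ξ η hη => ?_⟩⟩
  · rintro ⟨p, hp, h⟩
    refine hp.congr fun q hq => ?_
    have hx := pointAt_mem_source hq.1
    have := h _ hx _ q.2 ((flatCoord_iff β he hx).2 ((fc β e _).apply_symm_apply q.2))
    rw [coord_pointAt hq.1, flatCoord_iff β he hx] at this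
    exact this
  · rw [flatCoord_iff β he hx] at hη ⊢
    simp only []
    rw [flatEndoRep_apply, pointAt_coord hx, ← hη, LinearEquiv.symm_apply_apply]

theorem pair_anchorRep_antisymm (he : e ∈ atlas (CInf E) M) {P : M → Eb →ₗ[ℝ] E}
    (h : ∀ x ξ η, β.pair ξ (P x η) = -β.pair η (P x ξ)) {y : E} (hy : y ∈ dom e U) (ξ η : Eb) :
    β.pair ξ (anchorRep β e P y η) = -β.pair η (anchorRep β e P y ξ) := by
  have hx := pointAt_mem_source hy
  rw [anchorRep_apply, anchorRep_apply, ← pair_fc_symm β he hx, ← pair_fc_symm β he hx, h]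

/-! ### Admissible functions -/

/-- The condition on higher derivatives is automatic: the derivative of an E^♭-valued representative
is again E^♭-valued, and Schwarz's theorem moves the free argument to the outermost place. -/
theorem isAdmissible_of_differential (hU : IsOpen U) {f : M → ℝ}
    (h : ∀ e ∈ atlas (CInf E) M, ConvSmoothOn (fun y : E => f (pointAt e y)) (dom e U) ∧
      ∃ a : E → Eb, ConvSmoothOn a (dom e U) ∧
        ∀ y ∈ dom e U, ∀ v : E, β.pair (a y) v = dirDeriv (fun z : E => f (pointAt e z)) y v) :
    IsAdmissible β f U := by
  refine ⟨fun e he => (h e he).1, fun e he => (h e he).2, fun e he y hy u => ?_⟩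
  obtain ⟨hf, a, ha, hfa⟩ := h e he
  have hD := cInfOpen_dom (e := e) hU
  have key : ConvSmoothOn (iterDirDeriv (fun z : E => f (pointAt e z)) u) (dom e U) ∧
      ∃ a : E → Eb, ConvSmoothOn a (dom e U) ∧ ∀ y ∈ dom e U, ∀ v : E,
        β.pair (a y) v = dirDeriv (iterDirDeriv (fun z : E => f (pointAt e z)) u) y v := by
    induction u with
    | nil => exact ⟨hf, a, ha, hfa⟩
    | cons w u ih =>
      obtain ⟨hs, b, hb, hbv⟩ := ih
      refine ⟨hs.dirDeriv_const hD w, fun z => dirDeriv b z w, hb.dirDeriv_const hD w,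
        fun z hz v => ?_⟩
      have h1 := dirDeriv_pair β hD hb (convSmoothOn_const v _) hz w
      rw [dirDeriv_const, map_zero, add_zero] at h1
      rw [← h1, dirDeriv_congr hD (hs.dirDeriv_const hD v) (fun z hz => hbv z hz v) hz]
      exact (dirDeriv_symm hD hs hz w v).symm
  obtain ⟨-, b, -, hb⟩ := key
  exact ⟨b y, fun v => hb y hy v⟩

theorem isAdmissible_of_chart (he : e ∈ atlas (CInf E) M) (hUo : IsOpen U) (hU : U ⊆ e.source)
    {f : M → ℝ} (hf : ConvSmoothOn (fun y : E => f (pointAt e y)) (dom e U)) {a : E → Eb}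
    (ha : ConvSmoothOn a (dom e U))
    (hfa : ∀ y ∈ dom e U, ∀ v : E, β.pair (a y) v = dirDeriv (fun z : E => f (pointAt e z)) y v) :
    IsAdmissible β f U := by
  refine isAdmissible_of_differential β hUo fun e' he' => ⟨hf.change he he' hU, ?_⟩
  have hs := (smoothFlatSection_iff β).1 (smoothFlatSection_chartSection β he hU ha) e' he'
  refine ⟨_, hs, fun y hy v => ?_⟩
  have hx' := pointAt_mem_source hy
  have hx := hU hy.2
  obtain ⟨u, rfl⟩ := (tc e' (pointAt e' y)).surjective v
  rw [flatRep, pair_fc β he' hx', chartSection, pair_fc_symm β he hx,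
    hfa _ (coord_mem_dom hx hy.2), ← diffAt_eq_tc he hUo hf hy.2 hx,
    diffAt_eq_tc he' hUo (hf.change he he' hU) hy.2 hx', coord_pointAt hy]

/-- Non-degeneracy of the pairing makes the choice in `flatDiff` harmless wherever a representative
exists. -/
theorem flatRep_flatDiff (he : e ∈ atlas (CInf E) M) (hU : IsOpen U) {f : M → ℝ}
    (hf : ConvSmoothOn (fun y : E => f (pointAt e y)) (dom e U)) {a : E → Eb}
    (hfa : ∀ y ∈ dom e U, ∀ v : E, β.pair (a y) v = dirDeriv (fun z : E => f (pointAt e z)) y v)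
    {y : E} (hy : y ∈ dom e U) : flatRep β e (flatDiff β f) y = a y := by
  have hx := pointAt_mem_source hy
  have hd : ∀ v, diffAt f (pointAt e y) v = β.pair (a y) (tc e (pointAt e y) v) := fun v => by
    rw [diffAt_eq_tc he hU hf hy.2 hx, coord_pointAt hy, hfa y hy]
  have hex : ∃ ξ : Eb, ∀ v : E, β.pair ξ v = diffAt f (pointAt e y) v :=
    ⟨(fc β e (pointAt e y)).symm (a y), fun v => by rw [pair_fc_symm β he hx, hd]⟩
  refine fc_eq_of_pair β he hx fun v => ?_
  rw [← hd]
  exact (Classical.epsilon_spec hex v).symm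

theorem poissonBr_pointAt (he : e ∈ atlas (CInf E) M) (hU : IsOpen U) (P : M → Eb →ₗ[ℝ] E)
    {f g : M → ℝ} (hf : ConvSmoothOn (fun y : E => f (pointAt e y)) (dom e U)) {a : E → Eb}
    (hfa : ∀ y ∈ dom e U, ∀ v : E, β.pair (a y) v = dirDeriv (fun z : E => f (pointAt e z)) y v)
    (hg : ConvSmoothOn (fun y : E => g (pointAt e y)) (dom e U)) {b : E → Eb}
    (hgb : ∀ y ∈ dom e U, ∀ v : E, β.pair (b y) v = dirDeriv (fun z : E => g (pointAt e z)) y v)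
    {y : E} (hy : y ∈ dom e U) :
    poissonBr β P f g (pointAt e y) = -β.pair (a y) (anchorRep β e P y (b y)) := by
  rw [poissonBr, ← pair_flatRep_vfRep β he (flatDiff β f) (fun x => P x (flatDiff β g x)) hy,
    vfRep_anchor β he P _ hy, flatRep_flatDiff β he hU hf hfa hy,
    flatRep_flatDiff β he hU hg hgb hy]

end Charts
end

noncomputable section
open scoped ContDiff

/-! ## Partial PN structures in charts -/

section LocalForms

variable {E Eb : Type*}
  [AddCommGroup E] [Module ℝ E] [TopologicalSpace E] [ConvenientSpace E]
  [AddCommGroup Eb] [Module ℝ Eb] [TopologicalSpace Eb] [ConvenientSpace Eb]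

/-- The torsion of a field of endomorphisms, in coordinates. -/
def torsionAt (n : E → E →ₗ[ℝ] E) (y u v : E) : E :=
  dirDeriv (fun z => n z v) y (n y u) - dirDeriv (fun z => n z u) y (n y v) +
    n y (dirDeriv (fun z => n z u) y v) - n y (dirDeriv (fun z => n z v) y u)

/-- The vanishing of the concomitant, in coordinates. -/
def ConcomitantVanishesAt (β : FlatModel E Eb) (p : E → Eb →ₗ[ℝ] E) (n : E → E →ₗ[ℝ] E) (y : E) :
    Prop :=
  ∀ ξ θ : Eb, ∃ γ : Eb, (∀ v, β.pair γ v = β.pair ξ (dirDeriv (fun z => n z v) y (p y θ) -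
      dirDeriv (fun z => n z (p y θ)) y v)) ∧
    dirDeriv (fun z => n z (p y θ)) y (p y ξ) - dirDeriv (fun z => p z ξ) y (n y (p y θ)) +
      n y (dirDeriv (fun z => p z ξ) y (p y θ)) = p y γ

/-- The coordinate expression of a partial Poisson anchor. -/
structure IsLocalPoisson (β : FlatModel E Eb) (p : E → Eb →ₗ[ℝ] E) (D : Set E) : Prop where
  smooth : ConvSmoothOn (fun q : E × Eb => p q.1 q.2) (D ×ˢ univ)
  antisymm : ∀ y ∈ D, ∀ ξ η, β.pair ξ (p y η) = -β.pair η (p y ξ)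
  exists_derivative : ∃ B : E → Eb →ₗ[ℝ] Eb →ₗ[ℝ] Eb,
    ConvSmoothOn (fun q : E × Eb × Eb => B q.1 q.2.1 q.2.2) (D ×ˢ univ) ∧
    ∀ y ∈ D, ∀ ξ η v, β.pair (B y ξ η) v = β.pair ξ (dirDeriv (fun z => p z η) y v)
  jacobi : ∀ y ∈ D, ∀ ξ η ζ, β.pair ξ (dirDeriv (fun z => p z η) y (p y ζ)) +
    β.pair η (dirDeriv (fun z => p z ζ) y (p y ξ)) +
      β.pair ζ (dirDeriv (fun z => p z ξ) y (p y η)) = 0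

variable {M : Type*} [TopologicalSpace M] [ChartedSpace (CInf E) M] [ConvManifold E M]
  {e : OpenPartialHomeomorph M (CInf E)} {U : Set M} {x : M}

/-! ### Derivatives of coordinate expressions -/

theorem dirDeriv_vfRep_endo {N : M → E →ₗ[ℝ] E} (hN : IsSmoothEndo N) (hU : IsOpen U) {X : M → E}
    (hX : SmoothVF X U) (he : e ∈ atlas (CInf E) M) {y : E} (hy : y ∈ dom e U) (w : E) :
    dirDeriv (vfRep e fun z => N z (X z)) y w =
      dirDeriv (fun z => endoRep e N z (vfRep e X y)) y w +
        endoRep e N y (dirDeriv (vfRep e X) y w) := by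
  have hD := cInfOpen_dom (e := e) hU
  have hn := (isSmoothEndo_iff.1 hN e he).mono
    (prod_mono (dom_mono (subset_univ U)) (subset_univ (univ : Set E)))
  rw [← dirDeriv_family_const hD hn (hX e he) hy]
  exact dirDeriv_congr hD (hn.apply_linear (convSmoothOn_id _) (hX e he) (mapsTo_id _))
    (fun z hz => vfRep_endo he N X hz) hy w

theorem SmoothVF.endo {N : M → E →ₗ[ℝ] E} (hN : IsSmoothEndo N) {X : M → E}
    (hX : SmoothVF X U) : SmoothVF (fun z => N z (X z)) U := by
  intro e he
  have hn := (isSmoothEndo_iff.1 hN e he).mono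
    (prod_mono (dom_mono (subset_univ U)) (subset_univ (univ : Set E)))
  exact (hn.apply_linear (convSmoothOn_id _) (hX e he) (mapsTo_id _)).congr
    fun z hz => vfRep_endo he N X hz

/-- Tensoriality of the torsion: the derivatives of X and Y cancel by linearity of N. Hence fields
constant in a chart suffice as tests. -/
theorem lieBr_endo_torsion {N : M → E →ₗ[ℝ] E} (hN : IsSmoothEndo N) (hU : IsOpen U)
    {X Y : M → E} (hX : SmoothVF X U) (hY : SmoothVF Y U) (hx : x ∈ U) :
    lieBr (fun z => N z (X z)) (fun z => N z (Y z)) x -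
      N x (lieBr (fun z => N z (X z)) Y x + lieBr X (fun z => N z (Y z)) x - N x (lieBr X Y x)) =
    torsionAt (endoRep (chartAt (CInf E) x) N) (coord (chartAt (CInf E) x) x) (X x) (Y x) := by
  have he := chart_mem_atlas (CInf E) x
  have hy := coord_mem_dom (mem_chart_source (CInf E) x) hx
  simp only [lieBr, torsionAt, dirDeriv_vfRep_endo hN hU hX he hy,
    dirDeriv_vfRep_endo hN hU hY he hy, vfRep_chartAt, endoRep_chartAt, map_sub, map_add]
  abel

theorem smoothVF_const (he : e ∈ atlas (CInf E) M) (v : E) :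
    SmoothVF (chartField e fun _ => v) e.source :=
  smoothVF_chartField he subset_rfl (convSmoothOn_const v _)

theorem chartField_chartAt (X : E → E) (x : M) :
    chartField (chartAt (CInf E) x) X x = X (coord (chartAt (CInf E) x) x) :=
  tc_chartAt_symm _ _

theorem isNijenhuis_iff {N : M → E →ₗ[ℝ] E} (hN : IsSmoothEndo N) :
    IsNijenhuis N ↔ ∀ (x : M) (u v : E), torsionAt (endoRep (chartAt (CInf E) x) N)
      (coord (chartAt (CInf E) x) x) u v = 0 := by
  constructor
  · intro h x u v
    have he := chart_mem_atlas (CInf E) x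
    have hu := smoothVF_const he u
    have hv := smoothVF_const he v
    have h1 := lieBr_endo_torsion hN (chartAt (CInf E) x).open_source hu hv
      (mem_chart_source _ x)
    rw [h _ _ _ (chartAt (CInf E) x).open_source hu hv x (mem_chart_source _ x), sub_self,
      chartField_chartAt, chartField_chartAt] at h1
    exact h1.symm
  · intro h U X Y hU hX hY x hx
    rw [← sub_eq_zero, lieBr_endo_torsion hN hU hX hY hx, h]

variable {β : FlatModel E Eb} [WeakSubbundle M β]

theorem dirDeriv_vfRep_anchor {P : M → Eb →ₗ[ℝ] E} (hP : IsSmoothAnchor β P) (hU : IsOpen U)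
    {α : M → Eb} (hα : SmoothFlatSection β α U) (he : e ∈ atlas (CInf E) M) {y : E}
    (hy : y ∈ dom e U) (w : E) :
    dirDeriv (vfRep e fun z => P z (α z)) y w =
      dirDeriv (fun z => anchorRep β e P z (flatRep β e α y)) y w +
        anchorRep β e P y (dirDeriv (flatRep β e α) y w) := by
  have hD := cInfOpen_dom (e := e) hU
  have hn := ((isSmoothAnchor_iff β).1 hP e he).mono
    (prod_mono (dom_mono (subset_univ U)) (subset_univ (univ : Set Eb)))
  have ha := (smoothFlatSection_iff β).1 hα e he
  rw [← dirDeriv_family_const hD hn ha hy]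
  exact dirDeriv_congr hD (hn.apply_linear (convSmoothOn_id _) ha (mapsTo_id _))
    (fun z hz => vfRep_anchor β he P α hz) hy w

theorem SmoothFlatSection.anchor {P : M → Eb →ₗ[ℝ] E} (hP : IsSmoothAnchor β P) {α : M → Eb}
    (hα : SmoothFlatSection β α U) : SmoothVF (fun z => P z (α z)) U := by
  intro e he
  have hn := ((isSmoothAnchor_iff β).1 hP e he).mono
    (prod_mono (dom_mono (subset_univ U)) (subset_univ (univ : Set Eb)))
  exact (hn.apply_linear (convSmoothOn_id _) ((smoothFlatSection_iff β).1 hα e he)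
    (mapsTo_id _)).congr fun z hz => vfRep_anchor β he P α hz

theorem flatRep_chartAt (α : M → Eb) (x : M) :
    flatRep β (chartAt (CInf E) x) α (coord (chartAt (CInf E) x) x) = α x := by
  rw [flatRep_coord β α (mem_chart_source _ x), fc_chartAt]

/-- The derivative of X cancels, while that of α survives in the last parenthesis. `lieCovector_sub`
has a matching term, and N∘P = P∘N^t identifies the two. -/
theorem lieBr_anchor_endo {P : M → Eb →ₗ[ℝ] E} {N : M → E →ₗ[ℝ] E} (hP : IsSmoothAnchor β P)
    (hN : IsSmoothEndo N) (hU : IsOpen U) {α : M → Eb} (hα : SmoothFlatSection β α U) {X : M → E}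
    (hX : SmoothVF X U) (hx : x ∈ U) {p : E → Eb →ₗ[ℝ] E} {n : E → E →ₗ[ℝ] E} {a : E → Eb} {y : E}
    (hp : p = anchorRep β (chartAt (CInf E) x) P) (hn : n = endoRep (chartAt (CInf E) x) N)
    (ha : a = flatRep β (chartAt (CInf E) x) α) (hy : y = coord (chartAt (CInf E) x) x) :
    lieBr (fun z => P z (α z)) (fun z => N z (X z)) x -
        N x (lieBr (fun z => P z (α z)) X x) =
      dirDeriv (fun z => n z (X x)) y (P x (α x)) - dirDeriv (fun z => p z (α x)) y (N x (X x)) +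
        N x (dirDeriv (fun z => p z (α x)) y (X x)) +
        (N x (P x (dirDeriv a y (X x))) - P x (dirDeriv a y (N x (X x)))) := by
  subst hp hn ha hy
  have he := chart_mem_atlas (CInf E) x
  have hy := coord_mem_dom (mem_chart_source (CInf E) x) hx
  simp only [lieBr, dirDeriv_vfRep_endo hN hU hX he hy, dirDeriv_vfRep_anchor hP hU hα he hy,
    vfRep_chartAt, endoRep_chartAt, anchorRep_chartAt, flatRep_chartAt, map_sub, map_add]
  abel

/-- The derivatives of X and Y cancel, so the difference depends on Y only through Y x. The part
with the derivative of α is visibly in T^♭M; membership of the rest is a genuine condition on N. -/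
theorem lieCovector_sub {N : M → E →ₗ[ℝ] E} {Nt : M → Eb →ₗ[ℝ] Eb}
    (hN : IsSmoothEndo N) (hNt : ∀ x ξ v, β.pair (Nt x ξ) v = β.pair ξ (N x v)) (hU : IsOpen U)
    {α : M → Eb} (hα : SmoothFlatSection β α U) {X Y : M → E} (hX : SmoothVF X U)
    (hY : SmoothVF Y U) (hx : x ∈ U) {n : E → E →ₗ[ℝ] E} {a : E → Eb} {y : E}
    (hn : n = endoRep (chartAt (CInf E) x) N)
    (ha : a = flatRep β (chartAt (CInf E) x) α) (hy : y = coord (chartAt (CInf E) x) x) :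
    lieCovector X (fun z => β.pair (Nt z (α z))) Y x -
        lieCovector (fun z => N z (X z)) (fun z => β.pair (α z)) Y x =
      β.pair (Nt x (dirDeriv a y (X x)) - dirDeriv a y (N x (X x))) (Y x) +
        β.pair (α x) (dirDeriv (fun z => n z (Y x)) y (X x) -
          dirDeriv (fun z => n z (X x)) y (Y x)) := by
  subst hn ha hy
  have he := chart_mem_atlas (CInf E) x
  have hy := coord_mem_dom (mem_chart_source (CInf E) x) hx
  have hD := cInfOpen_dom (e := chartAt (CInf E) x) hU
  have has := (smoothFlatSection_iff β).1 hα _ he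
  have hd : ∀ (Z : M → E), SmoothVF Z U → ∀ w, diffAt (fun z => β.pair (α z) (Z z)) x w =
      β.pair (dirDeriv (flatRep β (chartAt (CInf E) x) α) (coord (chartAt (CInf E) x) x) w) (Z x) +
        β.pair (α x) (dirDeriv (vfRep (chartAt (CInf E) x) Z)
          (coord (chartAt (CInf E) x) x) w) := by
    intro Z hZ w
    have h1 := dirDeriv_pair β hD has (hZ _ he) hy w
    rw [vfRep_chartAt, flatRep_chartAt] at h1
    rw [← h1]
    exact dirDeriv_congr hD (has.pair β (hZ _ he))
      (fun z hz => (pair_flatRep_vfRep β he α Z hz).symm) hy w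
  simp only [lieCovector, hNt]
  rw [hd Y hY, hd _ (hY.endo hN)]
  simp only [lieBr, dirDeriv_vfRep_endo hN hU hX he hy, dirDeriv_vfRep_endo hN hU hY he hy,
    vfRep_chartAt, endoRep_chartAt, map_sub, map_add, LinearMap.sub_apply, hNt]
  ring

theorem smoothFlatSection_const (he : e ∈ atlas (CInf E) M) (ξ : Eb) :
    SmoothFlatSection β (chartSection β e fun _ => ξ) e.source :=
  smoothFlatSection_chartSection β he subset_rfl (convSmoothOn_const ξ _)

theorem chartSection_chartAt (a : E → Eb) (x : M) :
    chartSection β (chartAt (CInf E) x) a x = a (coord (chartAt (CInf E) x) x) :=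
  fc_chartAt_symm _ _ _

/-- The derivative a' of the section enters the covector as N^t a'(X) - a'(NX), and the vector as
the image of this under P. It drops out, leaving a condition on values at a point that sections
constant in a chart can test. -/
theorem concomitantVanishes_iff {P : M → Eb →ₗ[ℝ] E} {N : M → E →ₗ[ℝ] E} {Nt : M → Eb →ₗ[ℝ] Eb}
    (hP : IsSmoothAnchor β P) (hN : IsSmoothEndo N)
    (hNt : ∀ x ξ v, β.pair (Nt x ξ) v = β.pair ξ (N x v))
    (hNP : ∀ x ξ, N x (P x ξ) = P x (Nt x ξ)) :
    ConcomitantVanishes β P N Nt ↔ ∀ x : M, ConcomitantVanishesAt β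
      (anchorRep β (chartAt (CInf E) x) P) (endoRep (chartAt (CInf E) x) N)
      (coord (chartAt (CInf E) x) x) := by
  constructor
  · intro h x ξ θ
    have he := chart_mem_atlas (CInf E) x
    have hx := mem_chart_source (CInf E) x
    have hU := (chartAt (CInf E) x).open_source
    have hξ := smoothFlatSection_const (β := β) he ξ
    have hθ := smoothFlatSection_const (β := β) he θ
    obtain ⟨γ, hγ, hγ'⟩ := h _ _ _ hU hξ hθ x hx
    have hd : ∀ w, dirDeriv (flatRep β (chartAt (CInf E) x)
        (chartSection β (chartAt (CInf E) x) fun _ => ξ)) (coord (chartAt (CInf E) x) x) w = 0 := by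
      intro w
      rw [dirDeriv_congr (cInfOpen_dom hU) (convSmoothOn_const ξ _)
        (fun y hy => flatRep_chartSection β (fun _ => ξ) hy) (coord_mem_dom hx hx), dirDeriv_const]
    refine ⟨γ, fun v => ?_, ?_⟩
    · have hv := smoothVF_const he v
      have h1 := hγ _ _ hU hx subset_rfl hv
      rw [lieCovector_sub hN hNt hU hξ (hθ.anchor hP) hv hx rfl rfl rfl, hd, hd] at h1
      simpa [chartField_chartAt, chartSection_chartAt, anchorRep_chartAt] using h1
    · rw [lieBr_anchor_endo hP hN hU hξ (hθ.anchor hP) hx rfl rfl rfl rfl, hd, hd] at hγ'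
      simpa [chartSection_chartAt, anchorRep_chartAt, endoRep_chartAt] using hγ'
  · intro h U α θ hU hα hθ x hx
    obtain ⟨γ, hγ, hγ'⟩ := h x (α x) (θ x)
    simp only [anchorRep_chartAt, endoRep_chartAt] at hγ hγ'
    -- The covector for the values of the sections, with the derivative of α restored.
    refine ⟨γ + (Nt x (dirDeriv (flatRep β (chartAt (CInf E) x) α) (coord (chartAt (CInf E) x) x)
      (P x (θ x))) - dirDeriv (flatRep β (chartAt (CInf E) x) α) (coord (chartAt (CInf E) x) x)
      (N x (P x (θ x)))), fun V Y hV hxV hVU hY => ?_, ?_⟩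
    · rw [lieCovector_sub hN hNt hV (hα.mono β hVU) ((hθ.mono β hVU).anchor hP) hY hxV rfl rfl rfl,
        map_add, LinearMap.add_apply, hγ, add_comm]
    · rw [lieBr_anchor_endo hP hN hU hα (hθ.anchor hP) hx rfl rfl rfl rfl, hγ', hNP, map_add,
        map_sub]

/-! ### Partial Poisson anchors -/

theorem dom_source : dom e e.source = dom e univ :=
  (dom_mono (subset_univ _)).antisymm fun _ hy => ⟨hy.1, pointAt_mem_source hy⟩

/-- Functions on the chart domain are enough: `exists_anchor_derivative` gives the derivative, and
the Jacobi identity for three linear functions, whose second derivatives vanish, leaves only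
derivatives of the anchor. -/
theorem IsPartialPoisson.isLocalPoisson {P : M → Eb →ₗ[ℝ] E} (hP : IsPartialPoisson β P)
    (he : e ∈ atlas (CInf E) M) : IsLocalPoisson β (anchorRep β e P) (dom e univ) := by
  rw [← dom_source]
  have hU := e.open_source
  have hD := cInfOpen_dom (e := e) hU
  have hp := (isSmoothAnchor_iff β).1 hP.smooth e he
  rw [← dom_source] at hp
  have hanti : ∀ y ∈ dom e e.source, ∀ ξ η, β.pair ξ (anchorRep β e P y η) =
    -β.pair η (anchorRep β e P y ξ) := fun y hy => pair_anchorRep_antisymm β he hP.antisymm hy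
  have hfun : ∀ (φ : E → ℝ), ConvSmoothOn φ (dom e e.source) →
      ConvSmoothOn (fun y => φ (coord e (pointAt e y))) (dom e e.source) ∧
      ∀ y ∈ dom e e.source, ∀ v,
        dirDeriv (fun y => φ (coord e (pointAt e y))) y v = dirDeriv φ y v := by
    intro φ hφ
    have hc : EqOn (fun y => φ (coord e (pointAt e y))) φ (dom e e.source) := fun y hy => by
      simp only [coord_pointAt hy]
    exact ⟨hφ.congr hc, fun y hy v => dirDeriv_congr hD hφ hc hy v⟩
  have hadm : ∀ (φ : E → ℝ) (a : E → Eb), ConvSmoothOn φ (dom e e.source) →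
      ConvSmoothOn a (dom e e.source) →
      (∀ y ∈ dom e e.source, ∀ v, β.pair (a y) v = dirDeriv φ y v) →
      IsAdmissible β (fun x => φ (coord e x)) e.source := fun φ a hφ ha h =>
    isAdmissible_of_chart β he hU subset_rfl (hfun φ hφ).1 ha fun y hy v => by
      rw [h y hy, (hfun φ hφ).2 y hy]
  have hbr : ∀ (φ ψ : E → ℝ) (a b : E → Eb), ConvSmoothOn φ (dom e e.source) →
      ConvSmoothOn ψ (dom e e.source) → ConvSmoothOn a (dom e e.source) →
      ConvSmoothOn b (dom e e.source) →
      (∀ y ∈ dom e e.source, ∀ v, β.pair (a y) v = dirDeriv φ y v) →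
      (∀ y ∈ dom e e.source, ∀ v, β.pair (b y) v = dirDeriv ψ y v) →
      ∀ y ∈ dom e e.source, poissonBr β P (fun x => φ (coord e x)) (fun x => ψ (coord e x))
        (pointAt e y) = -β.pair (a y) (anchorRep β e P y (b y)) :=
    fun φ ψ a b hφ hψ ha hb hφa hψb y hy =>
      poissonBr_pointAt β he hU P (hfun φ hφ).1
        (fun y hy v => by rw [hφa y hy, (hfun φ hφ).2 y hy]) (hfun ψ hψ).1
        (fun y hy v => by rw [hψb y hy, (hfun ψ hψ).2 y hy]) hy
  have hsm : ∀ a b : E → Eb, ConvSmoothOn a (dom e e.source) → ConvSmoothOn b (dom e e.source) →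
      ConvSmoothOn (fun y => -β.pair (a y) (anchorRep β e P y (b y))) (dom e e.source) :=
    fun a b ha hb => (ha.pair β (hp.apply_linear (convSmoothOn_id _) hb (mapsTo_id _))).neg
  obtain ⟨B, hB, hBv⟩ := exists_anchor_derivative β hD hp hanti
    fun φ ψ a b hφ hψ ha hb hφa hψb => by
      obtain ⟨c, hc, hcv⟩ := (hP.bracket_mem _ _ _ hU (hadm φ a hφ ha hφa)
        (hadm ψ b hψ hb hψb)).differential e he
      refine ⟨c, hc, fun y hy v => ?_⟩
      rw [hcv y hy]
      exact dirDeriv_congr hD (hsm a b ha hb) (hbr φ ψ a b hφ hψ ha hb hφa hψb) hy v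
  refine ⟨hp, hanti, ⟨B, hB, hBv⟩, fun y hy ξ η ζ => ?_⟩
  have hlin : ∀ ξ : Eb, ConvSmoothOn (fun y => β.pair ξ y) (dom e e.source) := fun ξ =>
    (convSmoothOn_const ξ _).pair β (convSmoothOn_id _)
  have hcon : ∀ ξ : Eb, ConvSmoothOn (fun _ : E => ξ) (dom e e.source) :=
    fun ξ => convSmoothOn_const ξ _
  have hlind : ∀ ξ : Eb, ∀ y ∈ dom e e.source, ∀ v, β.pair ξ v =
    dirDeriv (fun y => β.pair ξ y) y v := fun ξ y _ v => (dirDeriv_pair_const β ξ y v).symm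
  have hdd : ∀ ξ η, ∀ y ∈ dom e e.source, ∀ v, β.pair (-B y ξ η) v =
      dirDeriv (fun z => -β.pair ξ (anchorRep β e P z η)) y v := by
    intro ξ η y hy v
    rw [dirDeriv_neg_pair_apply β hD hp hanti (hcon ξ) (hcon η) hy, dirDeriv_const,
      dirDeriv_const, map_neg, LinearMap.neg_apply, hBv y hy]
    simp
  have key : ∀ ξ η ζ, poissonBr β P (fun x => β.pair ξ (coord e x))
      (poissonBr β P (fun x => β.pair η (coord e x)) (fun x => β.pair ζ (coord e x)))
        (pointAt e y) = -β.pair η (dirDeriv (fun z => anchorRep β e P z ζ) y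
          (anchorRep β e P y ξ)) := by
    intro ξ η ζ
    have hc : EqOn (fun y => poissonBr β P (fun x => β.pair η (coord e x))
        (fun x => β.pair ζ (coord e x)) (pointAt e y))
        (fun y => -β.pair η (anchorRep β e P y ζ)) (dom e e.source) := fun z hz =>
      hbr _ _ _ _ (hlin η) (hlin ζ) (hcon η) (hcon ζ) (hlind η) (hlind ζ) z hz
    have h1 := poissonBr_pointAt β he hU P (f := fun x => β.pair ξ (coord e x))
        (hfun _ (hlin ξ)).1 (a := fun _ => ξ)
        (fun y hy v => by rw [(hfun _ (hlin ξ)).2 y hy]; exact hlind ξ y hy v)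
        ((hsm _ _ (hcon η) (hcon ζ)).congr hc) (b := fun y => -B y η ζ)
        (fun y hy v => by
          rw [hdd η ζ y hy]
          exact (dirDeriv_congr hD (hsm _ _ (hcon η) (hcon ζ)) hc hy v).symm) hy
    rw [h1, hanti y hy, map_neg, LinearMap.neg_apply, hBv y hy, neg_neg]
  have hj := hP.jacobi e.source _ _ _ hU (hadm _ _ (hlin ξ) (hcon ξ) (hlind ξ))
    (hadm _ _ (hlin η) (hcon η) (hlind η)) (hadm _ _ (hlin ζ) (hcon ζ) (hlind ζ))
    (pointAt e y) (pointAt_mem_source hy)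
  rw [key, key, key] at hj
  linarith

/-- In the differential of a bracket, the derivatives of df and dg become covectors of E^♭ by their
symmetry, so only the derivative of the anchor has to be assumed; `hder` asks for it along given
sections, the form that local lifts can deliver. In the Jacobi sum the second derivatives of f, g, h
occur in pairs that cancel by symmetry. -/
theorem isPartialPoisson_of_local {P : M → Eb →ₗ[ℝ] E} (hs : IsSmoothAnchor β P)
    (hanti : ∀ (x : M) (ξ η : Eb), β.pair ξ (P x η) = -β.pair η (P x ξ))
    (hder : ∀ e ∈ atlas (CInf E) M, ∀ U : Set M, IsOpen U → ∀ a b : E → Eb,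
      ConvSmoothOn a (dom e U) → ConvSmoothOn b (dom e U) → ∃ c : E → Eb,
        ConvSmoothOn c (dom e U) ∧ ∀ y ∈ dom e U, ∀ v,
          β.pair (c y) v = β.pair (a y) (dirDeriv (fun z => anchorRep β e P z (b y)) y v))
    (hjac : ∀ e ∈ atlas (CInf E) M, ∀ y ∈ dom e univ, ∀ ξ η ζ,
      β.pair ξ (dirDeriv (fun z => anchorRep β e P z η) y (anchorRep β e P y ζ)) +
        β.pair η (dirDeriv (fun z => anchorRep β e P z ζ) y (anchorRep β e P y ξ)) +
          β.pair ζ (dirDeriv (fun z => anchorRep β e P z ξ) y (anchorRep β e P y η)) = 0) :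
    IsPartialPoisson β P := by
  have hbr : ∀ (e : OpenPartialHomeomorph M (CInf E)), e ∈ atlas (CInf E) M →
      ∀ (U : Set M) (f g : M → ℝ) (a b : E → Eb), IsOpen U →
      ConvSmoothOn (fun y => f (pointAt e y)) (dom e U) →
      ConvSmoothOn (fun y => g (pointAt e y)) (dom e U) →
      ConvSmoothOn a (dom e U) → ConvSmoothOn b (dom e U) →
      (∀ y ∈ dom e U, ∀ v, β.pair (a y) v = dirDeriv (fun z => f (pointAt e z)) y v) →
      (∀ y ∈ dom e U, ∀ v, β.pair (b y) v = dirDeriv (fun z => g (pointAt e z)) y v) →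
      ConvSmoothOn (fun y => poissonBr β P f g (pointAt e y)) (dom e U) ∧ ∃ c : E → Eb,
        ConvSmoothOn c (dom e U) ∧ (∀ y ∈ dom e U, ∀ v,
          β.pair (c y) v = dirDeriv (fun z => poissonBr β P f g (pointAt e z)) y v) ∧
        ∀ y ∈ dom e U, ∀ v, β.pair (c y) v =
          -β.pair (dirDeriv a y (anchorRep β e P y (b y))) v +
          β.pair (dirDeriv b y (anchorRep β e P y (a y))) v -
            β.pair (a y) (dirDeriv (fun z => anchorRep β e P z (b y)) y v) := by
    intro e he U f g a b hU hf hg ha hb hfa hgb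
    have hD := cInfOpen_dom (e := e) hU
    have hp := ((isSmoothAnchor_iff β).1 hs e he).mono
      (prod_mono (dom_mono (subset_univ U)) (subset_univ (univ : Set Eb)))
    have hsm : ConvSmoothOn (fun y => -β.pair (a y) (anchorRep β e P y (b y))) (dom e U) :=
      (ha.pair β (hp.apply_linear (convSmoothOn_id _) hb (mapsTo_id _))).neg
    have hc : EqOn (fun y => poissonBr β P f g (pointAt e y))
        (fun y => -β.pair (a y) (anchorRep β e P y (b y))) (dom e U) := fun y hy =>
      poissonBr_pointAt β he hU P hf hfa hg hgb hy
    obtain ⟨c, hcs, hcv⟩ := hder e he U hU a b ha hb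
    have hpa : ConvSmoothOn (fun y => anchorRep β e P y (a y)) (dom e U) :=
      hp.apply_linear (convSmoothOn_id _) ha (mapsTo_id _)
    have hpb : ConvSmoothOn (fun y => anchorRep β e P y (b y)) (dom e U) :=
      hp.apply_linear (convSmoothOn_id _) hb (mapsTo_id _)
    have hcv' : ∀ y ∈ dom e U, ∀ v, β.pair (-dirDeriv a y (anchorRep β e P y (b y)) +
          dirDeriv b y (anchorRep β e P y (a y)) - c y) v =
          -β.pair (dirDeriv a y (anchorRep β e P y (b y))) v +
          β.pair (dirDeriv b y (anchorRep β e P y (a y))) v -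
            β.pair (a y) (dirDeriv (fun z => anchorRep β e P z (b y)) y v) := by
      intro y hy v
      rw [← hcv y hy]
      simp
    refine ⟨hsm.congr hc, fun y => -dirDeriv a y (anchorRep β e P y (b y)) +
      dirDeriv b y (anchorRep β e P y (a y)) - c y,
      ((ha.dirDeriv_apply hD hpb).neg.add (hb.dirDeriv_apply hD hpa)).sub hcs, fun y hy v => ?_,
      hcv'⟩
    rw [dirDeriv_congr hD hsm hc hy, dirDeriv_neg_pair_apply β hD hp
      (fun y hy => pair_anchorRep_antisymm β he hanti hy) ha hb hy, hcv' y hy,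
      pair_dirDeriv_symm β hD hf ha hfa hy v, pair_dirDeriv_symm β hD hg hb hgb hy v]
    ring
  refine ⟨hs, hanti, fun U f g hU hf hg => ?_, fun U f g h hU hf hg hh x hx => ?_⟩
  · refine isAdmissible_of_differential β hU fun e he => ?_
    obtain ⟨a, ha, hfa⟩ := hf.differential e he
    obtain ⟨b, hb, hgb⟩ := hg.differential e he
    obtain ⟨h1, c, hc, hcv, -⟩ :=
      hbr e he U f g a b hU (hf.smooth e he) (hg.smooth e he) ha hb hfa hgb
    exact ⟨h1, c, hc, hcv⟩
  · have he := chart_mem_atlas (CInf E) x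
    set e := chartAt (CInf E) x
    have hxe : x ∈ e.source := mem_chart_source (CInf E) x
    have hy : coord e x ∈ dom e U := coord_mem_dom hxe hx
    have hD := cInfOpen_dom (e := e) hU
    obtain ⟨a, ha, hfa⟩ := hf.differential e he
    obtain ⟨b, hb, hgb⟩ := hg.differential e he
    obtain ⟨c, hc, hhc⟩ := hh.differential e he
    have key : ∀ (f g h : M → ℝ) (a b c : E → Eb), IsAdmissible β f U → IsAdmissible β g U →
        IsAdmissible β h U → ConvSmoothOn a (dom e U) → ConvSmoothOn b (dom e U) →
        ConvSmoothOn c (dom e U) →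
        (∀ y ∈ dom e U, ∀ v, β.pair (a y) v = dirDeriv (fun z => f (pointAt e z)) y v) →
        (∀ y ∈ dom e U, ∀ v, β.pair (b y) v = dirDeriv (fun z => g (pointAt e z)) y v) →
        (∀ y ∈ dom e U, ∀ v, β.pair (c y) v = dirDeriv (fun z => h (pointAt e z)) y v) →
        poissonBr β P f (poissonBr β P g h) x =
          -β.pair (dirDeriv b (coord e x) (anchorRep β e P (coord e x) (c (coord e x))))
            (anchorRep β e P (coord e x) (a (coord e x))) +
          β.pair (dirDeriv c (coord e x) (anchorRep β e P (coord e x) (b (coord e x))))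
            (anchorRep β e P (coord e x) (a (coord e x))) -
          β.pair (b (coord e x)) (dirDeriv (fun z => anchorRep β e P z (c (coord e x)))
            (coord e x) (anchorRep β e P (coord e x) (a (coord e x)))) := by
      intro f g h a b c hf hg hh ha hb hc hfa hgb hhc
      obtain ⟨h1, d, hd, hdv, hdv'⟩ :=
        hbr e he U g h b c hU (hg.smooth e he) (hh.smooth e he) hb hc hgb hhc
      have h2 := poissonBr_pointAt β he hU P (hf.smooth e he) hfa h1 hdv hy
      rw [pointAt_coord hxe, pair_anchorRep_antisymm β he hanti hy, neg_neg, hdv' _ hy] at h2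
      exact h2
    rw [key f g h a b c hf hg hh ha hb hc hfa hgb hhc, key g h f b c a hg hh hf hb hc ha hgb hhc hfa,
      key h f g c a b hh hf hg hc ha hb hhc hfa hgb]
    have hj := hjac e he (coord e x) (coord_mem_dom hxe (mem_univ x)) (a (coord e x))
      (b (coord e x)) (c (coord e x))
    have s1 := pair_dirDeriv_symm β hD (hf.smooth e he) ha hfa hy
      (anchorRep β e P (coord e x) (b (coord e x))) (anchorRep β e P (coord e x) (c (coord e x)))
    have s2 := pair_dirDeriv_symm β hD (hg.smooth e he) hb hgb hy
      (anchorRep β e P (coord e x) (a (coord e x))) (anchorRep β e P (coord e x) (c (coord e x)))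
    have s3 := pair_dirDeriv_symm β hD (hh.smooth e he) hc hhc hy
      (anchorRep β e P (coord e x) (a (coord e x))) (anchorRep β e P (coord e x) (b (coord e x)))
    linarith

end LocalForms
end

noncomputable section
open scoped ContDiff

/-! ## Reduction to an immersed submanifold, in charts -/

section LocalReduction

variable {E Eb F Fb : Type*}
  [AddCommGroup E] [Module ℝ E] [TopologicalSpace E] [ConvenientSpace E]
  [AddCommGroup Eb] [Module ℝ Eb] [TopologicalSpace Eb] [ConvenientSpace Eb]
  [AddCommGroup F] [Module ℝ F] [TopologicalSpace F] [ConvenientSpace F]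
  [AddCommGroup Fb] [Module ℝ Fb] [TopologicalSpace Fb] [ConvenientSpace Fb]

theorem dirDeriv_dirDeriv_apply {i : F → E} {W : Set F} (hW : CInfOpen W) (hi : ConvSmoothOn i W)
    {b : F → F} (hb : ConvSmoothOn b W) {y : F} (hy : y ∈ W) (u : F) :
    dirDeriv (fun z => dirDeriv i z (b z)) y u =
      dirDeriv (fun z => dirDeriv i z (b y)) y u + dirDeriv i y (dirDeriv b y u) := by
  classical
  -- Linearity of the derivative is known only on `W`; the extension by 0 makes it a family of
  -- linear maps on all of F, as the product rule requires.
  let Q : F → F →ₗ[ℝ] E := fun z => if hz : z ∈ W then dirDerivLin i hW hi hz else 0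
  have hQ : ∀ z ∈ W, ∀ v, Q z v = dirDeriv i z v := fun z hz v => by
    simp only [Q, dif_pos hz]; rfl
  have hQs : ConvSmoothOn (fun q : F × F => Q q.1 q.2) (W ×ˢ univ) :=
    (hi.dirDeriv hW).congr fun q hq => hQ q.1 hq.1 q.2
  have h1 := dirDeriv_family_const hW hQs hb hy u
  rw [← hQ y hy, ← dirDeriv_congr hW (hi.dirDeriv_apply hW hb) (fun z hz => hQ z hz (b z)) hy,
    ← dirDeriv_congr hW (hi.dirDeriv_const hW (b y)) (fun z hz => hQ z hz (b y)) hy]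
  exact h1

/-- Local representatives agree on overlaps by non-degeneracy of the pairing, so they glue without
partitions of unity. -/
theorem exists_section_of_local (β : FlatModel E Eb) {D : Set E} {L : E → E → ℝ}
    (h : ∀ y ∈ D, ∃ W, CInfOpen W ∧ y ∈ W ∧ W ⊆ D ∧ ∃ c : E → Eb, ConvSmoothOn c W ∧
      ∀ z ∈ W, ∀ v, β.pair (c z) v = L z v) :
    ∃ c : E → Eb, ConvSmoothOn c D ∧ ∀ y ∈ D, ∀ v, β.pair (c y) v = L y v := by
  have h0 : ∀ y, ∃ ξ : Eb, y ∈ D → ∀ v, β.pair ξ v = L y v := by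
    intro y
    by_cases hy : y ∈ D
    · obtain ⟨W, -, hyW, -, c, -, hc⟩ := h y hy
      exact ⟨c y, fun _ => hc y hyW⟩
    · exact ⟨0, fun hy' => absurd hy' hy⟩
  choose c hc using h0
  refine ⟨c, ConvSmoothOn.of_local fun y hy => ?_, fun y hy => hc y hy⟩
  obtain ⟨W, hW, hyW, hWD, c', hc's, hc'⟩ := h y hy
  refine ⟨W, hW, hyW, (hc's.mono inter_subset_left).congr fun z hz => β.ext_pair fun v => ?_⟩
  rw [hc z hz.2, hc' z hz.1]

/-- The coordinate expression of the data of the reduction to an immersed submanifold. -/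
structure IsLocalReduction (β : FlatModel E Eb) (βS : FlatModel F Fb) (p : E → Eb →ₗ[ℝ] E)
    (n : E → E →ₗ[ℝ] E) (i : F → E) (W : Set F) (p' : F → Fb →ₗ[ℝ] F) (n' : F → F →ₗ[ℝ] F) :
    Prop where
  isOpen : CInfOpen W
  smooth : ConvSmoothOn i W
  smooth_anchor : ConvSmoothOn (fun q : F × Fb => p' q.1 q.2) (W ×ˢ univ)
  smooth_endo : ConvSmoothOn (fun q : F × F => n' q.1 q.2) (W ×ˢ univ)
  injective : ∀ z ∈ W, Function.Injective (dirDeriv i z)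
  endo : ∀ z ∈ W, ∀ w, n (i z) (dirDeriv i z w) = dirDeriv i z (n' z w)
  anchor : ∀ z ∈ W, ∀ ξ ξ' v, (∀ w, β.pair ξ (dirDeriv i z w) = βS.pair ξ' w) →
    p (i z) ξ = dirDeriv i z v → p' z ξ' = v
  lift : ∀ W₁ ⊆ W, CInfOpen W₁ → ∀ a' : F → Fb, ConvSmoothOn a' W₁ → ∀ y ∈ W₁,
    ∃ W₂, CInfOpen W₂ ∧ y ∈ W₂ ∧ W₂ ⊆ W₁ ∧ ∃ a : F → Eb, ConvSmoothOn a W₂ ∧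
      (∀ z ∈ W₂, ∀ w, β.pair (a z) (dirDeriv i z w) = βS.pair (a' z) w) ∧
      ∀ z ∈ W₂, p (i z) (a z) = dirDeriv i z (p' z (a' z))
  pull : ∀ W₁ ⊆ W, CInfOpen W₁ → ∀ a : F → Eb, ConvSmoothOn a W₁ → ∃ a' : F → Fb,
    ConvSmoothOn a' W₁ ∧ ∀ z ∈ W₁, ∀ w, βS.pair (a' z) w = β.pair (a z) (dirDeriv i z w)

namespace IsLocalReduction

variable {β : FlatModel E Eb} {βS : FlatModel F Fb} {p : E → Eb →ₗ[ℝ] E}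
    {n : E → E →ₗ[ℝ] E} {i : F → E} {W : Set F} {p' : F → Fb →ₗ[ℝ] F} {n' : F → F →ₗ[ℝ] F}
    {D : Set E}

theorem dirDeriv_add (h : IsLocalReduction β βS p n i W p' n') {y : F} (hy : y ∈ W) (v w : F) :
    dirDeriv i y (v + w) = dirDeriv i y v + dirDeriv i y w :=
  _root_.dirDeriv_add h.isOpen h.smooth hy v w

theorem dirDeriv_sub (h : IsLocalReduction β βS p n i W p' n') {y : F} (hy : y ∈ W) (v w : F) :
    dirDeriv i y (v - w) = dirDeriv i y v - dirDeriv i y w := by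
  rw [eq_sub_iff_add_eq, ← h.dirDeriv_add hy, sub_add_cancel]

theorem dirDeriv_zero (h : IsLocalReduction β βS p n i W p' n') {y : F} (hy : y ∈ W) :
    dirDeriv i y 0 = 0 := by
  rw [← sub_self (0 : F), h.dirDeriv_sub hy, sub_self]

theorem symm (h : IsLocalReduction β βS p n i W p' n') {y : F} (hy : y ∈ W) (u w : F) :
    dirDeriv (fun z => dirDeriv i z w) y u = dirDeriv (fun z => dirDeriv i z u) y w :=
  dirDeriv_symm h.isOpen h.smooth hy w u

/-- Product rule in ⟨a, Di w⟩ = ⟨a', w⟩. Read backwards, it trades D²i for derivatives of a lift and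
of its pull-back. -/
theorem dirDeriv_lift (h : IsLocalReduction β βS p n i W p' n') {W₂ : Set F} (hW₂ : CInfOpen W₂)
    (hW : W₂ ⊆ W) {a : F → Eb} {a' : F → Fb} (ha : ConvSmoothOn a W₂) (ha' : ConvSmoothOn a' W₂)
    (haa : ∀ z ∈ W₂, ∀ w, β.pair (a z) (dirDeriv i z w) = βS.pair (a' z) w) {y : F} (hy : y ∈ W₂)
    (u w : F) : β.pair (dirDeriv a y u) (dirDeriv i y w) +
      β.pair (a y) (dirDeriv (fun z => dirDeriv i z w) y u) = βS.pair (dirDeriv a' y u) w := by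
  have hi := (h.smooth.mono hW).dirDeriv_const hW₂ w
  rw [← dirDeriv_pair β hW₂ ha hi hy]
  have h1 := dirDeriv_pair βS hW₂ ha' (convSmoothOn_const w _) hy u
  rw [dirDeriv_const, map_zero, add_zero] at h1
  rw [← h1]
  exact dirDeriv_congr hW₂ (ha'.pair βS (convSmoothOn_const w _)) (fun z hz => haa z hz w) hy u

/-- Product rule on both sides of p(i) a = Di(p' a'); the right side contributes the D²i term that
symmetry must later remove. -/
theorem dirDeriv_anchor (h : IsLocalReduction β βS p n i W p' n') (hD : CInfOpen D)
    (hp : ConvSmoothOn (fun q : E × Eb => p q.1 q.2) (D ×ˢ univ)) (hm : MapsTo i W D)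
    {W₂ : Set F} (hW₂ : CInfOpen W₂) (hW : W₂ ⊆ W) {a : F → Eb} {a' : F → Fb}
    (ha : ConvSmoothOn a W₂) (ha' : ConvSmoothOn a' W₂)
    (hpa : ∀ z ∈ W₂, p (i z) (a z) = dirDeriv i z (p' z (a' z))) {y : F} (hy : y ∈ W₂) (u : F) :
    dirDeriv (fun x => p x (a y)) (i y) (dirDeriv i y u) + p (i y) (dirDeriv a y u) =
      dirDeriv (fun z => dirDeriv i z (p' y (a' y))) y u +
        (dirDeriv i y (dirDeriv (fun z => p' z (a' y)) y u) +
          dirDeriv i y (p' y (dirDeriv a' y u))) := by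
  have hi := h.smooth.mono hW
  have hp' := h.smooth_anchor.mono (prod_mono hW (subset_univ (univ : Set Fb)))
  have hb : ConvSmoothOn (fun z => p' z (a' z)) W₂ :=
    hp'.apply_linear (convSmoothOn_id _) ha' (mapsTo_id _)
  rw [← dirDeriv_apply_linear hD hp hW₂ hi ha (fun z hz => hm (hW hz)) hy,
    ← h.dirDeriv_add (hW hy), ← dirDeriv_family_const hW₂ hp' ha' hy,
    ← dirDeriv_dirDeriv_apply hW₂ hi hb hy]
  exact dirDeriv_congr hW₂ (hi.dirDeriv_apply hW₂ hb) hpa hy u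

/-- Product rule on both sides of n(i) Di w = Di(n' w), with w fixed. -/
theorem dirDeriv_endo (h : IsLocalReduction β βS p n i W p' n') (hD : CInfOpen D)
    (hn : ConvSmoothOn (fun q : E × E => n q.1 q.2) (D ×ˢ univ)) (hm : MapsTo i W D)
    {y : F} (hy : y ∈ W) (u w : F) :
    dirDeriv (fun x => n x (dirDeriv i y w)) (i y) (dirDeriv i y u) +
        n (i y) (dirDeriv (fun z => dirDeriv i z w) y u) =
      dirDeriv (fun z => dirDeriv i z (n' y w)) y u +
        dirDeriv i y (dirDeriv (fun z => n' z w) y u) := by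
  have hi := h.smooth
  have hb : ConvSmoothOn (fun z => n' z w) W :=
    h.smooth_endo.apply_linear (convSmoothOn_id _) (convSmoothOn_const w _) (mapsTo_id _)
  rw [← dirDeriv_apply_linear hD hn h.isOpen hi (hi.dirDeriv_const h.isOpen w) hm hy,
    ← dirDeriv_dirDeriv_apply h.isOpen hi hb hy]
  exact dirDeriv_congr h.isOpen (hi.dirDeriv_apply h.isOpen hb) (fun z hz => h.endo z hz w) hy u

/-- Pair `dirDeriv_anchor` for b with a. Antisymmetry of p turns ⟨a, p(db)⟩ into a pairing of db
with a tangent vector, where `dirDeriv_lift` applies. The derivatives of b and b' cancel, and only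
D²i accompanies dp. -/
theorem pair_dirDeriv_anchor (h : IsLocalReduction β βS p n i W p' n') (hD : CInfOpen D)
    (hp : IsLocalPoisson β p D) (hm : MapsTo i W D)
    {W₂ : Set F} (hW₂ : CInfOpen W₂) (hW : W₂ ⊆ W) {a b : F → Eb} {a' b' : F → Fb}
    (ha : ∀ z ∈ W₂, ∀ w, β.pair (a z) (dirDeriv i z w) = βS.pair (a' z) w)
    (hpa : ∀ z ∈ W₂, p (i z) (a z) = dirDeriv i z (p' z (a' z)))
    (hb : ConvSmoothOn b W₂) (hb' : ConvSmoothOn b' W₂)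
    (hbb : ∀ z ∈ W₂, ∀ w, β.pair (b z) (dirDeriv i z w) = βS.pair (b' z) w)
    (hpb : ∀ z ∈ W₂, p (i z) (b z) = dirDeriv i z (p' z (b' z))) {y : F} (hy : y ∈ W₂) (v : F) :
    βS.pair (a' y) (dirDeriv (fun z => p' z (b' y)) y v) =
      β.pair (a y) (dirDeriv (fun x => p x (b y)) (i y) (dirDeriv i y v)) +
      β.pair (b y) (dirDeriv (fun z => dirDeriv i z (p' y (a' y))) y v) -
      β.pair (a y) (dirDeriv (fun z => dirDeriv i z (p' y (b' y))) y v) := by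
  have h1 := congrArg (β.pair (a y))
    (h.dirDeriv_anchor hD hp.smooth hm hW₂ hW hb hb' hpb hy v)
  have h2 := h.dirDeriv_lift hW₂ hW hb hb' hbb hy v (p' y (a' y))
  have hD' := hm (hW hy)
  have h3 : βS.pair (a' y) (p' y (dirDeriv b' y v)) =
      -βS.pair (dirDeriv b' y v) (p' y (a' y)) := by
    -- Antisymmetry of p' is not part of the data; it is inherited from p by lifting the covector
    -- db'(v).
    obtain ⟨W₃, hW₃, hy₃, -, c, -, hc, hpc⟩ := h.lift W₂ hW hW₂ _
      (convSmoothOn_const (dirDeriv b' y v) W₂) y hy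
    rw [← ha y hy, ← hc y hy₃, ← hpc y hy₃, ← hpa y hy, hp.antisymm _ hD']
  rw [map_add, map_add, map_add, ha y hy, ha y hy, hp.antisymm _ hD', hpa y hy, h3] at h1
  linarith

/-- The D²i terms of `pair_dirDeriv_anchor` do not visibly lie in the reduced bundle. By symmetry
and `dirDeriv_lift` each is the derivative of a section of that bundle minus the pull-back of the
derivative of its lift, and both are smooth sections. -/
theorem exists_derivative (h : IsLocalReduction β βS p n i W p' n') (hD : CInfOpen D)
    (hp : IsLocalPoisson β p D) (hm : MapsTo i W D) {W₁ : Set F} (hW₁ : CInfOpen W₁) (hW : W₁ ⊆ W)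
    {a' b' : F → Fb} (ha' : ConvSmoothOn a' W₁) (hb' : ConvSmoothOn b' W₁) {y : F} (hy : y ∈ W₁) :
    ∃ W₂, CInfOpen W₂ ∧ y ∈ W₂ ∧ W₂ ⊆ W₁ ∧ ∃ c : F → Fb, ConvSmoothOn c W₂ ∧
      ∀ z ∈ W₂, ∀ v, βS.pair (c z) v = βS.pair (a' z) (dirDeriv (fun x => p' x (b' z)) z v) := by
  obtain ⟨Wa, hWa, hya, hWa₁, a, ha, haa, hpa⟩ := h.lift W₁ hW hW₁ a' ha' y hy
  obtain ⟨W₂, hW₂, hy₂, hW₂a, b, hb, hbb, hpb⟩ :=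
    h.lift Wa (hWa₁.trans hW) hWa b' (hb'.mono hWa₁) y hya
  replace ha := ha.mono hW₂a
  have ha₂ := ha'.mono (hW₂a.trans hWa₁)
  have hb₂ := hb'.mono (hW₂a.trans hWa₁)
  have hW₂W := (hW₂a.trans hWa₁).trans hW
  have hp' := h.smooth_anchor.mono (prod_mono hW₂W (subset_univ (univ : Set Fb)))
  have hX : ConvSmoothOn (fun z => p' z (a' z)) W₂ :=
    hp'.apply_linear (convSmoothOn_id _) ha₂ (mapsTo_id _)
  have hY : ConvSmoothOn (fun z => p' z (b' z)) W₂ :=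
    hp'.apply_linear (convSmoothOn_id _) hb₂ (mapsTo_id _)
  obtain ⟨B, hB, hBv⟩ := hp.exists_derivative
  have hBs : ConvSmoothOn (fun z => B (i z) (a z) (b z)) W₂ :=
    hB.comp ((h.smooth.mono hW₂W).prodMk (ha.prodMk hb)) fun z hz => ⟨hm (hW₂W hz), mem_univ _⟩
  obtain ⟨d, hd, hdv⟩ := h.pull W₂ hW₂W hW₂
    (fun z => B (i z) (a z) (b z) + dirDeriv a z (p' z (b' z)) - dirDeriv b z (p' z (a' z)))
    ((hBs.add (ha.dirDeriv_apply hW₂ hY)).sub (hb.dirDeriv_apply hW₂ hX))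
  refine ⟨W₂, hW₂, hy₂, hW₂a.trans hWa₁,
    fun z => d z - dirDeriv a' z (p' z (b' z)) + dirDeriv b' z (p' z (a' z)),
    (hd.sub (ha₂.dirDeriv_apply hW₂ hY)).add (hb₂.dirDeriv_apply hW₂ hX), fun z hz v => ?_⟩
  have hzW := hW₂W hz
  rw [h.pair_dirDeriv_anchor hD hp hm hW₂ hW₂W (fun z hz => haa z (hW₂a hz))
    (fun z hz => hpa z (hW₂a hz)) hb hb₂ hbb hpb hz v]
  have h1 := h.dirDeriv_lift hW₂ hW₂W ha ha₂ (fun z hz => haa z (hW₂a hz)) hz (p' z (b' z)) v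
  have h2 := h.dirDeriv_lift hW₂ hW₂W hb hb₂ hbb hz (p' z (a' z)) v
  rw [h.symm hzW] at h1 h2
  simp only [map_add, map_sub, LinearMap.add_apply, LinearMap.sub_apply, hdv z hz,
    hBv _ (hm hzW)]
  linarith

/-- In the cyclic sum of `pair_dirDeriv_anchor` each D²i term meets its opposite with arguments
exchanged; the Jacobi identity of p on the lifts remains. -/
theorem jacobi (h : IsLocalReduction β βS p n i W p' n') (hD : CInfOpen D)
    (hp : IsLocalPoisson β p D) (hm : MapsTo i W D) {y : F} (hy : y ∈ W) (ξ η ζ : Fb) :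
    βS.pair ξ (dirDeriv (fun z => p' z η) y (p' y ζ)) +
      βS.pair η (dirDeriv (fun z => p' z ζ) y (p' y ξ)) +
        βS.pair ζ (dirDeriv (fun z => p' z ξ) y (p' y η)) = 0 := by
  obtain ⟨Wa, hWa, hya, hWaW, a, ha, haa, hpa⟩ :=
    h.lift W subset_rfl h.isOpen _ (convSmoothOn_const ξ W) y hy
  obtain ⟨Wb, hWb, hyb, hWba, b, hb, hbb, hpb⟩ :=
    h.lift Wa hWaW hWa _ (convSmoothOn_const η Wa) y hya
  obtain ⟨Wc, hWc, hyc, hWcb, c, hc, hcc, hpc⟩ :=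
    h.lift Wb (hWba.trans hWaW) hWb _ (convSmoothOn_const ζ Wb) y hyb
  have hWcW := (hWcb.trans hWba).trans hWaW
  replace ha := ha.mono (hWcb.trans hWba)
  replace hb := hb.mono hWcb
  replace haa := fun z (hz : z ∈ Wc) => haa z (hWba (hWcb hz))
  replace hpa := fun z (hz : z ∈ Wc) => hpa z (hWba (hWcb hz))
  replace hbb := fun z (hz : z ∈ Wc) => hbb z (hWcb hz)
  replace hpb := fun z (hz : z ∈ Wc) => hpb z (hWcb hz)
  have cst : ∀ ξ : Fb, ConvSmoothOn (fun _ : F => ξ) Wc := fun ξ => convSmoothOn_const ξ Wc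
  have e1 := h.pair_dirDeriv_anchor hD hp hm hWc hWcW haa hpa hb (cst η) hbb hpb hyc (p' y ζ)
  have e2 := h.pair_dirDeriv_anchor hD hp hm hWc hWcW hbb hpb hc (cst ζ) hcc hpc hyc (p' y ξ)
  have e3 := h.pair_dirDeriv_anchor hD hp hm hWc hWcW hcc hpc ha (cst ξ) haa hpa hyc (p' y η)
  rw [← hpc y hyc] at e1
  rw [← hpa y hyc] at e2
  rw [← hpb y hyc] at e3
  have hj := hp.jacobi (i y) (hm hy) (a y) (b y) (c y)
  rw [e1, e2, e3, h.symm hy (p' y ζ) (p' y ξ), h.symm hy (p' y ζ) (p' y η),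
    h.symm hy (p' y ξ) (p' y η)]
  linarith

/-- By injectivity of Di it is enough to compare images under Di. There `dirDeriv_endo` turns the
torsion of n' into that of n, all D²i terms cancelling by symmetry. -/
theorem torsion (h : IsLocalReduction β βS p n i W p' n') (hD : CInfOpen D)
    (hn : ConvSmoothOn (fun q : E × E => n q.1 q.2) (D ×ˢ univ)) (hm : MapsTo i W D)
    {y : F} (hy : y ∈ W) (hnt : ∀ u v, torsionAt n (i y) u v = 0) (u v : F) :
    torsionAt n' y u v = 0 := by
  refine h.injective y hy ?_
  rw [h.dirDeriv_zero hy, ← hnt (dirDeriv i y u) (dirDeriv i y v), torsionAt, torsionAt,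
    h.dirDeriv_sub hy, h.dirDeriv_add hy, h.dirDeriv_sub hy, ← h.endo y hy, ← h.endo y hy,
    h.endo y hy u, h.endo y hy v]
  have e1 := h.dirDeriv_endo hD hn hm hy (n' y u) v
  have e2 := h.dirDeriv_endo hD hn hm hy (n' y v) u
  have e3 := congrArg (n (i y)) (h.dirDeriv_endo hD hn hm hy v u)
  have e4 := congrArg (n (i y)) (h.dirDeriv_endo hD hn hm hy u v)
  rw [map_add, map_add] at e3 e4
  rw [h.symm hy (n' y u) v] at e1
  rw [h.symm hy (n' y v) u, h.symm hy (n' y v) (n' y u)] at e2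
  rw [h.symm hy v u] at e3
  linear_combination (norm := module) e2 - e1 - e3 + e4

/-- In the covector part `dirDeriv_lift` removes D²i. In the vector part n p = p n^t accounts for
the derivative of the lift, and the outcome is that p maps a lift of the new covector to a tangent
vector; `anchor` then gives its image under p'. -/
theorem concomitant (h : IsLocalReduction β βS p n i W p' n') (hD : CInfOpen D)
    (hp : ConvSmoothOn (fun q : E × Eb => p q.1 q.2) (D ×ˢ univ))
    (hn : ConvSmoothOn (fun q : E × E => n q.1 q.2) (D ×ˢ univ)) (hm : MapsTo i W D)
    {y : F} (hy : y ∈ W) {nt : Eb →ₗ[ℝ] Eb} (hnt : ∀ ξ v, β.pair (nt ξ) v = β.pair ξ (n (i y) v))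
    (hnp : ∀ ξ, n (i y) (p (i y) ξ) = p (i y) (nt ξ)) (hc : ConcomitantVanishesAt β p n (i y)) :
    ConcomitantVanishesAt βS p' n' y := by
  intro ξ θ
  obtain ⟨W₂, hW₂, hy₂, hW₂W, a, ha, haa, hpa⟩ :=
    h.lift W subset_rfl h.isOpen _ (convSmoothOn_const ξ W) y hy
  obtain ⟨W₃, -, hy₃, -, b, -, -, hpb⟩ :=
    h.lift W₂ hW₂W hW₂ _ (convSmoothOn_const θ W₂) y hy₂
  obtain ⟨γ, hγ, hγ'⟩ := hc (a y) (b y)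
  rw [hpb y hy₃, hpa y hy₂, h.endo y hy] at hγ'
  rw [hpb y hy₃] at hγ
  -- The lift of a constant covector need not be constant, so γ receives the same derivative
  -- correction as in `concomitantVanishes_iff` before being pulled back.
  obtain ⟨d, -, hd⟩ := h.pull W subset_rfl h.isOpen _ (convSmoothOn_const
    (γ + (nt (dirDeriv a y (p' y θ)) - dirDeriv a y (n' y (p' y θ)))) W)
  have cst : ConvSmoothOn (fun _ : F => ξ) W₂ := convSmoothOn_const ξ W₂
  refine ⟨d y, fun w => ?_, (h.anchor y hy _ _ _ (fun w => (hd y hy w).symm) ?_).symm⟩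
  · rw [hd y hy]
    have e1 := congrArg (β.pair (a y)) (h.dirDeriv_endo hD hn hm hy (p' y θ) w)
    have e2 := congrArg (β.pair (a y)) (h.dirDeriv_endo hD hn hm hy w (p' y θ))
    have l1 := h.dirDeriv_lift hW₂ hW₂W ha cst haa hy₂ (p' y θ) (n' y w)
    have l2 := h.dirDeriv_lift hW₂ hW₂W ha cst haa hy₂ (n' y (p' y θ)) w
    rw [dirDeriv_const, map_zero, LinearMap.zero_apply] at l1 l2
    rw [map_add, map_add, haa y hy₂] at e1 e2
    rw [h.symm hy w (p' y θ), h.symm hy w (n' y (p' y θ))] at e2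
    simp only [map_add, map_sub, LinearMap.add_apply, LinearMap.sub_apply, hnt, hγ, h.endo y hy]
    linarith
  · have e3 := h.dirDeriv_endo hD hn hm hy (p' y ξ) (p' y θ)
    have e4 := h.dirDeriv_anchor hD hp hm hW₂ hW₂W ha cst hpa hy₂ (n' y (p' y θ))
    have e5 := congrArg (n (i y)) (h.dirDeriv_anchor hD hp hm hW₂ hW₂W ha cst hpa hy₂ (p' y θ))
    rw [dirDeriv_const, map_zero, h.dirDeriv_zero hy, add_zero] at e4 e5
    rw [map_add, map_add] at e5
    rw [h.symm hy (n' y (p' y θ)) (p' y ξ)] at e4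
    rw [h.symm hy (p' y θ) (p' y ξ)] at e5
    rw [map_add, map_sub, ← hnp, ← hγ', h.dirDeriv_add hy, h.dirDeriv_sub hy,
      ← h.endo y hy (dirDeriv (fun z => p' z ξ) y (p' y θ))]
    linear_combination (norm := module) e3 - e4 + e5

end IsLocalReduction
end LocalReduction
end

noncomputable section
open scoped ContDiff

/-! ## Reduction to an immersed submanifold -/

section Reduction

variable {E Eb F Fb : Type*}
  [AddCommGroup E] [Module ℝ E] [TopologicalSpace E] [ConvenientSpace E]
  [AddCommGroup Eb] [Module ℝ Eb] [TopologicalSpace Eb] [ConvenientSpace Eb]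
  [AddCommGroup F] [Module ℝ F] [TopologicalSpace F] [ConvenientSpace F]
  [AddCommGroup Fb] [Module ℝ Fb] [TopologicalSpace Fb] [ConvenientSpace Fb]
  {M S : Type*}
  [TopologicalSpace M] [ChartedSpace (CInf E) M] [ConvManifold E M]
  [TopologicalSpace S] [ChartedSpace (CInf F) S] [ConvManifold F S]
  {e : OpenPartialHomeomorph M (CInf E)} {e' : OpenPartialHomeomorph S (CInf F)}
  {ι : S → M} {V : Set S} {m : S}

/-! ### The tangent map in charts -/

theorem tc_eq_dirDeriv (he : e ∈ atlas (CInf E) M) {x : M} (hx : x ∈ e.source) (v : E) :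
    tc e x v = dirDeriv (fun y => coord e (pointAt (chartAt (CInf E) x) y))
      (coord (chartAt (CInf E) x) x) v := tc_apply he hx v

/-- Chain rule through the preferred chart at ι m, in which the tangent map is defined. -/
theorem tc_tangentMapAt (hι : IsConvSmooth E F ι) (he : e ∈ atlas (CInf E) M)
    (he' : e' ∈ atlas (CInf F) S) (hm : m ∈ e'.source) (hιm : ι m ∈ e.source) (v : F) :
    tc e (ι m) (tangentMapAt E ι m v) =
      dirDeriv (fun y => coord e (ι (pointAt e' y))) (coord e' m) (tc e' m v) := by
  set c := chartAt (CInf E) (ι m) with hc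
  have hcA : c ∈ atlas (CInf E) M := chart_mem_atlas _ _
  have hcm : ι m ∈ c.source := mem_chart_source _ _
  have h1 : tangentMapAt E ι m v =
      dirDeriv (fun y => coord c (ι (pointAt e' y))) (coord e' m) (tc e' m v) :=
    diffAt_eq_tc he' (f := fun m' => coord c (ι m')) (c.open_source.preimage hι.continuous)
      (hι.smooth e' he' c hcA) hcm hm v
  have hU : IsOpen (ι ⁻¹' (c.source ∩ e.source)) :=
    (c.open_source.inter e.open_source).preimage hι.continuous
  have hy : coord e' m ∈ dom e' (ι ⁻¹' (c.source ∩ e.source)) := coord_mem_dom hm ⟨hcm, hιm⟩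
  have hs : ConvSmoothOn (fun y => coord c (ι (pointAt e' y)))
      (dom e' (ι ⁻¹' (c.source ∩ e.source))) :=
    (hι.smooth e' he' c hcA).mono (dom_mono fun x hx => hx.1)
  have hmaps : MapsTo (fun y => coord c (ι (pointAt e' y)))
      (dom e' (ι ⁻¹' (c.source ∩ e.source))) (dom c e.source) :=
    fun y hy => coord_mem_dom hy.2.1 hy.2.2
  have h2 := dirDeriv_comp (cInfOpen_dom hU) (cInfOpen_dom e.open_source)
    (convSmoothOn_change hcA he) hs hmaps hy (tc e' m v)
  rw [← h1] at h2
  simp only [pointAt_coord hm] at h2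
  rw [tc_eq_dirDeriv he hιm, ← hc, ← h2]
  refine dirDeriv_congr (cInfOpen_dom hU) ((hι.smooth e' he' e he).mono
    (dom_mono fun x hx => hx.2)) (fun y hy => ?_) hy _
  simp only [pointAt_coord (e := c) hy.2.1]

/-- The tangent map as a linear map. -/
def tangentMapLin (hι : IsConvSmooth E F ι) (m : S) : F →ₗ[ℝ] E :=
  dirDerivLin (fun y => coord (chartAt (CInf E) (ι m)) (ι (pointAt (chartAt (CInf F) m) y)))
    (cInfOpen_dom ((chartAt (CInf E) (ι m)).open_source.preimage hι.continuous))
    (hι.smooth _ (chart_mem_atlas _ m) _ (chart_mem_atlas _ (ι m)))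
    (coord_mem_dom (mem_chart_source _ m) (mem_chart_source (CInf E) (ι m)))

theorem tangentMapLin_apply (hι : IsConvSmooth E F ι) (m : S) (v : F) :
    tangentMapLin hι m v = tangentMapAt E ι m v := rfl

variable {β : FlatModel E Eb} [WeakSubbundle M β] {βS : FlatModel F Fb} [WeakSubbundle S βS]

theorem isPullback_iff (hι : IsConvSmooth E F ι) (he : e ∈ atlas (CInf E) M)
    (he' : e' ∈ atlas (CInf F) S) (hm : m ∈ e'.source) (hιm : ι m ∈ e.source) (ξ : Eb) (ξ' : Fb) :
    IsPullback β βS ι m ξ ξ' ↔ ∀ w, β.pair (fc β e (ι m) ξ)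
      (dirDeriv (fun y => coord e (ι (pointAt e' y))) (coord e' m) w) =
        βS.pair (fc βS e' m ξ') w := by
  rw [(tc e' m).surjective.forall]
  refine forall_congr' fun v => ?_
  rw [← tc_tangentMapAt hι he he' hm hιm, pair_fc β he hιm, pair_fc βS he' hm, eq_comm]

/-! ### Fields of elements of `T^♭M` along `ι` -/

theorem smoothFlatAlong_iff {α : S → Eb} :
    SmoothFlatAlong (F := F) β ι α V ↔
      ∀ e' ∈ atlas (CInf F) S, ∀ e ∈ atlas (CInf E) M,
        ConvSmoothOn (fun y => fc β e (ι (pointAt e' y)) (α (pointAt e' y)))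
          (dom e' (V ∩ ι ⁻¹' e.source)) := by
  refine forall₄_congr fun e' he' e he => ⟨?_, fun h => ⟨_, h, fun m hm hιm => ?_⟩⟩
  · rintro ⟨a, ha, h⟩
    refine ha.congr fun y hy => ?_
    have := h _ ⟨hy.2.1, pointAt_mem_source hy⟩ hy.2.2
    rw [flatCoord_iff β he hy.2.2, coord_pointAt hy] at this
    exact this
  · rw [flatCoord_iff β he hιm]
    simp only [pointAt_coord hm.2]

theorem smoothFlatAlong_of_chart (hι : IsConvSmooth E F ι) (he : e ∈ atlas (CInf E) M)
    (he' : e' ∈ atlas (CInf F) S) (hV : V ⊆ e'.source) (hιV : V ⊆ ι ⁻¹' e.source) {α : S → Eb}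
    (hα : ConvSmoothOn (fun y => fc β e (ι (pointAt e' y)) (α (pointAt e' y))) (dom e' V)) :
    SmoothFlatAlong (F := F) β ι α V := by
  rw [smoothFlatAlong_iff]
  intro e₁' he₁' e₁ he₁
  have h1 := (hι.smooth e₁' he₁' e₁ he₁).mono
    (dom_mono (inter_subset_right (s := V) (t := ι ⁻¹' e₁.source)))
  have h2 := ConvSmoothOn.change he' he₁' (f := fun m => fc β e (ι m) (α m)) hV hα
  refine ((convSmoothOn_fc_change β he₁ he).comp (h1.prodMk (h2.mono (dom_mono inter_subset_left)))
    fun y hy => ⟨coord_mem_dom hy.2.2 (hιV hy.2.1), mem_univ _⟩).congr fun y hy => ?_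
  simp only [pointAt_coord (e := e₁) hy.2.2, LinearEquiv.symm_apply_apply]

/-! ### The reduced maps -/

variable {P : M → Eb →ₗ[ℝ] E} {N : M → E →ₗ[ℝ] E}

/-- Local surjectivity of δι gives a lift, and (RpP 1) splits it; discarding the annihilating
summand keeps the pull-back and makes the image under P tangent to S. -/
theorem exists_lift_section (hβS : IsInducedSubbundle β βS ι) (hRpP1 : RpP1 F β P ι)
    (hV : IsOpen V) {α' : S → Fb} (hα' : SmoothFlatSection βS α' V) (hm : m ∈ V) :
    ∃ (W : Set S) (α : S → Eb) (X : S → F), IsOpen W ∧ m ∈ W ∧ W ⊆ V ∧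
      SmoothFlatAlong (F := F) β ι α W ∧ SmoothVF X W ∧
      (∀ m' ∈ W, IsPullback β βS ι m' (α m') (α' m')) ∧
      ∀ m' ∈ W, P (ι m') (α m') = tangentMapAt E ι m' (X m') := by
  obtain ⟨W₁, α, hW₁, hm₁, hW₁V, hα, hαα'⟩ := hβS.surjective V α' hV hα' m hm
  obtain ⟨W, α₁, α₂, hW, hmW, hWW₁, ⟨hα₁, X, hX, hPX⟩, ⟨-, hα₂⟩, hsum⟩ :=
    hRpP1 W₁ α hW₁ hα m hm₁
  refine ⟨W, α₁, X, hW, hmW, hWW₁.trans hW₁V, hα₁, hX, fun m' hm' v => ?_, hPX⟩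
  rw [hαα' m' (hWW₁ hm') v, hsum m' hm', map_add, LinearMap.add_apply, hα₂ m' hm', add_zero]

/-- The relation that defines the reduced anchor. -/
def AnchorRel (β : FlatModel E Eb) (βS : FlatModel F Fb) (P : M → Eb →ₗ[ℝ] E) (ι : S → M) (m : S)
    (ξ' : Fb) (v : F) : Prop :=
  ∃ ξ : Eb, IsPullback β βS ι m ξ ξ' ∧ P (ι m) ξ = tangentMapAt E ι m v

/-- A covector at m is the value of a section constant in the preferred chart, which lifts. -/
theorem exists_anchorRel (hβS : IsInducedSubbundle β βS ι) (hRpP1 : RpP1 F β P ι) (m : S)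
    (ξ' : Fb) : ∃ v, AnchorRel β βS P ι m ξ' v := by
  obtain ⟨W, α, X, -, hmW, -, -, -, h1, h2⟩ := exists_lift_section hβS hRpP1
    (chartAt (CInf F) m).open_source
    (smoothFlatSection_const (β := βS) (chart_mem_atlas (CInf F) m) ξ') (mem_chart_source _ m)
  refine ⟨X m, α m, ?_, h2 m hmW⟩
  have := h1 m hmW
  rwa [chartSection_chartAt] at this

theorem AnchorRel.comb (hι : IsConvSmooth E F ι) {ξ' η' : Fb} {v w : F}
    (h1 : AnchorRel β βS P ι m ξ' v) (h2 : AnchorRel β βS P ι m η' w) (r : ℝ) :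
    AnchorRel β βS P ι m (r • ξ' + η') (r • v + w) := by
  obtain ⟨ξ, hξ, hξv⟩ := h1
  obtain ⟨η, hη, hηw⟩ := h2
  refine ⟨r • ξ + η, fun u => ?_, ?_⟩
  · simp [hξ u, hη u]
  · simp only [← tangentMapLin_apply hι, map_add, map_smul] at *
    rw [hξv, hηw]

/-- The difference of two lifts annihilates S and has tangent image under P, so (RpP 2) kills this
image and injectivity of dι concludes. -/
theorem AnchorRel.unique (hι : IsInjectiveImmersion E F ι) (hRpP2 : RpP2 F β P ι) {ξ' : Fb}
    {v w : F} (h1 : AnchorRel β βS P ι m ξ' v) (h2 : AnchorRel β βS P ι m ξ' w) : v = w := by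
  have h3 := AnchorRel.comb hι.smooth h2 h1 (-1)
  obtain ⟨ξ, hξ, hξv⟩ := h3
  have h4 := hRpP2 m ξ ⟨_, hξv⟩ fun u => by rw [← hξ u]; simp
  rw [hξv, ← tangentMapLin_apply hι.smooth, ← map_zero (tangentMapLin hι.smooth m)] at h4
  have h5 := hι.injective_tangentMap m h4
  rw [neg_smul, one_smul, neg_add_eq_zero] at h5
  exact h5.symm

theorem exists_reducedAnchor (hι : IsInjectiveImmersion E F ι) (hβS : IsInducedSubbundle β βS ι)
    (hRpP1 : RpP1 F β P ι) (hRpP2 : RpP2 F β P ι) : ∃ P' : S → Fb →ₗ[ℝ] F,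
      ∀ (m : S) (ξ' : Fb) (v : F), P' m ξ' = v ↔
        ∃ ξ : Eb, IsPullback β βS ι m ξ ξ' ∧ P (ι m) ξ = tangentMapAt E ι m v := by
  choose p hp using exists_anchorRel (β := β) (βS := βS) (P := P) hβS hRpP1
  have huniq : ∀ m ξ' v, AnchorRel β βS P ι m ξ' v → p m ξ' = v := fun m ξ' v h =>
    (hp m ξ').unique hι hRpP2 h
  have hcomb : ∀ m ξ' η' (r : ℝ), p m (r • ξ' + η') = r • p m ξ' + p m η' := fun m ξ' η' r =>
    huniq m _ _ ((hp m ξ').comb hι.smooth (hp m η') r)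
  have hzero : ∀ m, p m 0 = 0 := fun m => huniq m _ _ ⟨0, fun u => by simp, by
    rw [← tangentMapLin_apply hι.smooth, map_zero, map_zero]⟩
  refine ⟨fun m => { toFun := p m
                     map_add' := fun ξ' η' => by simpa using hcomb m ξ' η' 1
                     map_smul' := fun r ξ' => by simpa [hzero] using hcomb m ξ' 0 r },
    fun m ξ' v => ⟨?_, huniq m ξ' v⟩⟩
  rintro rfl
  exact hp m ξ'

/-- (RpN) concerns fields; a single vector is extended to a field constant in the preferred chart.
-/
theorem exists_reducedEndo (hι : IsInjectiveImmersion E F ι) (hRpN : RpN F N ι) :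
    ∃ N' : S → F →ₗ[ℝ] F, ∀ (m : S) (v w : F), N' m v = w ↔
        tangentMapAt E ι m w = N (ι m) (tangentMapAt E ι m v) := by
  have h : ∀ (m : S) (v : F), ∃ w : F, tangentMapAt E ι m w = N (ι m) (tangentMapAt E ι m v) := by
    intro m v
    obtain ⟨Y, -, hY⟩ := hRpN _ _ (chartAt (CInf F) m).open_source
      (smoothVF_const (chart_mem_atlas (CInf F) m) v)
    have := hY m (mem_chart_source _ m)
    rw [chartField_chartAt] at this
    exact ⟨_, this.symm⟩
  choose n hn using h
  refine ⟨fun m => { toFun := n m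
                     map_add' := fun v w => hι.injective_tangentMap m ?_
                     map_smul' := fun r v => hι.injective_tangentMap m ?_ },
    fun m v w => ⟨?_, fun h => hι.injective_tangentMap m ((hn m v).trans h.symm)⟩⟩
  · simp only [← tangentMapLin_apply hι.smooth, map_add] at *
    rw [hn, hn, hn, map_add, map_add]
  · simp only [← tangentMapLin_apply hι.smooth, map_smul, RingHom.id_apply] at *
    rw [hn, hn, map_smul, map_smul]
  · rintro rfl
    exact hn m v

/-- By uniqueness the reduced field coincides near each point with the smooth tangent field that
comes with a lift. -/
theorem SmoothVF.reducedAnchor (hβS : IsInducedSubbundle β βS ι) (hRpP1 : RpP1 F β P ι)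
    {P' : S → Fb →ₗ[ℝ] F} (hP' : ∀ (m : S) (ξ' : Fb) (v : F), P' m ξ' = v ↔
      ∃ ξ : Eb, IsPullback β βS ι m ξ ξ' ∧ P (ι m) ξ = tangentMapAt E ι m v)
    (hV : IsOpen V) {α' : S → Fb} (hα' : SmoothFlatSection βS α' V) :
    SmoothVF (fun m => P' m (α' m)) V := by
  refine SmoothVF.of_local fun m hm => ?_
  obtain ⟨W, α, X, hW, hmW, hWV, -, hX, h1, h2⟩ := exists_lift_section hβS hRpP1 hV hα' hm
  exact ⟨W, hW, hmW, (hX.mono inter_subset_left).congr fun m' hm' =>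
    (hP' _ _ _).2 ⟨_, h1 m' hm'.1, h2 m' hm'.1⟩⟩

theorem SmoothVF.reducedEndo (hRpN : RpN F N ι) {N' : S → F →ₗ[ℝ] F}
    (hN' : ∀ (m : S) (v w : F), N' m v = w ↔
      tangentMapAt E ι m w = N (ι m) (tangentMapAt E ι m v)) (hV : IsOpen V) {X : S → F}
    (hX : SmoothVF X V) : SmoothVF (fun m => N' m (X m)) V := by
  obtain ⟨Y, hY, h⟩ := hRpN V X hV hX
  exact hY.congr fun m hm => (hN' _ _ _).2 (h m hm).symm

theorem SmoothFlatAlong.flatEndo (hι : IsConvSmooth E F ι) {Nt : M → Eb →ₗ[ℝ] Eb}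
    (hNt : IsFlatTranspose β N Nt) {α : S → Eb} (hα : SmoothFlatAlong (F := F) β ι α V) :
    SmoothFlatAlong (F := F) β ι (fun m => Nt (ι m) (α m)) V := by
  rw [smoothFlatAlong_iff] at *
  intro e' he' e he
  have h1 := (hι.smooth e' he' e he).mono
    (dom_mono (inter_subset_right (s := V) (t := ι ⁻¹' e.source)))
  refine (((smooth_flatEndo_iff β).1 hNt.smooth e he).apply_linear h1 (hα e' he' e he)
    fun y hy => coord_mem_dom hy.2.2 (mem_univ _)).congr fun y hy => ?_
  simp only [flatEndoRep_apply, pointAt_coord (e := e) hy.2.2, LinearEquiv.symm_apply_apply]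

/-- Lift, apply N^t along ι and pull back; the result is transposed to N' because N dι = dι N'. -/
theorem exists_reducedTranspose_section (hι : IsConvSmooth E F ι)
    (hβS : IsInducedSubbundle β βS ι) {Nt : M → Eb →ₗ[ℝ] Eb} (hNt : IsFlatTranspose β N Nt)
    {N' : S → F →ₗ[ℝ] F} (hN' : ∀ (m : S) (v w : F), N' m v = w ↔
      tangentMapAt E ι m w = N (ι m) (tangentMapAt E ι m v)) (hV : IsOpen V) {α' : S → Fb}
    (hα' : SmoothFlatSection βS α' V) (hm : m ∈ V) :
    ∃ (W : Set S) (γ' : S → Fb), IsOpen W ∧ m ∈ W ∧ W ⊆ V ∧ SmoothFlatSection βS γ' W ∧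
      ∀ m' ∈ W, ∀ v, βS.pair (γ' m') v = βS.pair (α' m') (N' m' v) := by
  obtain ⟨W, α, hW, hmW, hWV, hα, hαα'⟩ := hβS.surjective V α' hV hα' m hm
  obtain ⟨γ', hγ', h⟩ := hβS.maps W _ hW (hα.flatEndo hι hNt)
  refine ⟨W, γ', hW, hmW, hWV, hγ', fun m' hm' v => ?_⟩
  rw [h m' hm' v, hNt.transpose, ← (hN' m' v _).1 rfl, hαα' m' hm']

theorem exists_reducedTranspose (hι : IsConvSmooth E F ι)
    (hβS : IsInducedSubbundle β βS ι) {Nt : M → Eb →ₗ[ℝ] Eb} (hNt : IsFlatTranspose β N Nt)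
    {N' : S → F →ₗ[ℝ] F} (hN' : ∀ (m : S) (v w : F), N' m v = w ↔
      tangentMapAt E ι m w = N (ι m) (tangentMapAt E ι m v)) :
    ∃ Nt' : S → Fb →ₗ[ℝ] Fb, ∀ m ξ' v, βS.pair (Nt' m ξ') v = βS.pair ξ' (N' m v) := by
  have h : ∀ m ξ', ∃ η', ∀ v, βS.pair η' v = βS.pair ξ' (N' m v) := by
    intro m ξ'
    obtain ⟨W, γ', -, hmW, -, -, h⟩ := exists_reducedTranspose_section hι hβS hNt hN'
      (chartAt (CInf F) m).open_source
      (smoothFlatSection_const (β := βS) (chart_mem_atlas (CInf F) m) ξ') (mem_chart_source _ m)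
    refine ⟨γ' m, fun v => ?_⟩
    rw [h m hmW, chartSection_chartAt]
  choose n hn using h
  exact ⟨fun m => { toFun := n m
                    map_add' := fun ξ η => βS.ext_pair fun v => by simp [hn]
                    map_smul' := fun r ξ => βS.ext_pair fun v => by simp [hn] }, hn⟩

theorem SmoothFlatSection.reducedTranspose (hι : IsConvSmooth E F ι)
    (hβS : IsInducedSubbundle β βS ι) {Nt : M → Eb →ₗ[ℝ] Eb} (hNt : IsFlatTranspose β N Nt)
    {N' : S → F →ₗ[ℝ] F} (hN' : ∀ (m : S) (v w : F), N' m v = w ↔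
      tangentMapAt E ι m w = N (ι m) (tangentMapAt E ι m v)) {Nt' : S → Fb →ₗ[ℝ] Fb}
    (hNt' : ∀ m ξ' v, βS.pair (Nt' m ξ') v = βS.pair ξ' (N' m v)) (hV : IsOpen V) {α' : S → Fb}
    (hα' : SmoothFlatSection βS α' V) : SmoothFlatSection βS (fun m => Nt' m (α' m)) V := by
  refine SmoothFlatSection.of_local βS fun m hm => ?_
  obtain ⟨W, γ', hW, hmW, -, hγ', h⟩ := exists_reducedTranspose_section hι hβS hNt hN' hV hα' hm
  exact ⟨W, hW, hmW, (hγ'.mono βS inter_subset_left).congr βS fun m' hm' =>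
    βS.ext_pair fun v => by rw [hNt', h m' hm'.1]⟩

/-! ### Smoothness of bundle maps that preserve smooth sections -/

/-- The hypothesis concerns one section at a time; joint smoothness in point and covector is
supplied by `convSmoothOn_of_sections`. -/
theorem isSmoothAnchor_of_sections {P' : S → Fb →ₗ[ℝ] F}
    (h : ∀ (V : Set S) (α' : S → Fb), IsOpen V → SmoothFlatSection βS α' V →
      SmoothVF (fun m => P' m (α' m)) V) : IsSmoothAnchor βS P' := by
  rw [isSmoothAnchor_iff]
  intro e' he'
  rw [← dom_source]
  refine convSmoothOn_of_sections (cInfOpen_dom e'.open_source) (fun a ha => ?_) id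
  refine (h _ _ e'.open_source (smoothFlatSection_chartSection βS he' subset_rfl ha) e' he').congr
    fun y hy => ?_
  rw [vfRep_anchor βS he' P' _ hy, flatRep_chartSection βS a hy]

theorem isSmoothEndo_of_sections {N' : S → F →ₗ[ℝ] F}
    (h : ∀ (V : Set S) (X : S → F), IsOpen V → SmoothVF X V →
      SmoothVF (fun m => N' m (X m)) V) : IsSmoothEndo N' := by
  rw [isSmoothEndo_iff]
  intro e' he'
  rw [← dom_source]
  refine convSmoothOn_of_sections (cInfOpen_dom e'.open_source) (fun a ha => ?_) id
  refine (h _ _ e'.open_source (smoothVF_chartField he' subset_rfl ha) e' he').congr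
    fun y hy => ?_
  rw [vfRep_endo he' N' _ hy, vfRep_chartField he' a hy]

theorem smooth_flatEndo_of_sections {Nt' : S → Fb →ₗ[ℝ] Fb}
    (h : ∀ (V : Set S) (α' : S → Fb), IsOpen V → SmoothFlatSection βS α' V →
      SmoothFlatSection βS (fun m => Nt' m (α' m)) V) :
    ∀ e' ∈ atlas (CInf F) S, ConvSmoothOn (fun q : F × Fb => flatEndoRep βS e' Nt' q.1 q.2)
      (dom e' univ ×ˢ univ) := by
  intro e' he'
  rw [← dom_source]
  refine convSmoothOn_of_sections (cInfOpen_dom e'.open_source) (fun a ha => ?_) fun hF => ?_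
  · refine ((smoothFlatSection_iff βS).1 (h _ _ e'.open_source
      (smoothFlatSection_chartSection βS he' subset_rfl ha)) e' he').congr fun y hy => ?_
    rw [flatRep_flatEndo, flatRep_chartSection βS a hy]
  -- Over a zero-dimensional S the bundle T^♭S is trivial, being embedded in the dual of the zero
  -- space.
  · exact subsingleton_of_forall_eq 0 fun ξ => βS.injective ξ fun v => by
      rw [Subsingleton.elim v 0, map_zero]

/-! ### The reduction in charts -/

theorem isLocalReduction (hι : IsInjectiveImmersion E F ι) (hβS : IsInducedSubbundle β βS ι)
    (hRpP1 : RpP1 F β P ι) {P' : S → Fb →ₗ[ℝ] F} (hP's : IsSmoothAnchor βS P')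
    (hP' : ∀ (m : S) (ξ' : Fb) (v : F), P' m ξ' = v ↔
      ∃ ξ : Eb, IsPullback β βS ι m ξ ξ' ∧ P (ι m) ξ = tangentMapAt E ι m v)
    {N' : S → F →ₗ[ℝ] F} (hN's : IsSmoothEndo N') (hN' : ∀ (m : S) (v w : F), N' m v = w ↔
      tangentMapAt E ι m w = N (ι m) (tangentMapAt E ι m v))
    (he : e ∈ atlas (CInf E) M) (he' : e' ∈ atlas (CInf F) S) :
    IsLocalReduction β βS (anchorRep β e P) (endoRep e N)
      (fun y => coord e (ι (pointAt e' y))) (dom e' (ι ⁻¹' e.source))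
      (anchorRep βS e' P') (endoRep e' N') := by
  have hs := hι.smooth
  have hd : ∀ z ∈ dom e' (ι ⁻¹' e.source), ∀ v,
      dirDeriv (fun y => coord e (ι (pointAt e' y))) z (tc e' (pointAt e' z) v) =
        tc e (ι (pointAt e' z)) (tangentMapAt E ι (pointAt e' z) v) := fun z hz v => by
    rw [tc_tangentMapAt hs he he' (pointAt_mem_source hz) hz.2, coord_pointAt hz]
  have hpull : ∀ z ∈ dom e' (ι ⁻¹' e.source), ∀ ξ ξ',
      IsPullback β βS ι (pointAt e' z) ξ ξ' ↔ ∀ w, β.pair (fc β e (ι (pointAt e' z)) ξ)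
        (dirDeriv (fun y => coord e (ι (pointAt e' y))) z w) =
          βS.pair (fc βS e' (pointAt e' z) ξ') w := fun z hz ξ ξ' => by
    rw [isPullback_iff hs he he' (pointAt_mem_source hz) hz.2, coord_pointAt hz]
  refine ⟨cInfOpen_dom (e.open_source.preimage hs.continuous), hs.smooth e' he' e he,
    ((isSmoothAnchor_iff βS).1 hP's e' he').mono
      (prod_mono (dom_mono (subset_univ _)) (subset_univ _)),
    (isSmoothEndo_iff.1 hN's e' he').mono (prod_mono (dom_mono (subset_univ _)) (subset_univ _)),
    fun z hz v w hvw => ?_, fun z hz w => ?_, fun z hz ξ ξ' v h1 h2 => ?_,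
    fun W₁ hW hW₁ a' ha' y hy => ?_, fun W₁ hW hW₁ a ha => ?_⟩
  · obtain ⟨v, rfl⟩ := (tc e' (pointAt e' z)).surjective v
    obtain ⟨w, rfl⟩ := (tc e' (pointAt e' z)).surjective w
    rw [hd z hz, hd z hz] at hvw
    rw [hι.injective_tangentMap _ ((tc e _).injective hvw)]
  · obtain ⟨w, rfl⟩ := (tc e' (pointAt e' z)).surjective w
    rw [hd z hz, endoRep_apply, endoRep_apply, pointAt_coord hz.2, LinearEquiv.symm_apply_apply,
      LinearEquiv.symm_apply_apply, hd z hz, (hN' _ w _).1 rfl]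
  · obtain ⟨ξ, rfl⟩ := (fc β e (ι (pointAt e' z))).surjective ξ
    obtain ⟨ξ', rfl⟩ := (fc βS e' (pointAt e' z)).surjective ξ'
    obtain ⟨v, rfl⟩ := (tc e' (pointAt e' z)).surjective v
    rw [hd z hz, anchorRep_apply, pointAt_coord hz.2, LinearEquiv.symm_apply_apply] at h2
    rw [anchorRep_apply, LinearEquiv.symm_apply_apply,
      (hP' _ ξ' v).2 ⟨ξ, (hpull z hz ξ ξ').2 h1, (tc e _).injective h2⟩]
  -- The coordinate section is carried to S, where sections lift, and the lift is read again in the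
  -- two charts.
  · have hVo := isOpen_chartPart (e := e') hW₁
    have hVd := dom_chartPart hW
    have hα' := smoothFlatSection_chartSection βS he'
      (chartPart_subset_source (e := e') (W := W₁)) (a := a') (by rwa [hVd])
    have hmV : pointAt e' y ∈ chartPart e' W₁ := by
      rw [← hVd] at hy; exact hy.2
    obtain ⟨W, α, X, hWo, hmW, hWV, hα, hX, h1, h2⟩ :=
      exists_lift_section hβS hRpP1 hVo hα' hmV
    have hWW₁ : dom e' W ⊆ W₁ := by
      rw [← hVd]; exact dom_mono hWV
    have hWs : dom e' W ⊆ dom e' (W ∩ ι ⁻¹' e.source) := fun z hz =>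
      ⟨hz.1, hz.2, (hW (hWW₁ hz)).2⟩
    have hfa : ∀ z ∈ dom e' W,
        fc βS e' (pointAt e' z) (chartSection βS e' a' (pointAt e' z)) = a' z := fun z hz =>
      flatRep_chartSection βS a' hz
    refine ⟨dom e' W, cInfOpen_dom hWo, ⟨(hW hy).1, hmW⟩, hWW₁, _,
      ((smoothFlatAlong_iff.1 hα) e' he' e he).mono hWs, fun z hz w => ?_, fun z hz => ?_⟩
    · rw [← hfa z hz]
      exact (hpull z (hW (hWW₁ hz)) _ _).1 (h1 _ hz.2) w
    · have h3 := (hP' (pointAt e' z) (chartSection βS e' a' (pointAt e' z)) _).2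
        ⟨_, h1 _ hz.2, h2 _ hz.2⟩
      rw [anchorRep_apply, pointAt_coord (hW (hWW₁ hz)).2, LinearEquiv.symm_apply_apply,
        ← hfa z hz, anchorRep_apply, LinearEquiv.symm_apply_apply, h3, hd z (hW (hWW₁ hz)),
        h2 _ hz.2]
  · have hVo := isOpen_chartPart (e := e') hW₁
    have hVd := dom_chartPart hW
    have hα : SmoothFlatAlong (F := F) β ι (fun m => (fc β e (ι m)).symm (a (coord e' m)))
        (chartPart e' W₁) := by
      refine smoothFlatAlong_of_chart hs he he' chartPart_subset_source (fun m hm => ?_) ?_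
      · have := (hW hm.2).2
        rwa [pointAt_coord hm.1] at this
      · rw [hVd]
        refine ha.congr fun z hz => ?_
        simp only [LinearEquiv.apply_symm_apply, coord_pointAt (hW hz)]
    obtain ⟨α', hα', h⟩ := hβS.maps _ _ hVo hα
    refine ⟨flatRep βS e' α', ?_, fun z hz w => ?_⟩
    · rw [← hVd]
      exact (smoothFlatSection_iff βS).1 hα' e' he'
    · have hz' : pointAt e' z ∈ chartPart e' W₁ := by
        rw [← hVd] at hz; exact hz.2
      have := (hpull z (hW hz) _ _).1 (h _ hz') w
      rw [LinearEquiv.apply_symm_apply, coord_pointAt (hW hz)] at this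
      exact this.symm

end Reduction

end

/-! ### The reduction theorem. -/

theorem mainTheorem8
    {E Eb F Fb : Type*}
    [AddCommGroup E] [Module ℝ E] [TopologicalSpace E] [ConvenientSpace E]
    [AddCommGroup Eb] [Module ℝ Eb] [TopologicalSpace Eb] [ConvenientSpace Eb]
    [AddCommGroup F] [Module ℝ F] [TopologicalSpace F] [ConvenientSpace F]
    [AddCommGroup Fb] [Module ℝ Fb] [TopologicalSpace Fb] [ConvenientSpace Fb]
    {M S : Type*}
    [TopologicalSpace M] [ChartedSpace (CInf E) M] [ConvManifold E M]
    [TopologicalSpace S] [ChartedSpace (CInf F) S] [ConvManifold F S]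
    (β : FlatModel E Eb) [WeakSubbundle M β]
    (P : M → Eb →ₗ[ℝ] E) (N : M → E →ₗ[ℝ] E) (hPN : IsPartialPN β P N)
    (ι : S → M) (hι : IsInjectiveImmersion E F ι)
    (βS : FlatModel F Fb) [WeakSubbundle S βS] (hβS : IsInducedSubbundle β βS ι)
    (hRpP1 : RpP1 F β P ι) (hRpP2 : RpP2 F β P ι) (hRpN : RpN F N ι) :
    ∃ (P' : S → Fb →ₗ[ℝ] F) (N' : S → F →ₗ[ℝ] F),
      (∀ (m : S) (ξ' : Fb) (v : F), P' m ξ' = v ↔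
        ∃ ξ : Eb, IsPullback β βS ι m ξ ξ' ∧ P (ι m) ξ = tangentMapAt E ι m v) ∧
      (∀ (m : S) (v w : F), N' m v = w ↔
        tangentMapAt E ι m w = N (ι m) (tangentMapAt E ι m v)) ∧
      IsPartialPN βS P' N' := by
  obtain ⟨P', hP'⟩ := exists_reducedAnchor hι hβS hRpP1 hRpP2
  obtain ⟨N', hN'⟩ := exists_reducedEndo hι hRpN
  obtain ⟨Nt, hNt, hNP, hconc⟩ := hPN.compatible
  obtain ⟨Nt', hNt'⟩ := exists_reducedTranspose hι.smooth hβS hNt hN'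
  have hP's : IsSmoothAnchor βS P' := isSmoothAnchor_of_sections fun V α' hV hα' =>
    SmoothVF.reducedAnchor hβS hRpP1 hP' hV hα'
  have hN's : IsSmoothEndo N' := isSmoothEndo_of_sections fun V X hV hX =>
    SmoothVF.reducedEndo hRpN hN' hV hX
  have hNt's := smooth_flatEndo_of_sections (Nt' := Nt') fun V α' hV hα' =>
    SmoothFlatSection.reducedTranspose hι.smooth hβS hNt hN' hNt' hV hα'
  have hlift : ∀ (m : S) (ξ' : Fb), ∃ ξ, IsPullback β βS ι m ξ ξ' ∧
      P (ι m) ξ = tangentMapAt E ι m (P' m ξ') := fun m ξ' => (hP' m ξ' _).1 rfl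
  have hN'ι : ∀ (m : S) (v : F), tangentMapAt E ι m (N' m v) = N (ι m) (tangentMapAt E ι m v) := fun m v =>
    (hN' m v _).1 rfl
  -- If ξ lifts ξ', then N^t ξ lifts the transposed covector, and P maps it to N dι(P' ξ') = dι(N'
  -- P' ξ').
  have hN'P' : ∀ m ξ', N' m (P' m ξ') = P' m (Nt' m ξ') := by
    intro m ξ'
    obtain ⟨ξ, hξ, hPξ⟩ := hlift m ξ'
    refine ((hP' _ _ _).2 ⟨Nt (ι m) ξ, fun v => ?_, ?_⟩).symm
    · rw [hNt', hξ, hNt.transpose, hN'ι]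
    · rw [← hNP, hPξ, hN'ι]
  have hanti : ∀ m ξ' η', βS.pair ξ' (P' m η') = -βS.pair η' (P' m ξ') := by
    intro m ξ' η'
    obtain ⟨ξ, hξ, hPξ⟩ := hlift m ξ'
    obtain ⟨η, hη, hPη⟩ := hlift m η'
    rw [hξ, hη, ← hPξ, ← hPη, hPN.poisson.antisymm]
  have hred := fun (e : OpenPartialHomeomorph M (CInf E)) (he : e ∈ atlas (CInf E) M)
    (e' : OpenPartialHomeomorph S (CInf F)) (he' : e' ∈ atlas (CInf F) S) =>
    isLocalReduction hι hβS hRpP1 hP's hP' hN's hN' he he'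
  have hmaps : ∀ (e : OpenPartialHomeomorph M (CInf E)) (e' : OpenPartialHomeomorph S (CInf F)),
      MapsTo (fun y => coord e (ι (pointAt e' y))) (dom e' (ι ⁻¹' e.source)) (dom e univ) :=
    fun e e' y hy => coord_mem_dom hy.2 (mem_univ _)
  have hD : ∀ e : OpenPartialHomeomorph M (CInf E), CInfOpen (dom e univ) := fun e =>
    cInfOpen_dom isOpen_univ
  have hcenter : ∀ m : S, coord (chartAt (CInf F) m) m ∈
      dom (chartAt (CInf F) m) (ι ⁻¹' (chartAt (CInf E) (ι m)).source) := fun m =>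
    coord_mem_dom (mem_chart_source _ m) (mem_chart_source (CInf E) (ι m))
  have hpt : ∀ m : S, pointAt (chartAt (CInf F) m) (coord (chartAt (CInf F) m) m) = m := fun m =>
    pointAt_coord (mem_chart_source _ m)
  refine ⟨P', N', hP', hN', ?_, hN's, ?_, Nt', ⟨hNt', (smooth_flatEndo_iff βS).2 hNt's⟩, hN'P', ?_⟩
  · refine isPartialPoisson_of_local hP's hanti (fun e' he' U hU a b ha hb => ?_)
      fun e' he' y hy ξ η ζ => ?_
    -- Lifts exist only near a point and in a chart of M about its image; the resulting covectors
    -- are glued afterwards.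
    · refine exists_section_of_local βS fun y hy => ?_
      have he := chart_mem_atlas (CInf E) (ι (pointAt e' y))
      have hW₁ : IsOpen (U ∩ ι ⁻¹' (chartAt (CInf E) (ι (pointAt e' y))).source) :=
        hU.inter ((chartAt (CInf E) _).open_source.preimage hι.smooth.continuous)
      obtain ⟨W₂, h1, h2, h3, c, h4, h5⟩ := (hred _ he e' he').exists_derivative (hD _)
        (hPN.poisson.isLocalPoisson he) (hmaps _ e') (cInfOpen_dom hW₁)
        (dom_mono inter_subset_right) (ha.mono (dom_mono inter_subset_left))
        (hb.mono (dom_mono inter_subset_left))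
        (show y ∈ _ from ⟨hy.1, hy.2, mem_chart_source (CInf E) _⟩)
      exact ⟨W₂, h1, h2, h3.trans (dom_mono inter_subset_left), c, h4, h5⟩
    · have he := chart_mem_atlas (CInf E) (ι (pointAt e' y))
      exact (hred _ he e' he').jacobi (hD _) (hPN.poisson.isLocalPoisson he) (hmaps _ e')
        ⟨hy.1, mem_chart_source (CInf E) _⟩ ξ η ζ
  · rw [isNijenhuis_iff hN's]
    intro m u v
    have he := chart_mem_atlas (CInf E) (ι m)
    refine (hred _ he _ (chart_mem_atlas (CInf F) m)).torsion (hD _)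
      (isSmoothEndo_iff.1 hPN.smooth _ he) (hmaps _ _) (hcenter m) ?_ u v
    simp only [hpt]
    exact (isNijenhuis_iff hPN.smooth).1 hPN.nijenhuis (ι m)
  · rw [concomitantVanishes_iff hP's hN's hNt' hN'P']
    intro m
    have he := chart_mem_atlas (CInf E) (ι m)
    refine (hred _ he _ (chart_mem_atlas (CInf F) m)).concomitant (hD _)
      ((isSmoothAnchor_iff β).1 hPN.poisson.smooth _ he) (isSmoothEndo_iff.1 hPN.smooth _ he)
      (hmaps _ _) (hcenter m) (nt := Nt (ι m)) ?_ ?_ ?_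
    · simp only [hpt, endoRep_chartAt]
      exact hNt.transpose (ι m)
    · simp only [hpt, endoRep_chartAt, anchorRep_chartAt]
      exact hNP (ι m)
    · simp only [hpt]
      exact (concomitantVanishes_iff hPN.poisson.smooth hPN.smooth hNt.transpose hNP).1 hconc (ι m)
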